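/- Let $H$ and $U$ be separable real Hilbert spaces, and let $V$ be a real reflexive Banach space that is continuously, densely and compactly embedded into $H$. Identify $H$ with its dual, so that $V\subseteq H\subseteq V^*$, with $\langle y,v\rangle=(y,v)_H$ for $y\in H$, $v\in V$. Let $L_2(U,H)$ be the space of Hilbert–Schmidt operators from $U$ to $H$, with norm $\|\cdot\|_{L_2}$. Let $T>0$, and let $A:[0,T]\times V\to V^*$ and $B:[0,T]\times V\to L_2(U,H)$ be (Borel) measurable. Let $f\in L^1([0,T],\mathbb R_+)$, $\alpha\in(1,\infty)$ and $\beta\in[0,\infty)$, and assume the following. (H1*) For a.e. $t\in[0,T]$ and all $u,v,x\in V$, the map $\lambda\mapsto\langle A(t,u+\lambda v),x\rangle$ is continuous on $\mathbb R$. (H2*) There are constants $\theta\in[0,\alpha)$, $\delta>0$, $\gamma,\kappa,C\ge 0$ and measurable functions $\rho,\eta:V\to\mathbb R$ with $$|\rho(u)|\le C(1+\|u\|_H^{\kappa})+C\|u\|_V^{\theta}(1+\|u\|_H^{\gamma}),\qquad |\eta(u)|\le C(1+\|u\|_H^{2+\beta})+C\|u\|_V^{\alpha}(1+\|u\|_H^{\beta})\qquad(u\in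 V)$$ such that for a.e. $t\in[0,T]$ and all $u,v\in V$, $$2\langle A(t,u)-A(t,v),u-v\rangle+\delta^2\|B(t,u)-B(t,v)\|_{L_2}^2\le[f(t)+\rho(u)+\eta(v)]\,\|u-v\|_H^2 .$$ (H3*) There are constants $c>0$ and $p>1$ such that for a.e. $t\in[0,T]$ and all $u\in V$, $$2\langle A(t,u),u\rangle+(p-1)\|B(t,u)\|_{L_2}^2\le f(t)(1+\|u\|_H^2)-c\|u\|_V^{\alpha}.$$ (H4*) There are constants $\beta'\ge 0$ and $C'>0$ such that for a.e. $t\in[0,T]$ and all $u\in V$, $$\|A(t,u)\|_{V^*}^{\alpha/(\alpha-1)}\le f(t)(1+\|u\|_H^{2+\beta'})+C'\|u\|_V^{\alpha}(1+\|u\|_H^{\beta'}).$$ (H5*) There are $g\in L^1([0,T],\mathbb R_+)$ and $L_B>0$ such that for a.e. $t\in[0,T]$ and all $u\in V$, $$\|B(t,u)\|_{L_2}^2\le g(t)(1+\|u\|_H^2)+L_B(1+\|u\|_V^{\alpha}).$$ Then for every $h\in L^2([0,T],U)$ and every $x\in H$ there is a unique $Y\in C([0,T],H)\cap L^{\alpha}([0,T],V)$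 that solves the skeleton equation $dY_t=A(t,Y_t)\,dt+B(t,Y_t)h(t)\,dt$, $Y_0=x$; that is, $A(\cdot,Y_\cdot)$ and $B(\cdot,Y_\cdot)h$ are Bochner integrable in $V^*$ and for all $t\in[0,T]$ $$Y_t=x+\int_0^tA(s,Y_s)\,ds+\int_0^tB(s,Y_s)h(s)\,ds\quad\text{in }V^*.$$ -/

import Mathlib

open MeasureTheory Set
open scoped ENNReal

noncomputable section

namespace SkeletonEq

/-! ### Hilbert–Schmidt operators -/

section HilbertSchmidt

variable (U H : Type*) [NormedAddCommGroup U] [InnerProductSpace ℝ U] [CompleteSpace U]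
  [NormedAddCommGroup H] [InnerProductSpace ℝ H]

/-- The index set of a chosen orthonormal basis of `U`. -/
def BasisIndex : Set U := (exists_hilbertBasis ℝ U).choose

/-- A chosen orthonormal basis of `U`. The notions below do not depend on this choice, see
`mem_hsSubmodule_iff` and `HilbertSchmidt.hasSum_norm_sq`. -/
def chosenBasis : HilbertBasis (BasisIndex U) ℝ U :=
  (exists_hilbertBasis ℝ U).choose_spec.choose

/-- The bounded operators `S : U → H` with `∑ i, ‖S (b i)‖ ^ 2 < ∞`. -/
def hsSubmodule : Submodule ℝ (U →L[ℝ] H) where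
  carrier := {S | Memℓp (fun i => S (chosenBasis U i)) 2}
  add_mem' hS hS' := hS.add hS'
  zero_mem' := (zero_memℓp : Memℓp (0 : BasisIndex U → H) 2)
  smul_mem' c _ hS := hS.const_smul c

/-- The space `L₂(U, H)` of Hilbert–Schmidt operators. It is a type of its own, so that it carries
the Hilbert–Schmidt norm and not the operator norm. -/
def HilbertSchmidt : Type _ := hsSubmodule U H

namespace HilbertSchmidt

instance : AddCommGroup (HilbertSchmidt U H) := inferInstanceAs (AddCommGroup (hsSubmodule U H))

instance : Module ℝ (HilbertSchmidt U H) := inferInstanceAs (Module ℝ (hsSubmodule U H))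

variable {U H}

/-- The underlying bounded operator. -/
def toCLM (S : HilbertSchmidt U H) : U →L[ℝ] H := Subtype.val (p := (· ∈ hsSubmodule U H)) S

variable (U H)

/-- `S ↦ (S (b i))ᵢ`, as a linear map into `ℓ²`. -/
def toLp : HilbertSchmidt U H →ₗ[ℝ] lp (fun _ : BasisIndex U => H) 2 where
  toFun S := ⟨fun i => S.toCLM (chosenBasis U i), S.2⟩
  map_add' _ _ := rfl
  map_smul' _ _ := rfl

theorem toLp_injective : Function.Injective (toLp U H) := by
  intro S S' h
  refine Subtype.ext (ContinuousLinearMap.ext_on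
    (s := Set.range (chosenBasis U)) ?_ ?_)
  · have := (chosenBasis U).dense_span
    rwa [← Submodule.dense_iff_topologicalClosure_eq_top] at this
  · rintro _ ⟨i, rfl⟩
    exact congrFun (congrArg Subtype.val h) i

/-- The Hilbert–Schmidt norm `‖S‖ = (∑ i, ‖S (b i)‖ ^ 2) ^ (1 / 2)`. -/
instance : NormedAddCommGroup (HilbertSchmidt U H) :=
  NormedAddCommGroup.induced _ _ (toLp U H) (toLp_injective U H)

instance : NormedSpace ℝ (HilbertSchmidt U H) := NormedSpace.induced ℝ _ _ (toLp U H)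

instance : MeasurableSpace (HilbertSchmidt U H) := borel _

instance : BorelSpace (HilbertSchmidt U H) := ⟨rfl⟩

end HilbertSchmidt

variable {U H} [CompleteSpace H]

theorem enorm_sq_eq_tsum {ι E : Type*} [NormedAddCommGroup E] [InnerProductSpace ℝ E]
    (d : HilbertBasis ι ℝ E) (x : E) : ‖x‖ₑ ^ 2 = ∑' j, ‖inner ℝ (d j) x‖ₑ ^ 2 := by
  have h' : HasSum (fun j => ‖inner ℝ (d j) x‖ ^ 2) (‖x‖ ^ 2) := by
    rw [← real_inner_self_eq_norm_sq]
    have e : (fun j => ‖inner ℝ (d j) x‖ ^ 2) = fun j => inner ℝ x (d j) * inner ℝ (d j) x := by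
      funext j
      rw [real_inner_comm x, Real.norm_eq_abs, sq_abs, sq]
    rw [e]
    exact d.hasSum_inner_mul_inner x x
  have := ENNReal.ofReal_tsum_of_nonneg (fun j => by positivity) h'.summable
  rw [h'.tsum_eq] at this
  simp_rw [ENNReal.ofReal_pow (norm_nonneg _), ofReal_norm] at this
  exact this

theorem tsum_enorm_sq_adjoint {ι : Type*} (b : HilbertBasis ι ℝ U) (S : U →L[ℝ] H) :
    ∑' i, ‖S (b i)‖ₑ ^ 2 = ∑' j, ‖S.adjoint (chosenBasis H j)‖ₑ ^ 2 := by
  rw [tsum_congr fun i => enorm_sq_eq_tsum (chosenBasis H) (S (b i)),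
    tsum_congr fun j => enorm_sq_eq_tsum b (S.adjoint (chosenBasis H j)), ENNReal.tsum_comm]
  refine tsum_congr fun j => tsum_congr fun i => ?_
  rw [ContinuousLinearMap.adjoint_inner_right, real_inner_comm]

theorem summable_norm_sq_iff {ι E : Type*} [NormedAddCommGroup E] (x : ι → E) :
    Summable (fun i => ‖x i‖ ^ 2) ↔ ∑' i, ‖x i‖ₑ ^ 2 ≠ ∞ := by
  have h : ∀ i, ‖x i‖ₑ ^ 2 = ENNReal.ofReal (‖x i‖ ^ 2) := fun i => by
    rw [ENNReal.ofReal_pow (norm_nonneg _), ofReal_norm]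
  simp_rw [h]
  exact ⟨fun hs => hs.tsum_ofReal_ne_top, fun hs =>
    (ENNReal.summable_toReal hs).congr fun i => ENNReal.toReal_ofReal (by positivity)⟩

/-- Membership in `L₂(U, H)` may be tested on any orthonormal basis. -/
theorem mem_hsSubmodule_iff {κ : Type*} (c : HilbertBasis κ ℝ U) (S : U →L[ℝ] H) :
    S ∈ hsSubmodule U H ↔ Summable fun k => ‖S (c k)‖ ^ 2 := by
  rw [summable_norm_sq_iff, tsum_enorm_sq_adjoint, ← tsum_enorm_sq_adjoint (chosenBasis U),
    ← summable_norm_sq_iff]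
  change Memℓp (fun i => S (chosenBasis U i)) 2 ↔ _
  rw [memℓp_gen_iff (by norm_num)]
  norm_num

/-- The Hilbert–Schmidt norm may be computed on any orthonormal basis. -/
theorem HilbertSchmidt.hasSum_norm_sq {κ : Type*} (c : HilbertBasis κ ℝ U)
    (S : HilbertSchmidt U H) : HasSum (fun k => ‖S.toCLM (c k)‖ ^ 2) (‖S‖ ^ 2) := by
  have hc : Summable fun k => ‖S.toCLM (c k)‖ ^ 2 := (mem_hsSubmodule_iff c _).1 S.2
  have hb : Summable fun i => ‖S.toCLM (chosenBasis U i)‖ ^ 2 :=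
    (mem_hsSubmodule_iff (chosenBasis U) _).1 S.2
  have hn : ‖S‖ ^ 2 = ∑' i, ‖S.toCLM (chosenBasis U i)‖ ^ 2 := by
    have := lp.norm_rpow_eq_tsum (p := 2) (by norm_num) (toLp U H S)
    norm_num at this
    exact this
  have e : ∑' k, ‖S.toCLM (c k)‖ ^ 2 = ∑' i, ‖S.toCLM (chosenBasis U i)‖ ^ 2 := by
    rw [← ENNReal.ofReal_eq_ofReal_iff (tsum_nonneg fun _ => by positivity)
      (tsum_nonneg fun _ => by positivity),
      ENNReal.ofReal_tsum_of_nonneg (fun _ => by positivity) hc,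
      ENNReal.ofReal_tsum_of_nonneg (fun _ => by positivity) hb]
    simp_rw [ENNReal.ofReal_pow (norm_nonneg _), ofReal_norm]
    rw [tsum_enorm_sq_adjoint c, tsum_enorm_sq_adjoint (chosenBasis U)]
  rw [hn, ← e]
  exact hc.hasSum

end HilbertSchmidt

/-! ### The Gelfand triple and the hypotheses on the coefficients

`ι : V →L[ℝ] H` is the embedding of `V` into `H`; `V* = StrongDual ℝ V`, and `⟨φ, v⟩` is `φ v`.
The coefficients are functions of `t : ℝ`, of which only the values for `t ∈ [0, T]` matter. -/

section Coefficients

variable {V H U : Type*} [NormedAddCommGroup V] [NormedSpace ℝ V]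
  [NormedAddCommGroup H] [InnerProductSpace ℝ H]
  [NormedAddCommGroup U] [InnerProductSpace ℝ U] [CompleteSpace U]

/-- `V` is a reflexive Banach space. -/
def IsReflexiveBanach (V : Type*) [NormedAddCommGroup V] [NormedSpace ℝ V] : Prop :=
  CompleteSpace V ∧ Function.Surjective (NormedSpace.inclusionInDoubleDual ℝ V)

/-- `V` is continuously, densely and compactly embedded into `H` by `ι`. -/
def IsGelfandEmbedding (ι : V →L[ℝ] H) : Prop :=
  Function.Injective ι ∧ DenseRange ι ∧ IsCompactOperator ι

/-- The embedding `H ⊆ V*`, that is `⟨y, v⟩ = (y, v)` for `y ∈ H` and `v ∈ V`. -/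
def toVDual (ι : V →L[ℝ] H) (y : H) : StrongDual ℝ V := (innerSL ℝ y).comp ι

/-- Lebesgue measure on `[0, T]`. -/
def timeMeasure (T : ℝ) : Measure ℝ := volume.restrict (Icc 0 T)

/-- `f ∈ L¹([0, T], ℝ₊)`. -/
def IsL1Nonneg (T : ℝ) (f : ℝ → ℝ) : Prop :=
  Integrable f (timeMeasure T) ∧ ∀ᵐ t ∂timeMeasure T, 0 ≤ f t

/-- Hemicontinuity. -/
def Hemicontinuity (T : ℝ) (A : ℝ → V → StrongDual ℝ V) : Prop :=
  ∀ᵐ t ∂timeMeasure T, ∀ u v x : V, Continuous fun l : ℝ => A t (u + l • v) x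

/-- Local monotonicity. -/
def LocalMonotonicity [MeasurableSpace V] (T α β : ℝ) (f : ℝ → ℝ) (ι : V →L[ℝ] H)
    (A : ℝ → V → StrongDual ℝ V) (B : ℝ → V → HilbertSchmidt U H) : Prop :=
  ∃ θ δ γ κ C : ℝ, 0 ≤ θ ∧ θ < α ∧ 0 < δ ∧ 0 ≤ γ ∧ 0 ≤ κ ∧ 0 ≤ C ∧
    ∃ ρ η : V → ℝ, Measurable ρ ∧ Measurable η ∧
      (∀ u, |ρ u| ≤ C * (1 + ‖ι u‖ ^ κ) + C * ‖u‖ ^ θ * (1 + ‖ι u‖ ^ γ)) ∧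
      (∀ u, |η u| ≤ C * (1 + ‖ι u‖ ^ (2 + β)) + C * ‖u‖ ^ α * (1 + ‖ι u‖ ^ β)) ∧
      ∀ᵐ t ∂timeMeasure T, ∀ u v : V,
        2 * (A t u - A t v) (u - v) + δ ^ 2 * ‖B t u - B t v‖ ^ 2
          ≤ (f t + ρ u + η v) * ‖ι (u - v)‖ ^ 2

/-- Coercivity. -/
def Coercivity (T α : ℝ) (f : ℝ → ℝ) (ι : V →L[ℝ] H)
    (A : ℝ → V → StrongDual ℝ V) (B : ℝ → V → HilbertSchmidt U H) : Prop :=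
  ∃ c p : ℝ, 0 < c ∧ 1 < p ∧ ∀ᵐ t ∂timeMeasure T, ∀ u : V,
    2 * A t u u + (p - 1) * ‖B t u‖ ^ 2 ≤ f t * (1 + ‖ι u‖ ^ 2) - c * ‖u‖ ^ α

/-- Growth of `A`. -/
def GrowthA (T α : ℝ) (f : ℝ → ℝ) (ι : V →L[ℝ] H) (A : ℝ → V → StrongDual ℝ V) : Prop :=
  ∃ β C : ℝ, 0 ≤ β ∧ 0 < C ∧ ∀ᵐ t ∂timeMeasure T, ∀ u : V,
    ‖A t u‖ ^ (α / (α - 1))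
      ≤ f t * (1 + ‖ι u‖ ^ (2 + β)) + C * ‖u‖ ^ α * (1 + ‖ι u‖ ^ β)

/-- Growth of `B`, with a dependence on the `V`-norm. -/
def GrowthB (T α : ℝ) (ι : V →L[ℝ] H) (B : ℝ → V → HilbertSchmidt U H) : Prop :=
  ∃ g : ℝ → ℝ, IsL1Nonneg T g ∧ ∃ L : ℝ, 0 < L ∧ ∀ᵐ t ∂timeMeasure T, ∀ u : V,
    ‖B t u‖ ^ 2 ≤ g t * (1 + ‖ι u‖ ^ 2) + L * (1 + ‖u‖ ^ α)

/-- `Y ∈ C([0, T], H) ∩ L^α([0, T], V)` solves the skeleton equation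
`dY = A(t, Y) dt + B(t, Y) h(t) dt`, `Y₀ = x`. Membership in `L^α([0, T], V)` means that some
`y ∈ L^α([0, T], V)` satisfies `ι (y t) = Y t` for a.e. `t`. Both integrals are Bochner integrals
in `V*`; since `ι` is injective they do not depend on the choice of `y`. -/
def IsSkeletonSolution (T α : ℝ) (ι : V →L[ℝ] H) (A : ℝ → V → StrongDual ℝ V)
    (B : ℝ → V → HilbertSchmidt U H) (h : ℝ → U) (x : H) (Y : C(Icc (0 : ℝ) T, H)) : Prop :=
  ∃ y : ℝ → V, MemLp y (ENNReal.ofReal α) (timeMeasure T) ∧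
    (∀ᵐ t ∂timeMeasure T, ∀ ht : t ∈ Icc 0 T, ι (y t) = Y ⟨t, ht⟩) ∧
    Integrable (fun s => A s (y s)) (timeMeasure T) ∧
    Integrable (fun s => toVDual ι ((B s (y s)).toCLM (h s))) (timeMeasure T) ∧
    ∀ t : Icc (0 : ℝ) T,
      toVDual ι (Y t) = toVDual ι x + (∫ s in (0 : ℝ)..t, A s (y s))
        + ∫ s in (0 : ℝ)..t, toVDual ι ((B s (y s)).toCLM (h s))

end Coefficients

end SkeletonEq

end

open MeasureTheory Set Filter Topology
open scoped ENNReal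

namespace SkeletonEq

/-! ### Absolutely continuous functions: Gronwall's inequality and the energy identity -/

theorem lipschitz_exp_neg_abs (x y : ℝ) :
    dist (Real.exp (-|x|)) (Real.exp (-|y|)) ≤ dist x y := by
  have key : ∀ a b : ℝ, 0 ≤ a → a ≤ b → |Real.exp (-a) - Real.exp (-b)| ≤ b - a := by
    intro a b ha hab
    have h1 : Real.exp (-b) = Real.exp (-a) * Real.exp (-(b - a)) := by
      rw [← Real.exp_add]; ring_nf
    have h2 : 1 - (b - a) ≤ Real.exp (-(b - a)) := by
      have := Real.add_one_le_exp (-(b - a)); linarith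
    have h3 : Real.exp (-a) ≤ 1 := Real.exp_le_one_iff.2 (by linarith)
    have h4 : 0 < Real.exp (-a) := Real.exp_pos _
    have h5 : Real.exp (-b) ≤ Real.exp (-a) := Real.exp_le_exp.2 (by linarith)
    rw [abs_of_nonneg (by linarith), h1]
    nlinarith
  rw [Real.dist_eq, Real.dist_eq]
  refine le_trans ?_ (abs_abs_sub_abs_le_abs_sub x y)
  rcases le_total |x| |y| with h | h
  · rw [abs_sub_comm |x|, abs_of_nonneg (sub_nonneg.2 h)]
    exact key _ _ (abs_nonneg x) h
  · rw [abs_sub_comm, abs_of_nonneg (sub_nonneg.2 h)]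
    exact key _ _ (abs_nonneg y) h

theorem AbsolutelyContinuousOnInterval.exp_neg_abs {f : ℝ → ℝ} {a b : ℝ}
    (hf : AbsolutelyContinuousOnInterval f a b) :
    AbsolutelyContinuousOnInterval (fun t => Real.exp (-|f t|)) a b := by
  refine squeeze_zero (fun t => Finset.sum_nonneg fun _ _ => dist_nonneg) (fun t => ?_) hf
  exact Finset.sum_le_sum fun i _ => lipschitz_exp_neg_abs _ _

/-- Gronwall's inequality with an integrable coefficient. -/
theorem gronwall_integrable {T a : ℝ} {φ F : ℝ → ℝ} (hφ : ContinuousOn φ (Icc 0 T))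
    (hF : IntegrableOn F (Icc 0 T)) (hF0 : ∀ᵐ t ∂volume.restrict (Icc 0 T), 0 ≤ F t)
    (h : ∀ t ∈ Icc 0 T, φ t ≤ a + ∫ s in (0 : ℝ)..t, F s * φ s) {t : ℝ} (ht : t ∈ Icc 0 T) :
    φ t ≤ a * Real.exp (∫ s in (0 : ℝ)..t, F s) := by
  have ht0 : 0 ≤ t := ht.1
  have hsub : Icc 0 t ⊆ Icc 0 T := Icc_subset_Icc_right ht.2
  have hFi : IntervalIntegrable F volume 0 t := by
    rw [intervalIntegrable_iff_integrableOn_Icc_of_le ht0]; exact hF.mono_set hsub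
  have hFφ : IntervalIntegrable (fun s => F s * φ s) volume 0 t :=
    hFi.mul_continuousOn (by rw [uIcc_of_le ht0]; exact hφ.mono hsub)
  set Φ : ℝ → ℝ := fun x => ∫ s in (0 : ℝ)..x, F s with hΦ
  set Ψ : ℝ → ℝ := fun x => a + ∫ s in (0 : ℝ)..x, F s * φ s with hΨ
  have hΦac : AbsolutelyContinuousOnInterval Φ 0 t :=
    hFi.absolutelyContinuousOnInterval_intervalIntegral (by simp)
  have hΨac : AbsolutelyContinuousOnInterval Ψ 0 t := by
    refine AbsolutelyContinuousOnInterval.fun_add ?_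
      (hFφ.absolutelyContinuousOnInterval_intervalIntegral (by simp))
    exact (LipschitzWith.const a).lipschitzOnWith.absolutelyContinuousOnInterval
  have hF0' : ∀ᵐ s, s ∈ Icc 0 T → 0 ≤ F s := (ae_restrict_iff' measurableSet_Icc).1 hF0
  have hΦ0 : ∀ x ∈ Icc 0 t, 0 ≤ Φ x := fun x hx =>
    intervalIntegral.integral_nonneg_of_ae_restrict hx.1
      (ae_restrict_of_ae_restrict_of_subset (Icc_subset_Icc_right (hx.2.trans ht.2)) hF0)
  have hE := AbsolutelyContinuousOnInterval.exp_neg_abs hΦac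
  have hprod := hΨac.fun_mul hE
  have hInt := hprod.integral_deriv_eq_sub
  have hle : ∫ x in (0 : ℝ)..t, deriv (fun x => Ψ x * Real.exp (-|Φ x|)) x ≤ 0 := by
    have h1 : ∀ᵐ x ∂volume.restrict (Ioc 0 t),
        deriv (fun x => Ψ x * Real.exp (-|Φ x|)) x ≤ (fun _ => (0 : ℝ)) x := by
      rw [ae_restrict_iff' measurableSet_Ioc]
      have hne : ∀ᵐ x : ℝ, x ≠ t := by simp [ae_iff, measure_singleton]
      filter_upwards [hFi.ae_hasDerivAt_integral, hFφ.ae_hasDerivAt_integral, hF0', hne] with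
        x hx1 hx2 hx3 hx4 hx
      have hxI : x ∈ uIcc 0 t := by rw [uIcc_of_le ht0]; exact Ioc_subset_Icc_self hx
      have hxI' : x ∈ Icc 0 T := hsub (Ioc_subset_Icc_self hx)
      have d1 : HasDerivAt Φ (F x) x := hx1 hxI 0 (by simp)
      have d2 : HasDerivAt Ψ (F x * φ x) x := (hx2 hxI 0 (by simp)).const_add a
      have hev : (fun x => Ψ x * Real.exp (-|Φ x|)) =ᶠ[𝓝 x] fun x => Ψ x * Real.exp (-Φ x) := by
        have : Ioo 0 t ∈ 𝓝 x := isOpen_Ioo.mem_nhds ⟨hx.1, lt_of_le_of_ne hx.2 hx4⟩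
        filter_upwards [this] with z hz
        rw [abs_of_nonneg (hΦ0 z (Ioo_subset_Icc_self hz))]
      have d3 := (d2.mul d1.neg.exp).congr_of_eventuallyEq hev
      rw [d3.deriv]
      have hxle : φ x ≤ Ψ x := h x hxI'
      have hpos := Real.exp_pos (-Φ x)
      have := mul_nonneg (hx3 hxI') (sub_nonneg.2 hxle)
      simp only [Pi.neg_apply]
      nlinarith [mul_nonneg this hpos.le]
    rw [intervalIntegral.integral_of_le ht0]
    exact integral_nonpos_of_ae h1
  rw [hInt] at hle
  have hΦ00 : Φ 0 = 0 := by simp [hΦ]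
  have hΨ00 : Ψ 0 = a := by simp [hΨ]
  rw [hΦ00, hΨ00, abs_of_nonneg (hΦ0 t ⟨ht0, le_rfl⟩)] at hle
  simp only [abs_zero, neg_zero, Real.exp_zero, mul_one] at hle
  have h2 : Ψ t = Ψ t * Real.exp (-Φ t) * Real.exp (Φ t) := by
    rw [mul_assoc, ← Real.exp_add]; simp
  calc φ t ≤ Ψ t := h t ht
    _ = Ψ t * Real.exp (-Φ t) * Real.exp (Φ t) := h2
    _ ≤ a * Real.exp (Φ t) := by
      have := Real.exp_pos (Φ t)
      nlinarith

theorem sq_primitive {t p₀ : ℝ} {γ : ℝ → ℝ} (hγ : IntervalIntegrable γ volume 0 t) :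
    (p₀ + ∫ s in (0 : ℝ)..t, γ s) ^ 2
      = p₀ ^ 2 + 2 * ∫ s in (0 : ℝ)..t, γ s * (p₀ + ∫ r in (0 : ℝ)..s, γ r) := by
  set p : ℝ → ℝ := fun x => p₀ + ∫ s in (0 : ℝ)..x, γ s with hp
  have hac : AbsolutelyContinuousOnInterval p 0 t :=
    AbsolutelyContinuousOnInterval.fun_add
      (LipschitzWith.const p₀).lipschitzOnWith.absolutelyContinuousOnInterval
      (hγ.absolutelyContinuousOnInterval_intervalIntegral (by simp))
  have h := AbsolutelyContinuousOnInterval.integral_deriv_mul_eq_sub hac hac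
  have h2 : ∫ x in (0 : ℝ)..t, (deriv p x * p x + p x * deriv p x)
      = ∫ x in (0 : ℝ)..t, 2 * (γ x * p x) := by
    refine intervalIntegral.integral_congr_ae ?_
    filter_upwards [hγ.ae_hasDerivAt_integral] with x hx hxI
    have d : HasDerivAt p (γ x) x := (hx (uIoc_subset_uIcc hxI) 0 (by simp)).const_add p₀
    rw [d.deriv]; ring
  rw [h2, intervalIntegral.integral_const_mul] at h
  have h0 : p 0 = p₀ := by simp [hp]
  rw [h0] at h
  change p t ^ 2 = _
  linarith

/-- The energy identity for absolutely continuous curves in a Euclidean space. -/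
theorem norm_sq_primitive {E : Type*} [NormedAddCommGroup E] [InnerProductSpace ℝ E]
    [FiniteDimensional ℝ E] {t : ℝ} (ht : 0 ≤ t) {c₀ : E} {c g : ℝ → E}
    (hg : IntervalIntegrable g volume 0 t)
    (hc : ∀ s ∈ Icc 0 t, c s = c₀ + ∫ r in (0 : ℝ)..s, g r) :
    ‖c t‖ ^ 2 = ‖c₀‖ ^ 2 + 2 * ∫ s in (0 : ℝ)..t, inner ℝ (g s) (c s) := by
  set b := stdOrthonormalBasis ℝ E
  have : CompleteSpace E := FiniteDimensional.complete ℝ E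
  have hgi : ∀ i, IntervalIntegrable (fun s => inner ℝ (b i) (g s)) volume 0 t := fun i =>
    ⟨hg.1.const_inner (b i), hg.2.const_inner (b i)⟩
  have hci : ∀ i, ∀ s ∈ Icc 0 t,
      inner ℝ (b i) (c s) = inner ℝ (b i) c₀ + ∫ r in (0 : ℝ)..s, inner ℝ (b i) (g r) := by
    intro i s hs
    rw [hc s hs, inner_add_right]
    congr 1
    have hgs : IntervalIntegrable g volume 0 s :=
      hg.mono_set (by rw [uIcc_of_le hs.1, uIcc_of_le ht]; exact Icc_subset_Icc_right hs.2)
    exact ((innerSL ℝ (b i)).intervalIntegral_comp_comm hgs).symm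
  have hcc : ContinuousOn c (uIcc 0 t) := by
    have h1 : ContinuousOn (fun s => c₀ + ∫ r in (0 : ℝ)..s, g r) (uIcc 0 t) :=
      continuousOn_const.add (intervalIntegral.continuousOn_primitive_interval
        (by rw [uIcc_of_le ht]
            exact (intervalIntegrable_iff_integrableOn_Icc_of_le ht).1 hg))
    exact h1.congr (by rw [uIcc_of_le ht]; exact hc)
  have hn : ∀ z : E, ‖z‖ ^ 2 = ∑ i, inner ℝ (b i) z ^ 2 := by
    intro z
    rw [← b.sum_sq_norm_inner_right z]
    simp
  have hin : ∀ y z : E, inner ℝ y z = ∑ i, inner ℝ (b i) y * inner ℝ (b i) z := by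
    intro y z
    rw [← b.sum_inner_mul_inner y z]
    exact Finset.sum_congr rfl fun i _ => by rw [real_inner_comm]
  have key : ∀ i, inner ℝ (b i) (c t) ^ 2 = inner ℝ (b i) c₀ ^ 2
      + 2 * ∫ s in (0 : ℝ)..t, inner ℝ (b i) (g s) * inner ℝ (b i) (c s) := by
    intro i
    rw [hci i t ⟨ht, le_rfl⟩, sq_primitive (hgi i)]
    congr 2
    refine intervalIntegral.integral_congr fun s hs => ?_
    rw [uIcc_of_le ht] at hs
    simp only [hci i s hs]
  rw [hn, hn, Finset.sum_congr rfl fun i _ => key i, Finset.sum_add_distrib, ← Finset.mul_sum,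
    ← intervalIntegral.integral_finsetSum]
  · simp only [fun s => hin (g s) (c s)]
  · intro i _
    exact (hgi i).mul_continuousOn (continuousOn_const.inner hcc)

/-! ### Passing to the limit in integrals -/

/-- A form of Vitali's convergence theorem. -/
theorem tendsto_integral_abs_sub_of_le {Ω : Type*} [MeasurableSpace Ω] {μ : Measure Ω}
    {X : ℕ → Ω → ℝ} {X' : Ω → ℝ} {q : ℕ → Ω → ℝ} {Q : ℝ}
    (hX : ∀ n, AEStronglyMeasurable (X n) μ) (hX' : Integrable X' μ)
    (hq : ∀ n, Integrable (q n) μ) (hq0 : ∀ n, ∀ᵐ ω ∂μ, 0 ≤ q n ω)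
    (hQ : ∀ n, ∫ ω, q n ω ∂μ ≤ Q)
    (hb : ∀ ε > 0, ∃ k : Ω → ℝ, Integrable k μ ∧ ∀ n, ∀ᵐ ω ∂μ, |X n ω| ≤ ε * q n ω + k ω)
    (hlim : ∀ᵐ ω ∂μ, Tendsto (fun n => X n ω) atTop (𝓝 (X' ω))) :
    Tendsto (fun n => ∫ ω, |X n ω - X' ω| ∂μ) atTop (𝓝 0) := by
  have hQ0 : 0 ≤ Q := (integral_nonneg_of_ae (hq0 0)).trans (hQ 0)
  rw [Metric.tendsto_atTop]
  intro ε hε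
  set δ := ε / (2 * (Q + 1)) with hδ
  have hδ0 : 0 < δ := by positivity
  obtain ⟨k, hk, hkb⟩ := hb δ hδ0
  have hm : ∀ n, AEStronglyMeasurable (fun ω => min |X n ω - X' ω| (|k ω| + |X' ω|)) μ := fun n =>
    (((hX n).sub hX'.1).norm).inf (hk.1.norm.add hX'.1.norm)
  have hd : Integrable (fun ω => |k ω| + |X' ω|) μ := hk.abs.add hX'.abs
  have hmb : ∀ n, ∀ᵐ ω ∂μ, ‖min |X n ω - X' ω| (|k ω| + |X' ω|)‖ ≤ |k ω| + |X' ω| := fun n =>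
    ae_of_all _ fun ω => by
      rw [Real.norm_eq_abs, abs_of_nonneg (by positivity)]; exact min_le_right _ _
  have hmi : ∀ n, Integrable (fun ω => min |X n ω - X' ω| (|k ω| + |X' ω|)) μ := fun n =>
    hd.mono' (hm n) (hmb n)
  have hlim0 : Tendsto (fun n => ∫ ω, min |X n ω - X' ω| (|k ω| + |X' ω|) ∂μ) atTop (𝓝 0) := by
    have := tendsto_integral_of_dominated_convergence (fun ω => |k ω| + |X' ω|) hm hd hmb
      (f := fun _ => (0 : ℝ)) (by
        filter_upwards [hlim] with ω hω
        have h1 : Tendsto (fun n => |X n ω - X' ω|) atTop (𝓝 0) := by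
          simpa using (hω.sub_const (X' ω)).abs
        have h2 := h1.min (tendsto_const_nhds (x := |k ω| + |X' ω|))
        rwa [min_eq_left (by positivity)] at h2)
    simpa using this
  obtain ⟨N, hN⟩ := (Metric.tendsto_atTop.1 hlim0) (ε / 2) (by positivity)
  refine ⟨N, fun n hn => ?_⟩
  have h1 := hN n hn
  rw [Real.dist_eq, sub_zero] at h1 ⊢
  rw [abs_of_nonneg (integral_nonneg fun ω => abs_nonneg _)]
  have h2 : ∀ᵐ ω ∂μ, |X n ω - X' ω| ≤ min |X n ω - X' ω| (|k ω| + |X' ω|) + δ * q n ω := by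
    filter_upwards [hkb n, hq0 n] with ω h1 h2
    have h3 : 0 ≤ δ * q n ω := by positivity
    rcases le_total |X n ω - X' ω| (|k ω| + |X' ω|) with h | h
    · rw [min_eq_left h]; linarith
    · rw [min_eq_right h]
      have := abs_sub (X n ω) (X' ω)
      have := le_abs_self (k ω)
      linarith
  have h3 : ∫ ω, |X n ω - X' ω| ∂μ
      ≤ ∫ ω, (min |X n ω - X' ω| (|k ω| + |X' ω|) + δ * q n ω) ∂μ :=
    integral_mono_of_nonneg (ae_of_all _ fun ω => abs_nonneg _)
      ((hmi n).add ((hq n).const_mul δ)) h2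
  rw [integral_add (hmi n) ((hq n).const_mul δ), integral_const_mul] at h3
  have h4 : δ * ∫ ω, q n ω ∂μ ≤ δ * Q := mul_le_mul_of_nonneg_left (hQ n) hδ0.le
  have h5 : δ * Q < ε / 2 := by
    rw [hδ, div_mul_eq_mul_div, div_lt_div_iff₀ (by positivity) (by positivity)]
    nlinarith
  have h6 := le_abs_self (∫ ω, min |X n ω - X' ω| (|k ω| + |X' ω|) ∂μ)
  linarith

/-- Pointwise compactness of a countable family of bounded equicontinuous sequences. -/
theorem exists_subseq_tendsto_pointwise {J : Type*} [Countable J] {T : ℝ} (hT : 0 ≤ T)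
    (f : ℕ → J → ℝ → ℝ) (hb : ∀ j, ∃ C, ∀ n, ∀ t ∈ Icc 0 T, |f n j t| ≤ C)
    (he : ∀ j, ∀ ε > 0, ∃ δ > 0, ∀ s ∈ Icc 0 T, ∀ t ∈ Icc 0 T, |s - t| < δ →
      ∀ᶠ n in atTop, |f n j s - f n j t| ≤ ε) :
    ∃ φ : ℕ → ℕ, StrictMono φ ∧ ∀ j, ∀ t ∈ Icc 0 T,
      ∃ l, Tendsto (fun n => f (φ n) j t) atTop (𝓝 l) := by
  choose C hC using hb
  have : Nonempty (Icc (0 : ℝ) T) := ⟨⟨0, le_rfl, hT⟩⟩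
  set d : ℕ → Icc (0 : ℝ) T := TopologicalSpace.denseSeq _
  have hcomp : IsCompact (Set.univ.pi fun p : J × ℕ => Icc (-C p.1) (C p.1)) :=
    isCompact_univ_pi fun p => isCompact_Icc
  obtain ⟨l, -, φ, hφ, hl⟩ := hcomp.tendsto_subseq (x := fun n p => f n p.1 (d p.2)) (by
    intro n p _
    exact abs_le.1 (hC p.1 n _ (d p.2).2))
  rw [tendsto_pi_nhds] at hl
  refine ⟨φ, hφ, fun j t ht => ?_⟩
  refine cauchySeq_tendsto_of_complete (Metric.cauchySeq_iff'.2 fun ε hε => ?_)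
  obtain ⟨δ, hδ, hδ'⟩ := he j (ε / 6) (by positivity)
  obtain ⟨k, hk⟩ := (TopologicalSpace.denseRange_denseSeq (Icc (0 : ℝ) T)).exists_dist_lt ⟨t, ht⟩ hδ
  have hk' : |t - d k| < δ := hk
  have h1 := hφ.tendsto_atTop.eventually (hδ' t ht (d k) (d k).2 hk')
  obtain ⟨N₁, hN₁⟩ := eventually_atTop.1 h1
  obtain ⟨N₂, hN₂⟩ := Metric.cauchySeq_iff.1 (hl (j, k)).cauchySeq (ε / 6) (by positivity)
  refine ⟨max N₁ N₂, fun n hn => ?_⟩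
  have a1 := hN₁ n (le_trans (le_max_left _ _) hn)
  have a2 := hN₁ (max N₁ N₂) (le_max_left _ _)
  have a3 := hN₂ n (le_trans (le_max_right _ _) hn) (max N₁ N₂) (le_max_right _ _)
  simp only [Function.comp, Real.dist_eq] at a3 ⊢
  rw [abs_le] at a1 a2
  rw [abs_lt] at a3 ⊢
  constructor <;> linarith

end SkeletonEq

namespace SkeletonEq

/-! ### Carathéodory's existence theorem -/

theorem intervalIntegrable_of_mem {G : Type*} [NormedAddCommGroup G] {T : ℝ} {g : ℝ → G} {a b : ℝ}
    (hg : IntegrableOn g (Icc 0 T)) (ha : a ∈ Icc 0 T) (hb : b ∈ Icc 0 T) :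
    IntervalIntegrable g volume a b := by
  rw [intervalIntegrable_iff]
  exact hg.mono_set (uIoc_subset_uIcc.trans (uIcc_subset_Icc ha hb))

theorem integrableOn_comp_of_bound {E : Type*} [NormedAddCommGroup E] [MeasurableSpace E]
    [BorelSpace E] [SecondCountableTopology E] {T : ℝ} {F : ℝ → E → E} {m : ℝ → ℝ}
    (hF : Measurable (Function.uncurry F)) (hm : IntegrableOn m (Icc 0 T))
    (hb : ∀ᵐ t ∂volume.restrict (Icc 0 T), ∀ x, ‖F t x‖ ≤ m t) {X : ℝ → E} (hX : Measurable X) :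
    IntegrableOn (fun s => F s (X s)) (Icc 0 T) := by
  refine Integrable.mono' hm ?_ (hb.mono fun t ht => ht _)
  exact (hF.comp (measurable_id.prodMk hX)).aestronglyMeasurable

section Caratheodory

variable {E : Type*} [NormedAddCommGroup E] [NormedSpace ℝ E]

/-- The projection of `ℝ` onto `[0, T]`. -/
def clamp (T t : ℝ) : ℝ := max 0 (min t T)

theorem continuous_clamp (T : ℝ) : Continuous (clamp T) := by
  unfold clamp; fun_prop

theorem clamp_mem {T : ℝ} (hT : 0 ≤ T) (t : ℝ) : clamp T t ∈ Icc 0 T :=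
  ⟨le_max_left _ _, max_le hT (min_le_right _ _)⟩

theorem clamp_of_mem {T t : ℝ} (ht : t ∈ Icc 0 T) : clamp T t = t := by
  rw [clamp, min_eq_left ht.2, max_eq_right ht.1]

theorem clamp_of_nonpos {T t : ℝ} (ht : t ≤ 0) : clamp T t = 0 :=
  max_eq_left ((min_le_left _ _).trans ht)

/-- The integral operator of the delayed equation. -/
noncomputable def delayMap (T d : ℝ) (F : ℝ → E → E) (x₀ : E) (X : ℝ → E) (t : ℝ) : E :=
  x₀ + ∫ s in (0 : ℝ)..clamp T t, F s (X (s - d))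

variable {T : ℝ} {F : ℝ → E → E} {m : ℝ → ℝ}

theorem continuous_primitive_clamp (hT : 0 ≤ T) {g : ℝ → E} (hg : IntegrableOn g (Icc 0 T)) :
    Continuous fun t => ∫ s in (0 : ℝ)..clamp T t, g s := by
  have h := intervalIntegral.continuousOn_primitive_interval (a := 0) (b := T) (f := g)
    (μ := volume) (by rwa [uIcc_of_le hT])
  rw [uIcc_of_le hT] at h
  exact h.comp_continuous (continuous_clamp T) (clamp_mem hT)

theorem norm_intervalIntegral_sub_le {g : ℝ → E} (hg : IntegrableOn g (Icc 0 T))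
    (hm : IntegrableOn m (Icc 0 T)) (hb : ∀ᵐ t ∂volume.restrict (Icc 0 T), ‖g t‖ ≤ m t)
    {s t : ℝ} (hs : s ∈ Icc 0 T) (ht : t ∈ Icc 0 T) :
    ‖(∫ r in (0 : ℝ)..t, g r) - ∫ r in (0 : ℝ)..s, g r‖
      ≤ |(∫ r in (0 : ℝ)..t, m r) - ∫ r in (0 : ℝ)..s, m r| := by
  have h0 : (0 : ℝ) ∈ Icc 0 T := ⟨le_rfl, hs.1.trans hs.2⟩
  rw [intervalIntegral.integral_interval_sub_left (intervalIntegrable_of_mem hg h0 ht)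
      (intervalIntegrable_of_mem hg h0 hs),
    intervalIntegral.integral_interval_sub_left (intervalIntegrable_of_mem hm h0 ht)
      (intervalIntegrable_of_mem hm h0 hs)]
  refine intervalIntegral.norm_integral_le_abs_of_norm_le ?_ (intervalIntegrable_of_mem hm hs ht)
  exact ae_restrict_of_ae_restrict_of_subset (uIoc_subset_uIcc.trans (uIcc_subset_Icc hs ht)) hb

/-- The delayed equation has a solution. -/
theorem exists_delay_solution [MeasurableSpace E] [BorelSpace E] [SecondCountableTopology E]
    (hT : 0 ≤ T) (hF : Measurable (Function.uncurry F)) (hm : IntegrableOn m (Icc 0 T))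
    (hb : ∀ᵐ t ∂volume.restrict (Icc 0 T), ∀ x, ‖F t x‖ ≤ m t) (x₀ : E) {d : ℝ} (hd : 0 < d) :
    ∃ X : ℝ → E, Continuous X ∧ ∀ t ∈ Icc 0 T, X t = x₀ + ∫ s in (0 : ℝ)..t, F s (X (s - d)) := by
  set Φ := delayMap T d F x₀
  have hΦc : ∀ X : ℝ → E, Continuous X → Continuous (Φ X) := fun X hX =>
    continuous_const.add (continuous_primitive_clamp hT
      (integrableOn_comp_of_bound hF hm hb
        (hX.comp (continuous_id.sub continuous_const)).measurable))
  set X : ℕ → ℝ → E := fun N => Φ^[N] fun _ => x₀ with hX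
  have hXs : ∀ N, X (N + 1) = Φ (X N) := fun N => Function.iterate_succ_apply' _ _ _
  have hXc : ∀ N, Continuous (X N) := by
    intro N
    induction N with
    | zero => exact continuous_const
    | succ N ih => rw [hXs]; exact hΦc _ ih
  have hst : ∀ N : ℕ, ∀ t ≤ N * d, X (N + 1) t = X N t := by
    intro N
    induction N with
    | zero =>
      intro t ht
      rw [hXs]
      change x₀ + _ = x₀
      rw [clamp_of_nonpos (by simpa using ht)]; simp
    | succ N ih =>
      intro t ht
      rw [hXs (N + 1), hXs N]
      change x₀ + _ = x₀ + _
      congr 1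
      refine intervalIntegral.integral_congr fun s hs => ?_
      rw [uIcc_of_le (clamp_mem hT t).1] at hs
      have hs2 : s ≤ (N + 1 : ℕ) * d :=
        hs.2.trans (max_le (by positivity) ((min_le_left _ _).trans ht))
      have : s - d ≤ N * d := by push_cast at hs2; linarith
      simp only [← hXs, ih _ this]
  obtain ⟨N, hN⟩ := exists_nat_ge (T / d)
  refine ⟨X N, hXc N, fun t ht => ?_⟩
  rw [← hst N t (ht.2.trans (by rwa [div_le_iff₀ hd] at hN)), hXs]
  change x₀ + _ = _
  rw [clamp_of_mem ht]

end Caratheodory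

/-- **Carathéodory's existence theorem** for a right-hand side with an integrable bound. -/
theorem exists_caratheodory_solution {E : Type*} [NormedAddCommGroup E] [InnerProductSpace ℝ E]
    [FiniteDimensional ℝ E] [MeasurableSpace E] [BorelSpace E] {T : ℝ} (hT : 0 ≤ T)
    {F : ℝ → E → E} {m : ℝ → ℝ} (hF : Measurable (Function.uncurry F))
    (hm : IntegrableOn m (Icc 0 T))
    (hb : ∀ᵐ t ∂volume.restrict (Icc 0 T), ∀ x, ‖F t x‖ ≤ m t)
    (hc : ∀ᵐ t ∂volume.restrict (Icc 0 T), Continuous (F t)) (x₀ : E) :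
    ∃ x : ℝ → E, Continuous x ∧ ∀ t ∈ Icc 0 T, x t = x₀ + ∫ s in (0 : ℝ)..t, F s (x s) := by
  have hcompl : CompleteSpace E := FiniteDimensional.complete ℝ E
  have hproper : ProperSpace E := FiniteDimensional.proper ℝ E
  set d : ℕ → ℝ := fun n => 1 / ((n : ℝ) + 1)
  have hd : ∀ n, 0 < d n := fun n => by positivity
  have hd0 : Tendsto d atTop (𝓝 0) := tendsto_one_div_add_atTop_nhds_zero_nat
  choose X hXc hX using fun n => exists_delay_solution hT hF hm hb x₀ (hd n)
  have h0T : (0 : ℝ) ∈ Icc 0 T := ⟨le_rfl, hT⟩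
  set Mf : ℝ → ℝ := fun t => ∫ r in (0 : ℝ)..t, m r with hMf
  have hMc : ContinuousOn Mf (Icc 0 T) := by
    have h := intervalIntegral.continuousOn_primitive_interval (a := 0) (b := T) (f := m)
      (μ := volume) (by rwa [uIcc_of_le hT])
    rwa [uIcc_of_le hT] at h
  have hInt : ∀ n, IntegrableOn (fun s => F s (X n (s - d n))) (Icc 0 T) := fun n =>
    integrableOn_comp_of_bound hF hm hb
      ((hXc n).comp (continuous_id.sub continuous_const)).measurable
  have hmod : ∀ n, ∀ s ∈ Icc 0 T, ∀ t ∈ Icc 0 T, ‖X n t - X n s‖ ≤ |Mf t - Mf s| := by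
    intro n s hs t ht
    rw [hX n t ht, hX n s hs, add_sub_add_left_eq_sub]
    exact norm_intervalIntegral_sub_le (hInt n) hm (hb.mono fun t ht => ht _) hs ht
  have hbd : ∃ C, ∀ n, ∀ t ∈ Icc 0 T, ‖X n t‖ ≤ C := by
    obtain ⟨C, hC⟩ := isCompact_Icc.exists_bound_of_continuousOn hMc
    refine ⟨‖x₀‖ + C, fun n t ht => ?_⟩
    have h1 := hmod n 0 h0T t ht
    have h2 : X n 0 = x₀ := by rw [hX n 0 h0T]; simp
    have h3 : Mf 0 = 0 := by simp [hMf]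
    rw [h2, h3, sub_zero] at h1
    have h4 := hC t ht
    rw [Real.norm_eq_abs] at h4
    have h5 := norm_sub_norm_le (X n t) x₀
    linarith
  obtain ⟨C, hC⟩ := hbd
  set b := stdOrthonormalBasis ℝ E
  obtain ⟨φ, hφ, hl⟩ := exists_subseq_tendsto_pointwise hT (fun n i t => inner ℝ (b i) (X n t))
    (fun i => ⟨C, fun n t ht => (abs_real_inner_le_norm _ _).trans (by
      rw [b.orthonormal.1 i, one_mul]; exact hC n t ht)⟩)
    (fun i ε hε => by
      have := (isCompact_Icc (a := (0 : ℝ)) (b := T)).uniformContinuousOn_of_continuous hMc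
      obtain ⟨δ, hδ, h⟩ := Metric.uniformContinuousOn_iff.1 this ε hε
      refine ⟨δ, hδ, fun s hs t ht hst => Eventually.of_forall fun n => ?_⟩
      rw [← inner_sub_right]
      refine (abs_real_inner_le_norm _ _).trans ?_
      rw [b.orthonormal.1 i, one_mul]
      exact (hmod n t ht s hs).trans (h s hs t ht hst).le)
  have hl' : ∀ t ∈ Icc 0 T, ∃ x, Tendsto (fun n => X (φ n) t) atTop (𝓝 x) := by
    intro t ht
    choose l hl using fun i => hl i t ht
    refine ⟨∑ i, l i • b i, ?_⟩
    have : (fun n => X (φ n) t) = fun n => ∑ i, inner ℝ (b i) (X (φ n) t) • b i := by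
      funext n; exact (b.sum_repr' _).symm
    rw [this]
    exact tendsto_finsetSum _ fun i _ => (hl i).smul_const (b i)
  choose! x hx using hl'
  have hxmod : ∀ s ∈ Icc 0 T, ∀ t ∈ Icc 0 T, ‖x t - x s‖ ≤ |Mf t - Mf s| := fun s hs t ht =>
    le_of_tendsto ((hx t ht).sub (hx s hs)).norm (Eventually.of_forall fun n => hmod _ s hs t ht)
  have hxc : ContinuousOn x (Icc 0 T) := by
    intro s hs
    rw [ContinuousWithinAt, tendsto_iff_norm_sub_tendsto_zero]
    have h1 : Tendsto (fun t => |Mf t - Mf s|) (𝓝[Icc 0 T] s) (𝓝 0) := by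
      simpa using ((hMc s hs).sub_const (Mf s)).abs
    exact squeeze_zero' (Eventually.of_forall fun _ => norm_nonneg _)
      (eventually_mem_nhdsWithin.mono fun t ht => hxmod s hs t ht) h1
  refine ⟨fun t => x (clamp T t), hxc.comp_continuous (continuous_clamp T) (clamp_mem hT), ?_⟩
  intro t ht
  simp only
  rw [clamp_of_mem ht]
  have hdel : ∀ s ∈ Ioc 0 T, Tendsto (fun n => X (φ n) (s - d (φ n))) atTop (𝓝 (x s)) := by
    intro s hs
    have hsI := Ioc_subset_Icc_self hs
    have hd' : Tendsto (fun n => s - d (φ n)) atTop (𝓝 s) := by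
      simpa using (hd0.comp hφ.tendsto_atTop).const_sub s
    have hev : ∀ᶠ n in atTop, s - d (φ n) ∈ Icc 0 T := by
      filter_upwards [hd'.eventually (lt_mem_nhds hs.1)] with n hn
      exact ⟨hn.le, by linarith [hd (φ n), hs.2]⟩
    have h1 : Tendsto (fun n => |Mf (s - d (φ n)) - Mf s|) atTop (𝓝 0) := by
      have : Tendsto (fun n => s - d (φ n)) atTop (𝓝[Icc 0 T] s) :=
        tendsto_nhdsWithin_iff.2 ⟨hd', hev⟩
      simpa using (((hMc s hsI).tendsto.comp this).sub_const (Mf s)).abs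
    have h2 : Tendsto (fun n => X (φ n) (s - d (φ n)) - X (φ n) s) atTop (𝓝 0) :=
      squeeze_zero_norm' (hev.mono fun n hn => hmod _ s hsI _ hn) h1
    simpa using h2.add (hx s hsI)
  refine tendsto_nhds_unique (hx t ht) ?_
  have hlim : Tendsto (fun n => ∫ s in (0 : ℝ)..t, F s (X (φ n) (s - d (φ n)))) atTop
      (𝓝 (∫ s in (0 : ℝ)..t, F s (x (clamp T s)))) := by
    have hsub : uIoc 0 t ⊆ Icc 0 T := by
      rw [uIoc_of_le ht.1]; exact fun s hs => ⟨hs.1.le, hs.2.trans ht.2⟩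
    refine intervalIntegral.tendsto_integral_filter_of_dominated_convergence m
      (Eventually.of_forall fun n => ((hInt _).mono_set hsub).aestronglyMeasurable)
      (Eventually.of_forall fun n => ?_) ?_ ?_
    · have := (ae_restrict_iff' measurableSet_Icc).1 hb
      filter_upwards [this] with s hs hs'
      exact hs (hsub hs') _
    · rw [intervalIntegrable_iff]; exact hm.mono_set hsub
    · have := (ae_restrict_iff' measurableSet_Icc).1 hc
      filter_upwards [this] with s hs hs'
      have hsT : s ∈ Icc 0 T := hsub hs'
      rw [uIoc_of_le ht.1] at hs'
      rw [clamp_of_mem hsT]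
      exact ((hs hsT).tendsto _).comp (hdel s ⟨hs'.1, hsT.2⟩)
  have : (fun n => X (φ n) t) = fun n => x₀ + ∫ s in (0 : ℝ)..t, F s (X (φ n) (s - d (φ n))) := by
    funext n; exact hX _ t ht
  rw [this]
  exact hlim.const_add x₀

end SkeletonEq

namespace SkeletonEq

/-! ### Functional analysis of the Gelfand triple -/

theorem dense_of_dual_eq_zero {E : Type*} [NormedAddCommGroup E] [NormedSpace ℝ E]
    (S : Submodule ℝ E) (h : ∀ g : StrongDual ℝ E, (∀ x ∈ S, g x = 0) → g = 0) :
    Dense (S : Set E) := by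
  intro x
  by_contra hx
  obtain ⟨g, u, hgx, hgu⟩ := geometric_hahn_banach_point_closed (E := E) (x := x)
    (t := closure (S : Set E)) (S.convex.closure) isClosed_closure hx
  have hS : ∀ z ∈ S, g z = 0 := by
    intro z hz
    by_contra hne
    have h1 := hgu (((u - 1) / g z) • z) (subset_closure (S.smul_mem _ hz))
    rw [map_smul, smul_eq_mul, div_mul_cancel₀ _ hne] at h1
    linarith
  have h0 := h g hS
  have h1 := hgu 0 (subset_closure S.zero_mem)
  rw [h0] at h1 hgx
  simp only [zero_apply] at h1 hgx
  linarith

/-- A normed space with a separable dual is separable. -/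
theorem separableSpace_of_dual (E : Type*) [NormedAddCommGroup E] [NormedSpace ℝ E]
    [TopologicalSpace.SeparableSpace (StrongDual ℝ E)] : TopologicalSpace.SeparableSpace E := by
  set d : ℕ → StrongDual ℝ E := TopologicalSpace.denseSeq _
  have hex : ∀ n, ∃ x : E, ‖x‖ ≤ 1 ∧ ‖d n‖ / 2 ≤ ‖d n x‖ := by
    intro n
    by_contra hcon
    push Not at hcon
    rcases eq_or_lt_of_le (norm_nonneg (d n)) with h0 | h0
    · have := hcon 0 (by simp)
      rw [← h0] at this; simp at this
    · have h1 : ‖d n‖ ≤ ‖d n‖ / 2 := by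
        refine ContinuousLinearMap.opNorm_le_of_unit_norm (by positivity) fun x hx => ?_
        exact (hcon x hx.le).le
      linarith
  choose x hx1 hx2 using hex
  have hdense : Dense (Submodule.span ℝ (range x) : Set E) := by
    refine dense_of_dual_eq_zero _ fun g hg => ?_
    by_contra hne
    have hpos : 0 < ‖g‖ := norm_pos_iff.2 hne
    obtain ⟨n, hn⟩ := (TopologicalSpace.denseRange_denseSeq (StrongDual ℝ E)).exists_dist_lt g
      (ε := ‖g‖ / 4) (by positivity)
    rw [dist_eq_norm] at hn
    have h1 : ‖(g - d n) (x n)‖ ≤ ‖g - d n‖ := by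
      refine ((g - d n).le_opNorm _).trans ?_
      exact mul_le_of_le_one_right (norm_nonneg _) (hx1 n)
    have h2 : g (x n) = 0 := hg _ (Submodule.subset_span ⟨n, rfl⟩)
    rw [sub_apply, h2, zero_sub, norm_neg] at h1
    have h3 : ‖g‖ ≤ ‖g - d n‖ + ‖d n‖ := by
      simpa using norm_add_le (g - d n) (d n)
    have := hx2 n
    change ‖g - d n‖ < _ at hn
    linarith
  have hsep : TopologicalSpace.IsSeparable (Submodule.span ℝ (range x) : Set E) :=
    (Set.countable_range x).isSeparable.span
  exact hdense.isSeparable_iff.1 hsep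

section GelfandTriple

variable {V H : Type*} [NormedAddCommGroup V] [NormedSpace ℝ V]
  [NormedAddCommGroup H] [InnerProductSpace ℝ H]

/-- The embedding `H ⊆ V*` as a continuous linear map. -/
noncomputable def toVDualL (ι : V →L[ℝ] H) : H →L[ℝ] StrongDual ℝ V :=
  ((ContinuousLinearMap.compL ℝ V H ℝ).flip ι).comp (innerSL ℝ)

theorem toVDualL_apply (ι : V →L[ℝ] H) (y : H) : toVDualL ι y = toVDual ι y := rfl

theorem toVDual_apply (ι : V →L[ℝ] H) (y : H) (v : V) : toVDual ι y v = inner ℝ y (ι v) := rfl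

theorem denseRange_toVDual (hV : IsReflexiveBanach V) {ι : V →L[ℝ] H}
    (hι : Function.Injective ι) : DenseRange (toVDual ι) := by
  have h : Dense ((toVDualL ι).toLinearMap.range : Set (StrongDual ℝ V)) := by
    refine dense_of_dual_eq_zero _ fun g hg => ?_
    obtain ⟨v, rfl⟩ := hV.2 g
    have h1 := hg (toVDualL ι (ι v)) ⟨ι v, rfl⟩
    rw [NormedSpace.dual_def, toVDualL_apply, toVDual_apply, inner_self_eq_zero] at h1
    have : v = 0 := hι (by rw [h1, map_zero])
    rw [this, map_zero]
  rw [DenseRange]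
  convert! h using 1

theorem separableSpace_dual (hV : IsReflexiveBanach V) {ι : V →L[ℝ] H}
    (hι : Function.Injective ι) [TopologicalSpace.SeparableSpace H] :
    TopologicalSpace.SeparableSpace (StrongDual ℝ V) :=
  (denseRange_toVDual hV hι).separableSpace (toVDualL ι).continuous

/-- A bounded sequence in `V` that converges in `H` converges weakly in `V`. -/
theorem tendsto_dual_apply (hV : IsReflexiveBanach V) {ι : V →L[ℝ] H}
    (hι : Function.Injective ι) {v : ℕ → V} {v' : V} {R : ℝ} (hR : ∀ n, ‖v n‖ ≤ R)
    (hv : Tendsto (fun n => ι (v n)) atTop (𝓝 (ι v'))) (φ : StrongDual ℝ V) :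
    Tendsto (fun n => φ (v n)) atTop (𝓝 (φ v')) := by
  have hR0 : 0 ≤ R := (norm_nonneg _).trans (hR 0)
  rw [Metric.tendsto_atTop]
  intro ε hε
  obtain ⟨y, hy⟩ := (denseRange_toVDual hV hι).exists_dist_lt φ
    (ε := ε / (2 * (R + ‖v'‖ + 1))) (by positivity)
  rw [dist_eq_norm] at hy
  have h1 : Tendsto (fun n => toVDual ι y (v n)) atTop (𝓝 (toVDual ι y v')) := by
    simp only [toVDual_apply]
    exact tendsto_const_nhds.inner hv
  obtain ⟨N, hN⟩ := Metric.tendsto_atTop.1 h1 (ε / 2) (by positivity)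
  refine ⟨N, fun n hn => ?_⟩
  have h2 := hN n hn
  rw [dist_eq_norm] at h2 ⊢
  have h3 : φ (v n) - φ v' = (φ - toVDual ι y) (v n - v')
      + (toVDual ι y (v n) - toVDual ι y v') := by
    simp only [sub_apply, map_sub]; ring
  have h4 : ‖(φ - toVDual ι y) (v n - v')‖ ≤ ε / (2 * (R + ‖v'‖ + 1)) * (R + ‖v'‖) := by
    refine ((φ - toVDual ι y).le_opNorm _).trans ?_
    refine mul_le_mul hy.le ?_ (norm_nonneg _) (by positivity)
    exact (norm_sub_le _ _).trans (by linarith [hR n])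
  have h5 : ε / (2 * (R + ‖v'‖ + 1)) * (R + ‖v'‖) ≤ ε / 2 := by
    have : 0 ≤ ‖v'‖ := norm_nonneg _
    rw [div_mul_eq_mul_div, div_le_div_iff₀ (by positivity) (by positivity)]
    nlinarith
  rw [h3]
  exact (norm_add_le _ _).trans_lt (by linarith)

/-- The image in `H` of a closed ball of `V` is closed. -/
theorem exists_of_tendsto_of_bounded (hV : IsReflexiveBanach V) {ι : V →L[ℝ] H}
    {v : ℕ → V} {y : H} {R : ℝ} (hR : ∃ᶠ n in atTop, ‖v n‖ ≤ R)
    (hv : Tendsto (fun n => ι (v n)) atTop (𝓝 y)) : ∃ v' : V, ι v' = y ∧ ‖v'‖ ≤ R := by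
  obtain ⟨σ, hσ, hσR⟩ := extraction_of_frequently_atTop hR
  have hcomp := WeakDual.isCompact_closedBall (𝕜 := ℝ) (E := StrongDual ℝ V) 0 R
  set J : ℕ → WeakDual ℝ (StrongDual ℝ V) := fun n =>
    StrongDual.toWeakDual (NormedSpace.inclusionInDoubleDual ℝ V (v (σ n)))
  have hJ : ∀ n, J n ∈ WeakDual.toStrongDual ⁻¹' Metric.closedBall
      (0 : StrongDual ℝ (StrongDual ℝ V)) R := by
    intro n
    exact (mem_closedBall_zero_iff (E := StrongDual ℝ (StrongDual ℝ V))).2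
      ((NormedSpace.double_dual_bound ℝ V _).trans (hσR n))
  set f : Ultrafilter ℕ := Ultrafilter.of atTop
  have hf : (f : Filter ℕ) ≤ atTop := Ultrafilter.of_le _
  obtain ⟨ψ, hψ, hlim⟩ := hcomp.ultrafilter_le_nhds (f.map J)
    (by
      rw [Filter.le_principal_iff]
      exact Filter.mem_map.2 (Filter.univ_mem' hJ))
  obtain ⟨v', hv'⟩ := hV.2 (WeakDual.toStrongDual ψ)
  refine ⟨v', ?_, ?_⟩
  · refine ext_inner_left ℝ fun z => ?_
    have h1 : Tendsto (fun n => J n (toVDual ι z)) f (𝓝 (ψ (toVDual ι z))) :=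
      ((WeakDual.eval_continuous (toVDual ι z)).tendsto ψ).comp hlim
    have h2 : Tendsto (fun n => J n (toVDual ι z)) f (𝓝 (inner ℝ z y)) :=
      ((tendsto_const_nhds.inner hv).comp hσ.tendsto_atTop).mono_left hf
    have h3 : ψ (toVDual ι z) = inner ℝ z (ι v') := by
      change WeakDual.toStrongDual ψ (toVDual ι z) = _
      rw [← hv']; rfl
    rw [← h3]
    exact tendsto_nhds_unique h1 h2
  · replace hψ := mem_closedBall_zero_iff.1 (mem_preimage.1 hψ)
    rw [← hv'] at hψ
    refine le_trans (le_of_eq ?_) hψ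
    exact ((NormedSpace.inclusionInDoubleDualLi ℝ).norm_map v').symm

/-- Ehrling's inequality with finitely many functionals. -/
theorem exists_norm_le_add_sum_inner [CompleteSpace H] {ι : V →L[ℝ] H} (hι : IsCompactOperator ι)
    {ε : ℝ} (hε : 0 < ε) :
    ∃ (N : ℕ) (e : Fin N → H), ∀ v, ‖ι v‖ ≤ ε * ‖v‖ + ∑ i, |inner ℝ (e i) (ι v)| := by
  have hK := (IsCompactOperator.isCompact_closure_image_closedBall (f := ι.toLinearMap) hι 1)
  obtain ⟨s, -, hs, hcov⟩ := hK.finite_cover_balls hε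
  set W : Submodule ℝ H := Submodule.span ℝ s
  have hfin : FiniteDimensional ℝ W := FiniteDimensional.span_of_finite ℝ hs
  set b := stdOrthonormalBasis ℝ W
  refine ⟨_, fun i => (b i : H), fun v => ?_⟩
  have h1 : ∀ v : V, ‖v‖ ≤ 1 → ‖ι v - W.starProjection (ι v)‖ ≤ ε := by
    intro v hv
    have hmem : ι v ∈ closure (ι '' Metric.closedBall 0 1) :=
      subset_closure ⟨v, by simpa using hv, rfl⟩
    obtain ⟨z, hz, hzv⟩ := mem_iUnion₂.1 (hcov hmem)
    rw [Metric.mem_ball, dist_eq_norm] at hzv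
    refine le_trans ?_ hzv.le
    rw [Submodule.starProjection_minimal]
    exact ciInf_le_of_le ⟨0, by rintro _ ⟨w, rfl⟩; exact norm_nonneg _⟩
      ⟨z, Submodule.subset_span hz⟩ le_rfl
  have h2 : ‖ι v - W.starProjection (ι v)‖ ≤ ε * ‖v‖ := by
    rcases eq_or_ne v 0 with rfl | hv
    · simp
    · have hv0 : 0 < ‖v‖ := norm_pos_iff.2 hv
      have := h1 (‖v‖⁻¹ • v) (by rw [norm_smul, norm_inv, norm_norm, inv_mul_cancel₀ hv0.ne'])
      rw [map_smul, map_smul, ← smul_sub, norm_smul, norm_inv, norm_norm,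
        inv_mul_le_iff₀ hv0] at this
      linarith
  have h3 : W.starProjection (ι v) = ∑ i, inner ℝ (b i : H) (ι v) • (b i : H) := by
    rw [Submodule.starProjection_apply, ← b.sum_repr' (W.orthogonalProjectionOnto (ι v))]
    simp only [Submodule.coe_sum, Submodule.coe_smul]
    refine Finset.sum_congr rfl fun i _ => ?_
    rw [Submodule.inner_orthogonalProjectionOnto_eq_of_mem_left]
  have h4 : ‖W.starProjection (ι v)‖ ≤ ∑ i, |inner ℝ (b i : H) (ι v)| := by
    rw [h3]
    refine (norm_sum_le _ _).trans (Finset.sum_le_sum fun i _ => ?_)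
    rw [norm_smul, ← Submodule.coe_norm, b.orthonormal.1 i, mul_one, Real.norm_eq_abs]
  have h5 := norm_add_le (ι v - W.starProjection (ι v)) (W.starProjection (ι v))
  rw [sub_add_cancel] at h5
  linarith

end GelfandTriple

end SkeletonEq

namespace SkeletonEq

/-! ### Approximation of `L^α` functions by step functions -/

theorem exists_subseq_tendsto_ae_zero {Ω : Type*} [MeasurableSpace Ω] {μ : Measure Ω}
    {X : ℕ → Ω → ℝ} (hX : ∀ n, Integrable (X n) μ)
    (h : Tendsto (fun n => ∫ ω, |X n ω| ∂μ) atTop (𝓝 0)) :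
    ∃ σ : ℕ → ℕ, StrictMono σ ∧ ∀ᵐ ω ∂μ, Tendsto (fun n => X (σ n) ω) atTop (𝓝 0) := by
  have h1 : Tendsto (fun n => eLpNorm (X n - fun _ => (0 : ℝ)) 1 μ) atTop (𝓝 0) := by
    have h2 : ∀ n, eLpNorm (X n - fun _ => (0 : ℝ)) 1 μ = ENNReal.ofReal (∫ ω, |X n ω| ∂μ) := by
      intro n
      rw [eLpNorm_one_eq_lintegral_enorm]
      simp only [Pi.sub_apply, sub_zero]
      rw [← ofReal_integral_norm_eq_lintegral_enorm (hX n)]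
      rfl
    simp_rw [h2]
    simpa using ENNReal.tendsto_ofReal h
  obtain ⟨σ, hσ, hlim⟩ := (tendstoInMeasure_of_tendsto_eLpNorm one_ne_zero
    (fun n => (hX n).1) aestronglyMeasurable_const h1).exists_seq_tendsto_ae
  exact ⟨σ, hσ, hlim⟩

theorem integrable_norm_rpow_iff_memLp {Ω E : Type*} [MeasurableSpace Ω] [NormedAddCommGroup E]
    {μ : Measure Ω} {α : ℝ} (hα : 0 < α) {y : Ω → E} (hy : AEStronglyMeasurable y μ) :
    Integrable (fun t => ‖y t‖ ^ α) μ ↔ MemLp y (ENNReal.ofReal α) μ := by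
  have := integrable_norm_rpow_iff hy (p := ENNReal.ofReal α) (by simpa using hα) (by simp)
  rwa [ENNReal.toReal_ofReal hα.le] at this

theorem add_rpow_le_const_mul {α a b c : ℝ} (hα : 0 ≤ α) (ha : 0 ≤ a) (hb : 0 ≤ b) (hc : 0 ≤ c) :
    (a + b + c) ^ α ≤ 3 ^ α * (a ^ α + b ^ α + c ^ α) := by
  have hm : a + b + c ≤ 3 * max a (max b c) := by
    have h1 := le_max_left a (max b c)
    have h2 := (le_max_left b c).trans (le_max_right a (max b c))
    have h3 := (le_max_right b c).trans (le_max_right a (max b c))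
    linarith
  have h0 : 0 ≤ max a (max b c) := ha.trans (le_max_left _ _)
  have h1 := Real.rpow_le_rpow (by positivity) hm hα
  rw [Real.mul_rpow (by norm_num) h0] at h1
  refine h1.trans (mul_le_mul_of_nonneg_left ?_ (by positivity))
  have a1 := Real.rpow_nonneg ha α
  have a2 := Real.rpow_nonneg hb α
  have a3 := Real.rpow_nonneg hc α
  rcases max_choice a (max b c) with h | h <;> rw [h]
  · linarith
  · rcases max_choice b c with h | h <;> rw [h] <;> linarith

/-- The step function with value `y (r k)` on `(r k, r (k + 1)]` for `k < N`. -/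
noncomputable def stepFun {E : Type*} [AddCommMonoid E] (N : ℕ) (r : ℕ → ℝ) (y : ℝ → E)
    (t : ℝ) : E :=
  ∑ k ∈ Finset.range N, (Ioc (r k) (r (k + 1))).indicator (fun _ => y (r k)) t

section StepFun

variable {E : Type*} [AddCommMonoid E] {N : ℕ} {r : ℕ → ℝ} {y : ℝ → E} {t : ℝ}

theorem stepFun_of_mem (hr : Monotone r) {k : ℕ} (hk : k < N) (ht : t ∈ Ioc (r k) (r (k + 1))) :
    stepFun N r y t = y (r k) := by
  rw [stepFun, Finset.sum_eq_single k]
  · exact indicator_of_mem ht _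
  · intro j _ hjk
    refine indicator_of_notMem (fun hj => ?_) _
    exact Set.disjoint_left.1 (hr.pairwise_disjoint_on_Ioc_succ hjk) hj ht
  · intro h; exact absurd (Finset.mem_range.2 hk) h

theorem stepFun_of_le (hr : Monotone r) (ht : t ≤ r 0) : stepFun N r y t = 0 := by
  refine Finset.sum_eq_zero fun k _ => indicator_of_notMem (fun h => ?_) _
  exact absurd h.1 (not_lt.2 (ht.trans (hr (Nat.zero_le k))))

theorem exists_mem_Ioc_of_lt {N : ℕ} {r : ℕ → ℝ} {t : ℝ} (h0 : r 0 < t) (hN : t ≤ r N) :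
    ∃ k < N, t ∈ Ioc (r k) (r (k + 1)) := by
  induction N with
  | zero => exact absurd hN (not_le.2 h0)
  | succ N ih =>
    rcases le_or_gt t (r N) with h | h
    · obtain ⟨k, hk, hk'⟩ := ih h
      exact ⟨k, hk.trans (Nat.lt_succ_self N), hk'⟩
    · exact ⟨N, Nat.lt_succ_self N, h, hN⟩

end StepFun

theorem stronglyMeasurable_stepFun {E : Type*} [NormedAddCommGroup E] (N : ℕ) (r : ℕ → ℝ)
    (y : ℝ → E) : StronglyMeasurable (stepFun N r y) := by
  refine Finset.stronglyMeasurable_fun_sum _ fun k _ => ?_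
  exact stronglyMeasurable_const.indicator measurableSet_Ioc

/-- An `L^α` function is approximated by step functions that take its values, at times outside a
null set. -/
theorem exists_stepFun_approx {E : Type*} [NormedAddCommGroup E] [NormedSpace ℝ E] {α τ : ℝ}
    (hα : 1 ≤ α) (hτ : 0 < τ) {y : ℝ → E}
    (hy : MemLp y (ENNReal.ofReal α) (volume.restrict (Icc 0 τ))) {P : ℝ → Prop}
    (hP : ∀ᵐ t ∂volume.restrict (Icc 0 τ), P t) {ε : ℝ} (hε : 0 < ε) :
    ∃ (N : ℕ) (r : ℕ → ℝ), Monotone r ∧ r 0 ∈ Icc 0 ε ∧ r N = τ ∧ (∀ k, r k ∈ Icc 0 τ) ∧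
      (∀ k < N, P (r k)) ∧ ∫ t in Icc 0 τ, ‖y t - stepFun N r y t‖ ^ α ≤ ε := by
  have hα0 : 0 < α := by linarith
  set Cα : ℝ := 3 ^ α with hCα
  have hCα0 : 0 < Cα := by positivity
  have hyi : IntegrableOn (fun t => ‖y t‖ ^ α) (Icc 0 τ) :=
    (integrable_norm_rpow_iff_memLp hα0 hy.1).2 hy
  -- a continuous approximation
  obtain ⟨g, hg, hgL⟩ := hy.exists_boundedContinuous_eLpNorm_sub_le (by simp)
    (ε := ENNReal.ofReal ((ε / (12 * Cα)) ^ α⁻¹))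
    (by rw [Ne, ENNReal.ofReal_eq_zero, not_le]; positivity)
  set e : ℝ → ℝ := fun t => ‖y t - g t‖ ^ α with he
  have heL : MemLp (fun t => y t - g t) (ENNReal.ofReal α) (volume.restrict (Icc 0 τ)) := hy.sub hgL
  have hei : IntegrableOn e (Icc 0 τ) := (integrable_norm_rpow_iff_memLp hα0 heL.1).2 heL
  have he0 : ∀ t, 0 ≤ e t := fun t => by positivity
  have heint : ∫ t in Icc 0 τ, e t ≤ ε / (12 * Cα) := by
    have h1 := heL.eLpNorm_eq_integral_rpow_norm (by simpa using hα0) (by simp)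
    change eLpNorm (y - ⇑g) _ _ = _ at h1
    rw [h1, ENNReal.toReal_ofReal hα0.le, ENNReal.ofReal_le_ofReal_iff (by positivity),
      Real.rpow_le_rpow_iff (integral_nonneg fun t => by positivity) (by positivity)
      (by positivity)] at hg
    exact hg
  -- choice of the mesh
  have hguc : UniformContinuousOn g (Icc 0 τ) :=
    isCompact_Icc.uniformContinuousOn_of_continuous g.continuous.continuousOn
  set ω : ℝ := (ε / (4 * Cα * τ)) ^ α⁻¹ with hω
  have hω0 : 0 < ω := by positivity
  have hωα : ω ^ α = ε / (4 * Cα * τ) := by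
    rw [hω, ← Real.rpow_mul (by positivity), inv_mul_cancel₀ hα0.ne', Real.rpow_one]
  obtain ⟨δ₁, hδ₁, hδ₁'⟩ := Metric.uniformContinuousOn_iff.1 hguc ω hω0
  have hprim : Tendsto (fun x => ∫ t in (0 : ℝ)..x, ‖y t‖ ^ α) (𝓝[Icc 0 τ] 0) (𝓝 0) := by
    have h := intervalIntegral.continuousOn_primitive_interval (a := 0) (b := τ) (μ := volume)
      (f := fun t => ‖y t‖ ^ α) (by rwa [uIcc_of_le hτ.le])
    rw [uIcc_of_le hτ.le] at h
    have := (h 0 ⟨le_rfl, hτ.le⟩).tendsto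
    simpa using this
  obtain ⟨δ₂, hδ₂, hδ₂'⟩ := Metric.tendsto_nhdsWithin_nhds.1 hprim (ε / 4) (by positivity)
  obtain ⟨N, hN⟩ := exists_nat_gt (max (2 * τ / δ₁) (max (τ / δ₂) (max (τ / ε) 0)))
  simp only [max_lt_iff] at hN
  obtain ⟨hN1, hN2, hN3, hN4⟩ := hN
  set δ : ℝ := τ / N with hδ
  have hδ0 : 0 < δ := by positivity
  have hNδ : N * δ = τ := by rw [hδ]; field_simp
  have hδδ₁ : 2 * δ < δ₁ := by
    rw [div_lt_iff₀ hδ₁] at hN1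
    rw [hδ, ← mul_div_assoc, div_lt_iff₀ hN4]; linarith
  have hδδ₂ : δ < δ₂ := by
    rw [div_lt_iff₀ hδ₂] at hN2
    rw [hδ, div_lt_iff₀ hN4]; linarith
  have hδε : δ < ε := by
    rw [div_lt_iff₀ hε] at hN3
    rw [hδ, div_lt_iff₀ hN4]; linarith
  -- choice of the points
  have hcell : ∀ k : ℕ, k < N → Icc (k * δ) ((k + 1 : ℕ) * δ) ⊆ Icc 0 τ := by
    intro k hk
    refine Icc_subset_Icc (by positivity) ?_
    rw [← hNδ]
    exact mul_le_mul_of_nonneg_right (by exact_mod_cast hk) hδ0.le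
  have hpt : ∀ k : ℕ, k < N → ∃ x ∈ Icc (k * δ) ((k + 1 : ℕ) * δ), P x ∧
      δ * e x ≤ ∫ t in (k * δ)..((k + 1 : ℕ) * δ), e t := by
    intro k hk
    have hlen : ((k + 1 : ℕ) : ℝ) * δ - k * δ = δ := by push_cast; ring
    have hle : (k : ℝ) * δ ≤ (k + 1 : ℕ) * δ := by linarith
    set μ := volume.restrict (Icc ((k : ℝ) * δ) ((k + 1 : ℕ) * δ)) with hμ
    have hμu : μ univ = ENNReal.ofReal δ := by
      rw [hμ, Measure.restrict_apply_univ, Real.volume_Icc, hlen]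
    have hμ0 : μ ≠ 0 := by
      intro h
      rw [h] at hμu
      simp only [Measure.coe_zero, Pi.zero_apply] at hμu
      exact absurd hμu.symm (by rw [ENNReal.ofReal_eq_zero, not_le]; exact hδ0)
    have hfin : IsFiniteMeasure μ := ⟨by rw [hμu]; simp⟩
    have hQ : ∀ᵐ t ∂μ, t ∈ Icc ((k : ℝ) * δ) ((k + 1 : ℕ) * δ) ∧ P t :=
      (ae_restrict_mem measurableSet_Icc).and
        (ae_restrict_of_ae_restrict_of_subset (hcell k hk) hP)
    obtain ⟨x, hx, hxe⟩ := exists_notMem_null_le_average hμ0 (hei.mono_set (hcell k hk))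
      (ae_iff.1 hQ)
    simp only [mem_ofPred_eq, not_not] at hx
    refine ⟨x, hx.1, hx.2, ?_⟩
    rw [average_eq, Measure.real, hμu, ENNReal.toReal_ofReal hδ0.le, smul_eq_mul] at hxe
    rw [intervalIntegral.integral_of_le hle, ← integral_Icc_eq_integral_Ioc]
    calc δ * e x ≤ δ * (δ⁻¹ * ∫ a, e a ∂μ) := mul_le_mul_of_nonneg_left hxe hδ0.le
      _ = _ := by rw [← mul_assoc, mul_inv_cancel₀ hδ0.ne', one_mul]
  choose! ξ hξ hξP hξe using hpt
  set r : ℕ → ℝ := fun k => if k < N then ξ k else τ with hr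
  have hrlt : ∀ k, k < N → r k = ξ k := fun k hk => if_pos hk
  have hrge : ∀ k, N ≤ k → r k = τ := fun k hk => if_neg (not_lt.2 hk)
  have hrτ : ∀ k, r k ∈ Icc 0 τ := by
    intro k
    rcases lt_or_ge k N with h | h
    · rw [hrlt k h]; exact hcell k h (hξ k h)
    · rw [hrge k h]; exact ⟨hτ.le, le_rfl⟩
  have hrmono : Monotone r := by
    refine monotone_nat_of_le_succ fun k => ?_
    rcases lt_or_ge (k + 1) N with h | h
    · rw [hrlt k (by lia), hrlt _ h]
      exact (hξ k (by lia)).2.trans (hξ (k + 1) h).1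
    · rw [hrge _ h]; exact (hrτ k).2
  have hNpos : 0 < N := by exact_mod_cast hN4
  have hr0 : r 0 ≤ δ := by
    rw [hrlt 0 hNpos]
    have := (hξ 0 hNpos).2
    simpa using this
  have hgap : ∀ k, k < N → r (k + 1) - r k ≤ 2 * δ := by
    intro k hk
    have h1 := (hξ k hk).1
    have h2 : r (k + 1) ≤ (k + 2) * δ := by
      rcases lt_or_ge (k + 1) N with h | h
      · rw [hrlt _ h]
        have := (hξ _ h).2
        push_cast at this
        linarith
      · rw [hrge _ h, ← hNδ]
        have : (N : ℝ) ≤ k + 2 := by exact_mod_cast (by lia : N ≤ k + 2)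
        exact mul_le_mul_of_nonneg_right this hδ0.le
    rw [hrlt k hk]
    linarith
  refine ⟨N, r, hrmono, ⟨(hrτ 0).1, hr0.trans hδε.le⟩, hrge N le_rfl, hrτ, fun k hk => ?_, ?_⟩
  · rw [hrlt k hk]; exact hξP k hk
  -- the error
  set S : ℝ → ℝ := stepFun N r e with hS
  have hS0 : ∀ t, 0 ≤ S t := fun t =>
    Finset.sum_nonneg fun k _ => indicator_nonneg (fun _ _ => he0 _) _
  have hptw : ∀ t ∈ Icc 0 τ, ‖y t - stepFun N r y t‖ ^ α
      ≤ Cα * (e t + ω ^ α + S t) + (Icc 0 δ).indicator (fun t => ‖y t‖ ^ α) t := by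
    intro t ht
    have hind : 0 ≤ (Icc 0 δ).indicator (fun t => ‖y t‖ ^ α) t :=
      indicator_nonneg (fun _ _ => by positivity) _
    rcases le_or_gt t (r 0) with h | h
    · rw [stepFun_of_le hrmono h, sub_zero,
        indicator_of_mem (show t ∈ Icc 0 δ from ⟨ht.1, h.trans hr0⟩)]
      have := hS0 t
      have := he0 t
      have : 0 ≤ Cα * (e t + ω ^ α + S t) := by positivity
      linarith
    · obtain ⟨k, hk, htk⟩ := exists_mem_Ioc_of_lt h (by rw [hrge N le_rfl]; exact ht.2)
      rw [hS, stepFun_of_mem hrmono hk htk, stepFun_of_mem hrmono hk htk]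
      have hd : ‖g t - g (r k)‖ ≤ ω := by
        rw [← dist_eq_norm]
        refine (hδ₁' t ht (r k) (hrτ k) ?_).le
        rw [Real.dist_eq, abs_of_nonneg (by linarith [htk.1])]
        have := hgap k hk
        linarith [htk.2]
      have htri : ‖y t - y (r k)‖ ≤ ‖y t - g t‖ + ω + ‖y (r k) - g (r k)‖ := by
        have : y t - y (r k) = (y t - g t) + (g t - g (r k)) - (y (r k) - g (r k)) := by abel
        rw [this]
        refine (norm_sub_le _ _).trans ?_
        have := norm_add_le (y t - g t) (g t - g (r k))
        linarith
      have h1 := Real.rpow_le_rpow (norm_nonneg _) htri hα0.le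
      have h2 := add_rpow_le_const_mul hα0.le (norm_nonneg (y t - g t)) hω0.le
        (norm_nonneg (y (r k) - g (r k)))
      simp only [he]
      linarith
  have hSi : IntegrableOn S (Icc 0 τ) := by
    refine integrable_finsetSum _ fun k _ => ?_
    exact (integrable_const _).indicator measurableSet_Ioc
  have hSint : ∫ t in Icc 0 τ, S t ≤ 2 * ∫ t in Icc 0 τ, e t := by
    rw [hS]
    simp only [stepFun]
    rw [integral_finsetSum _ fun k _ => (integrable_const _).indicator measurableSet_Ioc]
    have h1 : ∀ k ∈ Finset.range N,
        ∫ t in Icc 0 τ, (Ioc (r k) (r (k + 1))).indicator (fun _ => e (r k)) t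
          ≤ 2 * ∫ t in ((k : ℕ) * δ)..((k + 1 : ℕ) * δ), e t := by
      intro k hk
      have hk' := Finset.mem_range.1 hk
      rw [integral_indicator measurableSet_Ioc, Measure.restrict_restrict measurableSet_Ioc,
        inter_eq_left.2 (show Ioc (r k) (r (k + 1)) ⊆ Icc 0 τ from
          fun t ht => ⟨(hrτ k).1.trans ht.1.le, ht.2.trans (hrτ (k + 1)).2⟩),
        setIntegral_const, Measure.real, Real.volume_Ioc,
        ENNReal.toReal_ofReal (sub_nonneg.2 (hrmono (Nat.le_succ k))), smul_eq_mul]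
      have h2 := hξe k hk'
      rw [← hrlt k hk'] at h2
      have h3 := mul_le_mul_of_nonneg_right (hgap k hk') (he0 (r k))
      linarith
    refine (Finset.sum_le_sum h1).trans ?_
    rw [← Finset.mul_sum, intervalIntegral.sum_integral_adjacent_intervals
      (a := fun k : ℕ => (k : ℝ) * δ)]
    · rw [Nat.cast_zero, zero_mul, hNδ, intervalIntegral.integral_of_le hτ.le,
        integral_Icc_eq_integral_Ioc]
    · intro k hk
      rw [intervalIntegrable_iff_integrableOn_Icc_of_le
        (mul_le_mul_of_nonneg_right (by exact_mod_cast Nat.le_succ k) hδ0.le)]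
      exact hei.mono_set (hcell k hk)
  have hindi : IntegrableOn ((Icc 0 δ).indicator fun t => ‖y t‖ ^ α) (Icc 0 τ) :=
    hyi.indicator measurableSet_Icc
  have hconst : IntegrableOn (fun _ : ℝ => ω ^ α) (Icc 0 τ) := integrable_const _
  have h12 : IntegrableOn (fun t => e t + ω ^ α) (Icc 0 τ) := hei.add hconst
  have h123 : IntegrableOn (fun t => e t + ω ^ α + S t) (Icc 0 τ) := h12.add hSi
  have hrhs : IntegrableOn (fun t => Cα * (e t + ω ^ α + S t)
      + (Icc 0 δ).indicator (fun t => ‖y t‖ ^ α) t) (Icc 0 τ) :=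
    (h123.const_mul Cα).add hindi
  have hδτ : δ ≤ τ := by
    rw [hδ]; exact div_le_self hτ.le (by exact_mod_cast hNpos)
  have hind4 : ∫ t in Icc 0 τ, (Icc 0 δ).indicator (fun t => ‖y t‖ ^ α) t ≤ ε / 4 := by
    rw [integral_indicator measurableSet_Icc, Measure.restrict_restrict measurableSet_Icc,
      inter_eq_left.2 (Icc_subset_Icc_right hδτ), integral_Icc_eq_integral_Ioc,
      ← intervalIntegral.integral_of_le hδ0.le]
    have := hδ₂' (x := δ) ⟨hδ0.le, hδτ⟩ (by rw [Real.dist_eq, sub_zero, abs_of_pos hδ0]; exact hδδ₂)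
    rw [Real.dist_eq, sub_zero] at this
    exact (le_abs_self _).trans this.le
  calc ∫ t in Icc 0 τ, ‖y t - stepFun N r y t‖ ^ α
      ≤ ∫ t in Icc 0 τ, (Cα * (e t + ω ^ α + S t)
        + (Icc 0 δ).indicator (fun t => ‖y t‖ ^ α) t) :=
        integral_mono_of_nonneg (ae_of_all _ fun t => by positivity) hrhs
          ((ae_restrict_mem measurableSet_Icc).mono hptw)
    _ = Cα * ((∫ t in Icc 0 τ, e t) + τ * ω ^ α + ∫ t in Icc 0 τ, S t)
        + ∫ t in Icc 0 τ, (Icc 0 δ).indicator (fun t => ‖y t‖ ^ α) t := by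
        rw [integral_add (h123.const_mul Cα) hindi, integral_const_mul,
          integral_add h12 hSi, integral_add hei hconst, setIntegral_const,
          Measure.real, Real.volume_Icc, sub_zero, ENNReal.toReal_ofReal hτ.le, smul_eq_mul]
    _ ≤ Cα * (ε / (12 * Cα) + τ * (ε / (4 * Cα * τ)) + 2 * (ε / (12 * Cα))) + ε / 4 := by
        rw [hωα]
        refine add_le_add (mul_le_mul_of_nonneg_left ?_ hCα0.le) hind4
        linarith
    _ = 3 * ε / 4 := by field_simp; ring
    _ ≤ ε := by linarith

end SkeletonEq

namespace SkeletonEq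

/-! ### Pairings of `V*`-valued and `V`-valued functions and the energy inequality -/

section Pairing

variable {V H : Type*} [NormedAddCommGroup V] [NormedSpace ℝ V]
  [NormedAddCommGroup H] [InnerProductSpace ℝ H]

/-- The bound on `V*`-valued functions under which the pairings below are integrable. -/
def HasGrowthBound (μ : Measure ℝ) (ι : V →L[ℝ] H) (α : ℝ) (F D q : ℝ → ℝ)
    (w : ℝ → StrongDual ℝ V) : Prop :=
  ∀ᵐ t ∂μ, ∀ ε > 0, ∀ z, |w t z| ≤ ε * q t + D ε * (‖z‖ ^ α + F t * ‖ι z‖ ^ 2)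

variable {μ : Measure ℝ} {ι : V →L[ℝ] H} {α : ℝ} {F D q : ℝ → ℝ} {w : ℝ → StrongDual ℝ V}
  {z : ℝ → V}

theorem aestronglyMeasurable_pairing (hw : AEStronglyMeasurable w μ)
    (hz : AEStronglyMeasurable z μ) : AEStronglyMeasurable (fun t => w t (z t)) μ :=
  (isBoundedBilinearMap_apply (𝕜 := ℝ) (E := V) (F := ℝ)).continuous.comp_aestronglyMeasurable
    (hw.prodMk hz)

theorem HasGrowthBound.integrable_pairing (hb : HasGrowthBound μ ι α F D q w)
    (hw : AEStronglyMeasurable w μ) (hz : AEStronglyMeasurable z μ) (hq : Integrable q μ)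
    (hzα : Integrable (fun t => ‖z t‖ ^ α) μ) (hzF : Integrable (fun t => F t * ‖ι (z t)‖ ^ 2) μ) :
    Integrable (fun t => w t (z t)) μ := by
  refine Integrable.mono' ((hq.const_mul 1).add ((hzα.add hzF).const_mul (D 1)))
    (aestronglyMeasurable_pairing hw hz) ?_
  filter_upwards [hb] with t ht
  exact ht 1 one_pos (z t)

theorem HasGrowthBound.abs_integral_pairing_le (hb : HasGrowthBound μ ι α F D q w)
    (hq : Integrable q μ) (hzα : Integrable (fun t => ‖z t‖ ^ α) μ)
    (hzF : Integrable (fun t => F t * ‖ι (z t)‖ ^ 2) μ) {ε : ℝ} (hε : 0 < ε) :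
    |∫ t, w t (z t) ∂μ|
      ≤ ε * ∫ t, q t ∂μ + D ε * (∫ t, ‖z t‖ ^ α ∂μ + ∫ t, F t * ‖ι (z t)‖ ^ 2 ∂μ) := by
  have h1 : |∫ t, w t (z t) ∂μ| ≤ ∫ t, |w t (z t)| ∂μ := abs_integral_le_integral_abs
  refine h1.trans ?_
  have h2 : Integrable (fun t => ‖z t‖ ^ α + F t * ‖ι (z t)‖ ^ 2) μ := hzα.add hzF
  calc ∫ t, |w t (z t)| ∂μ
      ≤ ∫ t, (ε * q t + D ε * (‖z t‖ ^ α + F t * ‖ι (z t)‖ ^ 2)) ∂μ :=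
        integral_mono_of_nonneg (ae_of_all _ fun t => abs_nonneg _)
          ((hq.const_mul ε).add (h2.const_mul _)) (hb.mono fun t ht => ht ε hε (z t))
    _ = _ := by
      rw [integral_add (hq.const_mul ε) (h2.const_mul _), integral_const_mul, integral_const_mul,
        integral_add hzα hzF]

theorem integrable_mul_norm_sq_of_bounded (hF : Integrable F μ) (hF0 : ∀ᵐ t ∂μ, 0 ≤ F t)
    (hz : AEStronglyMeasurable z μ) {M : ℝ} (hM : ∀ᵐ t ∂μ, ‖ι (z t)‖ ≤ M) :
    Integrable (fun t => F t * ‖ι (z t)‖ ^ 2) μ := by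
  refine Integrable.mono' (hF.mul_const (M ^ 2))
    (hF.1.mul ((ι.continuous.comp_aestronglyMeasurable hz).norm.pow 2)) ?_
  filter_upwards [hF0, hM] with t h1 h2
  rw [Real.norm_eq_abs, abs_of_nonneg (by positivity)]
  gcongr

theorem norm_stepFun_le {N : ℕ} {r : ℕ → ℝ} (hr : Monotone r) {y : ℝ → V} {M : ℝ} (hM : 0 ≤ M)
    (h : ∀ k < N, ‖ι (y (r k))‖ ≤ M) {t : ℝ} (ht : t ≤ r N) : ‖ι (stepFun N r y t)‖ ≤ M := by
  rcases le_or_gt t (r 0) with h0 | h0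
  · rw [stepFun_of_le hr h0]; simpa using hM
  · obtain ⟨k, hk, htk⟩ := exists_mem_Ioc_of_lt h0 ht
    rw [stepFun_of_mem hr hk htk]; exact h k hk

theorem integrable_norm_rpow_stepFun {E : Type*} [NormedAddCommGroup E] {α τ : ℝ} (hα : 0 < α)
    {N : ℕ} {r : ℕ → ℝ} {y : ℝ → E} :
    IntegrableOn (fun t => ‖stepFun N r y t‖ ^ α) (Icc 0 τ) := by
  rw [IntegrableOn, integrable_norm_rpow_iff_memLp hα
    (stronglyMeasurable_stepFun N r y).aestronglyMeasurable]
  exact memLp_finsetSum (Finset.range N)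
    (f := fun k => (Ioc (r k) (r (k + 1))).indicator fun _ => y (r k))
    fun k _ => (memLp_const _).indicator measurableSet_Ioc

/-- Step functions that approximate `y` both in `L^α(0, τ; V)` and in a weighted `L²(0, τ; H)`. -/
theorem exists_stepFun_approx_weighted {τ : ℝ} (hα : 1 ≤ α) (hτ : 0 < τ) {y : ℝ → V}
    (hy : MemLp y (ENNReal.ofReal α) (volume.restrict (Icc 0 τ))) {u : ℝ → H}
    (hyu : ∀ᵐ t ∂volume.restrict (Icc 0 τ), ι (y t) = u t) {M : ℝ}
    (hM : ∀ t ∈ Icc 0 τ, ‖u t‖ ≤ M) (hF : IntegrableOn F (Icc 0 τ))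
    (hF0 : ∀ᵐ t ∂volume.restrict (Icc 0 τ), 0 ≤ F t) {ε : ℝ} (hε : 0 < ε) :
    ∃ (N : ℕ) (r : ℕ → ℝ), Monotone r ∧ r 0 ∈ Icc 0 ε ∧ r N = τ ∧ (∀ k, r k ∈ Icc 0 τ) ∧
      (∀ k < N, ι (y (r k)) = u (r k)) ∧
      IntegrableOn (fun t => ‖y t - stepFun N r y t‖ ^ α) (Icc 0 τ) ∧
      IntegrableOn (fun t => F t * ‖ι (y t - stepFun N r y t)‖ ^ 2) (Icc 0 τ) ∧
      ∫ t in Icc 0 τ, ‖y t - stepFun N r y t‖ ^ α ≤ ε ∧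
      ∫ t in Icc 0 τ, F t * ‖ι (y t - stepFun N r y t)‖ ^ 2 ≤ ε := by
  have hα0 : 0 < α := by linarith
  have hM0 : 0 ≤ M := (norm_nonneg _).trans (hM 0 ⟨le_rfl, hτ.le⟩)
  set μ := volume.restrict (Icc 0 τ) with hμ
  set d : ℕ → ℝ := fun n => 1 / ((n : ℝ) + 1)
  have hd : ∀ n, 0 < d n := fun n => by positivity
  have hd0 : Tendsto d atTop (𝓝 0) := tendsto_one_div_add_atTop_nhds_zero_nat
  choose N r hr hr0 hrN hrτ hrP hrint using fun n => exists_stepFun_approx hα hτ hy hyu (hd n)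
  set ψ : ℕ → ℝ → V := fun n t => y t - stepFun (N n) (r n) y t with hψ
  have hψm : ∀ n, AEStronglyMeasurable (ψ n) μ := fun n =>
    hy.1.sub (stronglyMeasurable_stepFun _ _ _).aestronglyMeasurable
  have hψL : ∀ n, MemLp (ψ n) (ENNReal.ofReal α) μ := fun n => hy.sub
    ((integrable_norm_rpow_iff_memLp hα0
      (stronglyMeasurable_stepFun _ _ _).aestronglyMeasurable).1 (integrable_norm_rpow_stepFun hα0))
  have hψα : ∀ n, Integrable (fun t => ‖ψ n t‖ ^ α) μ := fun n =>
    (integrable_norm_rpow_iff_memLp hα0 (hψm n)).2 (hψL n)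
  have hψM : ∀ n, ∀ᵐ t ∂μ, ‖ι (ψ n t)‖ ≤ M + M := by
    intro n
    filter_upwards [hyu, ae_restrict_mem measurableSet_Icc] with t ht htI
    rw [hψ]
    simp only [map_sub]
    refine (norm_sub_le _ _).trans (add_le_add (by rw [ht]; exact hM t htI) ?_)
    refine norm_stepFun_le (hr n) hM0 (fun k hk => ?_) (by rw [hrN]; exact htI.2)
    rw [hrP n k hk]; exact hM _ (hrτ n k)
  have hψF : ∀ n, Integrable (fun t => F t * ‖ι (ψ n t)‖ ^ 2) μ := fun n =>
    integrable_mul_norm_sq_of_bounded hF hF0 (hψm n) (hψM n)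
  have hlim : Tendsto (fun n => ∫ t, |‖ψ n t‖ ^ α| ∂μ) atTop (𝓝 0) := by
    refine squeeze_zero (fun n => integral_nonneg fun t => abs_nonneg _) (fun n => ?_) hd0
    refine le_trans (le_of_eq ?_) (hrint n)
    refine integral_congr_ae (ae_of_all _ fun t => ?_)
    exact abs_of_nonneg (by positivity)
  obtain ⟨σ, hσ, hσlim⟩ := exists_subseq_tendsto_ae_zero hψα hlim
  have hσ0 : ∀ᵐ t ∂μ, Tendsto (fun n => ι (ψ (σ n) t)) atTop (𝓝 0) := by
    filter_upwards [hσlim] with t ht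
    have h1 : Tendsto (fun n => ‖ψ (σ n) t‖) atTop (𝓝 0) := by
      have h2 := ht.rpow_const (p := α⁻¹) (Or.inr (by positivity))
      rw [Real.zero_rpow (by positivity)] at h2
      refine h2.congr fun n => ?_
      rw [← Real.rpow_mul (norm_nonneg _), mul_inv_cancel₀ hα0.ne', Real.rpow_one]
    have h3 := (ι.continuous.tendsto 0).comp (tendsto_zero_iff_norm_tendsto_zero.2 h1)
    rw [map_zero] at h3
    exact h3
  have hFlim : Tendsto (fun n => ∫ t, F t * ‖ι (ψ (σ n) t)‖ ^ 2 ∂μ) atTop (𝓝 0) := by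
    have := tendsto_integral_of_dominated_convergence (μ := μ) (f := fun _ => (0 : ℝ))
      (fun t => F t * (M + M) ^ 2) (fun n => (hψF (σ n)).1) (hF.mul_const _)
      (fun n => by
        filter_upwards [hF0, hψM (σ n)] with t h1 h2
        rw [Real.norm_eq_abs, abs_of_nonneg (by positivity)]
        gcongr)
      (by
        filter_upwards [hσ0] with t ht
        simpa using (ht.norm.pow 2).const_mul (F t))
    simpa using this
  have hev := (hFlim.eventually (ge_mem_nhds hε)).and
    ((hd0.comp hσ.tendsto_atTop).eventually (ge_mem_nhds hε))
  obtain ⟨n, hn1, hn2⟩ := hev.exists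
  exact ⟨N (σ n), r (σ n), hr _, ⟨(hr0 _).1, (hr0 _).2.trans hn2⟩, hrN _, hrτ _, hrP _, hψα _,
    hψF _, (hrint _).trans hn2, hn1⟩

theorem setIntegral_pairing_stepFun {τ : ℝ} {N : ℕ} {r : ℕ → ℝ} (hr : Monotone r)
    (hrτ : ∀ k, r k ∈ Icc 0 τ) {y : ℝ → V}
    (hw : ∀ v : V, IntegrableOn (fun t => w t v) (Icc 0 τ)) :
    ∫ t in Icc 0 τ, w t (stepFun N r y t)
      = ∑ k ∈ Finset.range N, ∫ t in (r k)..(r (k + 1)), w t (y (r k)) := by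
  have h1 : ∀ t, w t (stepFun N r y t) = ∑ k ∈ Finset.range N,
      (Ioc (r k) (r (k + 1))).indicator (fun t => w t (y (r k))) t := by
    intro t
    rw [stepFun, map_sum]
    refine Finset.sum_congr rfl fun k _ => ?_
    by_cases h : t ∈ Ioc (r k) (r (k + 1))
    · rw [indicator_of_mem h, indicator_of_mem h]
    · rw [indicator_of_notMem h, indicator_of_notMem h, map_zero]
  simp_rw [h1]
  rw [integral_finsetSum _ fun k _ => (hw (y (r k))).indicator measurableSet_Ioc]
  refine Finset.sum_congr rfl fun k _ => ?_
  rw [integral_indicator measurableSet_Ioc, Measure.restrict_restrict measurableSet_Ioc,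
    inter_eq_left.2 (show Ioc (r k) (r (k + 1)) ⊆ Icc 0 τ from
      fun t ht => ⟨(hrτ k).1.trans ht.1.le, ht.2.trans (hrτ (k + 1)).2⟩),
    intervalIntegral.integral_of_le (hr (Nat.le_succ k))]

/-- The energy inequality for the limit of a sequence of approximations: if
`∫ₛᵗ ⟨wₙ, v⟩ → (u t - u s, v)` for all `v`, then `limsup 2 ∫ ⟨wₙ, u⟩ ≤ ‖u τ‖² - ‖u 0‖²`. -/
theorem eventually_two_mul_integral_le {τ : ℝ} (hα : 1 ≤ α) (hτ : 0 < τ) {y : ℝ → V}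
    (hy : MemLp y (ENNReal.ofReal α) (volume.restrict (Icc 0 τ))) {u : ℝ → H}
    (hyu : ∀ᵐ t ∂volume.restrict (Icc 0 τ), ι (y t) = u t) {M : ℝ}
    (hM : ∀ t ∈ Icc 0 τ, ‖u t‖ ≤ M) (hF : IntegrableOn F (Icc 0 τ))
    (hF0 : ∀ᵐ t ∂volume.restrict (Icc 0 τ), 0 ≤ F t) {w : ℕ → ℝ → StrongDual ℝ V} {q : ℕ → ℝ → ℝ}
    (hw : ∀ n, AEStronglyMeasurable (w n) (volume.restrict (Icc 0 τ)))
    (hq : ∀ n, IntegrableOn (q n) (Icc 0 τ)) {Q : ℝ} (hQ : ∀ n, ∫ t in Icc 0 τ, q n t ≤ Q)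
    (hb : ∀ n, HasGrowthBound (volume.restrict (Icc 0 τ)) ι α F D (q n) (w n))
    (hD : ∀ ε, 0 ≤ D ε)
    (hlim : ∀ v : V, ∀ s ∈ Icc 0 τ, ∀ t ∈ Icc 0 τ, Tendsto (fun n => ∫ r in s..t, w n r v) atTop
      (𝓝 (inner ℝ (u t - u s) (ι v))))
    (hlsc : ∀ ε > 0, ∃ δ > 0, ∀ t ∈ Icc 0 τ, t ≤ δ → ‖u 0‖ ^ 2 - ε ≤ ‖u t‖ ^ 2)
    {ε : ℝ} (hε : 0 < ε) :
    ∀ᶠ n in atTop, 2 * ∫ t in Icc 0 τ, w n t (y t) ≤ ‖u τ‖ ^ 2 - ‖u 0‖ ^ 2 + ε := by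
  have hα0 : 0 < α := by linarith
  set ε' : ℝ := ε / (8 * (|Q| + 1)) with hε'
  have hε'0 : 0 < ε' := by positivity
  obtain ⟨δ, hδ, hδ'⟩ := hlsc (ε / 4) (by positivity)
  set η : ℝ := min δ (ε / (16 * (D ε' + 1))) with hη
  have hDε := hD ε'
  have hη0 : 0 < η := lt_min hδ (by positivity)
  obtain ⟨N, r, hr, hr0, hrN, hrτ, hru, hψα, hψF, hψα', hψF'⟩ :=
    exists_stepFun_approx_weighted hα hτ hy hyu hM hF hF0 hη0
  have hconstα : ∀ v : V, IntegrableOn (fun _ : ℝ => ‖v‖ ^ α) (Icc 0 τ) := fun v =>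
    integrable_const _
  have hwv : ∀ n, ∀ v : V, IntegrableOn (fun t => w n t v) (Icc 0 τ) := fun n v =>
    (hb n).integrable_pairing (hw n) aestronglyMeasurable_const (hq n) (hconstα v)
      (hF.mul_const _)
  -- the contribution of the step function
  have hsum : Tendsto (fun n => ∫ t in Icc 0 τ, w n t (stepFun N r y t)) atTop
      (𝓝 (∑ k ∈ Finset.range N, inner ℝ (u (r (k + 1)) - u (r k)) (u (r k)))) := by
    simp_rw [fun n => setIntegral_pairing_stepFun (N := N) (y := y) hr hrτ (hwv n)]
    refine tendsto_finsetSum _ fun k hk => ?_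
    rw [← hru k (Finset.mem_range.1 hk)]
    have := hlim (y (r k)) (r k) (hrτ k) (r (k + 1)) (hrτ (k + 1))
    rwa [← hru k (Finset.mem_range.1 hk)] at this
  have htel : 2 * ∑ k ∈ Finset.range N, inner ℝ (u (r (k + 1)) - u (r k)) (u (r k))
      ≤ ‖u τ‖ ^ 2 - ‖u (r 0)‖ ^ 2 := by
    rw [Finset.mul_sum, ← hrN, ← Finset.sum_range_sub (fun k => ‖u (r k)‖ ^ 2)]
    refine Finset.sum_le_sum fun k _ => ?_
    have h1 : u (r (k + 1)) = (u (r (k + 1)) - u (r k)) + u (r k) := by abel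
    have h2 := norm_add_sq_real (u (r (k + 1)) - u (r k)) (u (r k))
    rw [← h1] at h2
    have h3 := sq_nonneg ‖u (r (k + 1)) - u (r k)‖
    linarith
  have h0 := hδ' (r 0) (hrτ 0) (hr0.2.trans (min_le_left _ _))
  have hev := hsum.eventually (gt_mem_nhds (lt_add_of_pos_right _ (by positivity : 0 < ε / 8)))
  filter_upwards [hev] with n hn
  have hψm : AEStronglyMeasurable (fun t => y t - stepFun N r y t) (volume.restrict (Icc 0 τ)) :=
    hy.1.sub (stronglyMeasurable_stepFun _ _ _).aestronglyMeasurable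
  have hsplit : ∫ t in Icc 0 τ, w n t (y t) = (∫ t in Icc 0 τ, w n t (stepFun N r y t))
      + ∫ t in Icc 0 τ, w n t (y t - stepFun N r y t) := by
    rw [← integral_add]
    · refine integral_congr_ae (ae_of_all _ fun t => ?_)
      simp only [map_sub]; ring
    · have h1 : ∀ t ∈ Icc 0 τ, ‖ι (stepFun N r y t)‖ ≤ M := fun t ht =>
        norm_stepFun_le hr ((norm_nonneg _).trans (hM t ht))
          (fun k hk => by rw [hru k hk]; exact hM _ (hrτ k)) (by rw [hrN]; exact ht.2)
      exact (hb n).integrable_pairing (hw n)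
        (stronglyMeasurable_stepFun _ _ _).aestronglyMeasurable (hq n)
        (integrable_norm_rpow_stepFun hα0)
        (integrable_mul_norm_sq_of_bounded hF hF0
          (stronglyMeasurable_stepFun _ _ _).aestronglyMeasurable
          ((ae_restrict_mem measurableSet_Icc).mono h1))
    · exact (hb n).integrable_pairing (hw n) hψm (hq n) hψα hψF
  have herr := (le_abs_self _).trans ((hb n).abs_integral_pairing_le (hq n) hψα hψF hε'0)
  have h3 : ε' * ∫ t in Icc 0 τ, q n t ≤ ε / 8 := by
    have h4 : ∫ t in Icc 0 τ, q n t ≤ |Q| + 1 := by linarith [hQ n, le_abs_self Q]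
    refine (mul_le_mul_of_nonneg_left h4 hε'0.le).trans (le_of_eq ?_)
    rw [hε']; field_simp
  have h5 : D ε' * ((∫ t in Icc 0 τ, ‖y t - stepFun N r y t‖ ^ α)
      + ∫ t in Icc 0 τ, F t * ‖ι (y t - stepFun N r y t)‖ ^ 2) ≤ ε / 8 := by
    have h6 : (∫ t in Icc 0 τ, ‖y t - stepFun N r y t‖ ^ α)
        + ∫ t in Icc 0 τ, F t * ‖ι (y t - stepFun N r y t)‖ ^ 2 ≤ 2 * (ε / (16 * (D ε' + 1))) := by
      have := min_le_right δ (ε / (16 * (D ε' + 1)))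
      linarith
    refine (mul_le_mul_of_nonneg_left h6 hDε).trans ?_
    rw [← mul_assoc, mul_div_assoc', div_le_div_iff₀ (by positivity) (by positivity)]
    nlinarith
  rw [hsplit]
  linarith

end Pairing

end SkeletonEq

namespace SkeletonEq

/-! ### Pseudo-monotonicity -/

section PseudoMonotone

variable {V H : Type*} [NormedAddCommGroup V] [NormedSpace ℝ V]
  [NormedAddCommGroup H] [InnerProductSpace ℝ H]

/-- The properties, at a fixed time, of the full drift `u ↦ A(t, u) + B(t, u) h(t)`. Here `φ` is the
value at this time of an integrable function. -/
structure PointwiseAdmissible (ι : V →L[ℝ] H) (α c : ℝ) (K D : ℝ → ℝ) (φ : ℝ)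
    (a : V → StrongDual ℝ V) : Prop where
  nonneg : 0 ≤ φ
  hemi : ∀ u v x : V, Continuous fun l : ℝ => a (u + l • v) x
  mono : ∀ M u v, ‖ι u‖ ≤ M → ‖ι v‖ ≤ M →
    2 * (a u - a v) (u - v) ≤ K M * (φ + ‖u‖ ^ α + ‖v‖ ^ α) * ‖ι (u - v)‖ ^ 2
  coer : ∀ u, 2 * a u u ≤ φ * (1 + ‖ι u‖ ^ 2) - c * ‖u‖ ^ α
  growth : ∀ M u, ‖ι u‖ ≤ M → ∀ ε > 0, ∀ z,
    |a u z| ≤ ε * (K M * (φ + ‖u‖ ^ α)) + D ε * (‖z‖ ^ α + φ * ‖ι z‖ ^ 2)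

namespace PointwiseAdmissible

variable {ι : V →L[ℝ] H} {α c : ℝ} {K D : ℝ → ℝ} {φ : ℝ} {a : V → StrongDual ℝ V}

theorem mono_of_norm_le (h : PointwiseAdmissible ι α c K D φ a) (hα : 0 ≤ α) (hK : ∀ M, 0 ≤ K M)
    {R : ℝ} {u v : V} (hu : ‖u‖ ≤ R) (hv : ‖v‖ ≤ R) :
    2 * (a u - a v) (u - v)
      ≤ K (‖ι‖ * R) * (φ + R ^ α + R ^ α) * ‖ι (u - v)‖ ^ 2 := by
  have hι : ∀ w : V, ‖w‖ ≤ R → ‖ι w‖ ≤ ‖ι‖ * R := fun w hw =>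
    (ι.le_opNorm w).trans (mul_le_mul_of_nonneg_left hw (norm_nonneg _))
  refine (h.mono _ u v (hι u hu) (hι v hv)).trans ?_
  have := hK (‖ι‖ * R)
  gcongr

theorem eventually_pairing_sub_lt (h : PointwiseAdmissible ι α c K D φ a) (hα : 0 ≤ α)
    (hK : ∀ M, 0 ≤ K M) (hV : IsReflexiveBanach V) (hι : Function.Injective ι) {u : ℕ → V} {u' : V}
    {R : ℝ} (hR : ∀ n, ‖u n‖ ≤ R) (hu : Tendsto (fun n => ι (u n)) atTop (𝓝 (ι u'))) {ε : ℝ}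
    (hε : 0 < ε) : ∀ᶠ n in atTop, a (u n) (u n - u') < ε := by
  set R' := max R ‖u'‖
  have h1 : Tendsto (fun n => 2 * a u' (u n - u')
      + K (‖ι‖ * R') * (φ + R' ^ α + R' ^ α) * ‖ι (u n - u')‖ ^ 2) atTop (𝓝 0) := by
    have h2 : Tendsto (fun n => a u' (u n - u')) atTop (𝓝 0) := by
      have := (tendsto_dual_apply hV hι hR hu (a u')).sub_const (a u' u')
      simpa using this
    have h3 : Tendsto (fun n => ‖ι (u n - u')‖ ^ 2) atTop (𝓝 0) := by
      have := ((hu.sub_const (ι u')).norm.pow 2)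
      simpa using this
    simpa using (h2.const_mul 2).add (h3.const_mul _)
  filter_upwards [h1.eventually (gt_mem_nhds (by positivity : 0 < 2 * ε))] with n hn
  have h4 := h.mono_of_norm_le hα hK ((hR n).trans (le_max_left R ‖u'‖)) (le_max_right R ‖u'‖)
  rw [sub_apply] at h4
  linarith

theorem eventually_apply_lt (h : PointwiseAdmissible ι α c K D φ a) (hα : 0 ≤ α)
    (hK : ∀ M, 0 ≤ K M) (hV : IsReflexiveBanach V) (hι : Function.Injective ι) {u : ℕ → V} {u' : V}
    {R : ℝ} (hR : ∀ n, ‖u n‖ ≤ R) (hu : Tendsto (fun n => ι (u n)) atTop (𝓝 (ι u')))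
    (h0 : Tendsto (fun n => a (u n) (u n - u')) atTop (𝓝 0)) (w : V) {ε : ℝ} (hε : 0 < ε) :
    ∀ᶠ n in atTop, a (u n) w < a u' w + ε := by
  set R' := max R (‖u'‖ + ‖w‖)
  set C := K (‖ι‖ * R') * (φ + R' ^ α + R' ^ α)
  have hlam : Tendsto (fun l : ℝ => a (u' + l • (-w)) w + C / 2 * l * ‖ι w‖ ^ 2 + l) (𝓝[>] 0)
      (𝓝 (a u' w)) := by
    have h1 := (h.hemi u' (-w) w).tendsto 0
    have h2 : Tendsto (fun l : ℝ => a (u' + l • (-w)) w + C / 2 * l * ‖ι w‖ ^ 2 + l) (𝓝 0)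
        (𝓝 (a (u' + (0 : ℝ) • (-w)) w + C / 2 * 0 * ‖ι w‖ ^ 2 + 0)) :=
      (h1.add ((tendsto_id.const_mul _).mul_const _)).add tendsto_id
    simp only [zero_smul, add_zero, mul_zero, zero_mul] at h2
    exact h2.mono_left nhdsWithin_le_nhds
  have hsmall : ∀ᶠ l : ℝ in 𝓝[>] 0, l ∈ Ioc (0 : ℝ) 1 :=
    Ioc_mem_nhdsGT one_pos
  obtain ⟨l, hl, hl1⟩ := ((hlam.eventually (gt_mem_nhds (lt_add_of_pos_right _ hε))).and
    hsmall).exists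
  set v := u' + l • (-w) with hv
  have hvR : ‖v‖ ≤ R' := by
    refine le_trans ?_ (le_max_right _ _)
    refine (norm_add_le _ _).trans ?_
    rw [norm_smul, norm_neg, Real.norm_eq_abs, abs_of_pos hl1.1]
    have := mul_le_mul_of_nonneg_right hl1.2 (norm_nonneg w)
    linarith
  have huv : u' - v = l • w := by rw [hv]; simp
  have hlim : Tendsto (fun n => 2 * a v (u n - v) - 2 * a (u n) (u n - u')
      + C * ‖ι (u n - v)‖ ^ 2) atTop (𝓝 (2 * (l * a v w) + C * (l ^ 2 * ‖ι w‖ ^ 2))) := by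
    have h2 : Tendsto (fun n => a v (u n - v)) atTop (𝓝 (l * a v w)) := by
      have := (tendsto_dual_apply hV hι hR hu (a v)).sub_const (a v v)
      rw [← map_sub, huv, map_smul, smul_eq_mul] at this
      simpa using this
    have h3 : Tendsto (fun n => ‖ι (u n - v)‖ ^ 2) atTop (𝓝 (l ^ 2 * ‖ι w‖ ^ 2)) := by
      have := (hu.sub_const (ι v)).norm.pow 2
      rw [← map_sub, huv, map_smul, norm_smul, mul_pow, Real.norm_eq_abs, sq_abs] at this
      simpa using this
    have := ((h2.const_mul 2).sub (h0.const_mul 2)).add (h3.const_mul C)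
    simpa using this
  have hgap : 2 * (l * a v w) + C * (l ^ 2 * ‖ι w‖ ^ 2)
      < 2 * l * (a v w + C / 2 * l * ‖ι w‖ ^ 2 + l) := by
    have := mul_pos hl1.1 hl1.1
    nlinarith
  filter_upwards [hlim.eventually (gt_mem_nhds hgap)] with n hn
  have h4 := h.mono_of_norm_le hα hK ((hR n).trans (le_max_left R (‖u'‖ + ‖w‖))) hvR
  have h5 : a (u n) (u n - v) = a (u n) (u n - u') + l * a (u n) w := by
    rw [← smul_eq_mul, ← map_smul, ← huv, ← map_add]
    congr 1; abel
  rw [sub_apply, h5] at h4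
  have h6 : 2 * l * a (u n) w < 2 * l * (a v w + C / 2 * l * ‖ι w‖ ^ 2 + l) := by
    change _ ≤ C * _ at h4
    linarith
  have h7 := lt_of_mul_lt_mul_left h6 (by linarith [hl1.1])
  linarith

/-- Pseudo-monotonicity. -/
theorem tendsto_apply (h : PointwiseAdmissible ι α c K D φ a) (hα : 0 ≤ α)
    (hK : ∀ M, 0 ≤ K M) (hV : IsReflexiveBanach V) (hι : Function.Injective ι) {u : ℕ → V} {u' : V}
    {R : ℝ} (hR : ∀ n, ‖u n‖ ≤ R) (hu : Tendsto (fun n => ι (u n)) atTop (𝓝 (ι u')))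
    (h0 : Tendsto (fun n => a (u n) (u n - u')) atTop (𝓝 0)) (w : V) :
    Tendsto (fun n => a (u n) w) atTop (𝓝 (a u' w)) := by
  rw [Metric.tendsto_nhds]
  intro ε hε
  filter_upwards [h.eventually_apply_lt hα hK hV hι hR hu h0 w hε,
    h.eventually_apply_lt hα hK hV hι hR hu h0 (-w) hε] with n h1 h2
  rw [map_neg, map_neg] at h2
  rw [Real.dist_eq, abs_lt]
  constructor <;> linarith

/-- Demicontinuity. -/
theorem continuous_apply (h : PointwiseAdmissible ι α c K D φ a) (hα : 0 < α)
    (hK : ∀ M, 0 ≤ K M) (hV : IsReflexiveBanach V) (hι : Function.Injective ι)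
    (w : V) : Continuous fun u => a u w := by
  refine continuous_iff_seqContinuous.2 fun u u' hu => ?_
  obtain ⟨R, hR⟩ := hu.norm.bddAbove_range
  have hR' : ∀ n, ‖u n‖ ≤ R := fun n => hR ⟨n, rfl⟩
  have hR0 : 0 ≤ R := (norm_nonneg _).trans (hR' 0)
  have hιu := (ι.continuous.tendsto u').comp hu
  refine h.tendsto_apply hα.le hK hV hι hR' hιu ?_ w
  have hz : Tendsto (fun n => u n - u') atTop (𝓝 0) := by simpa using hu.sub_const u'
  have hz1 : Tendsto (fun n => ‖u n - u'‖ ^ α + φ * ‖ι (u n - u')‖ ^ 2) atTop (𝓝 0) := by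
    have h1 := hz.norm.rpow_const (p := α) (Or.inr hα.le)
    have h2 := (((ι.continuous.tendsto 0).comp hz).norm.pow 2).const_mul φ
    have := h1.add h2
    simpa [Real.zero_rpow hα.ne'] using this
  rw [Metric.tendsto_nhds]
  intro ε hε
  set C := K (‖ι‖ * R) * (φ + R ^ α)
  have hC : 0 ≤ C := mul_nonneg (hK _) (add_nonneg h.nonneg (by positivity))
  set ε' := ε / (2 * (C + 1))
  have hε' : 0 < ε' := by positivity
  have hlim := hz1.const_mul (D ε')
  rw [mul_zero] at hlim
  filter_upwards [hlim.eventually (gt_mem_nhds (by positivity : 0 < ε / 2))] with n hn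
  rw [Real.dist_eq, sub_zero]
  have h1 : ‖ι (u n)‖ ≤ ‖ι‖ * R :=
    (ι.le_opNorm _).trans (mul_le_mul_of_nonneg_left (hR' n) (norm_nonneg _))
  have h2 := h.growth _ (u n) h1 ε' hε' (u n - u')
  have h3 : ε' * (K (‖ι‖ * R) * (φ + ‖u n‖ ^ α)) ≤ ε / 2 := by
    have h4 : K (‖ι‖ * R) * (φ + ‖u n‖ ^ α) ≤ C := by
      have := hK (‖ι‖ * R)
      have := hR' n
      change _ ≤ K (‖ι‖ * R) * (φ + R ^ α)
      gcongr
    refine (mul_le_mul_of_nonneg_left (h4.trans (le_add_of_nonneg_right one_pos.le))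
      hε'.le).trans ?_
    refine le_of_eq ?_
    simp only [ε']
    field_simp
  linarith

theorem pairing_sub_le (h : PointwiseAdmissible ι α c K D φ a) (hc : 0 < c) (hK : ∀ M, 0 ≤ K M)
    (hD : ∀ ε, 0 ≤ D ε) {M : ℝ} {u y : V} (hu : ‖ι u‖ ≤ M) (hy : ‖ι y‖ ≤ M) :
    a u (u - y) ≤ φ * (1 + M ^ 2) + c * φ
      + D (c / (4 * (K M + 1))) * (‖y‖ ^ α + φ * M ^ 2) - c / 4 * ‖u‖ ^ α := by
  have hφ := h.nonneg
  have hKM := hK M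
  have hε : 0 < c / (4 * (K M + 1)) := by positivity
  have h1 := h.coer u
  have h2 := (neg_le_abs _).trans (h.growth M u hu _ hε y)
  have hDε := hD (c / (4 * (K M + 1)))
  have h3 : ‖ι u‖ ^ 2 ≤ M ^ 2 := by gcongr
  have h4 : ‖ι y‖ ^ 2 ≤ M ^ 2 := by gcongr
  have h5 : φ * (1 + ‖ι u‖ ^ 2) ≤ φ * (1 + M ^ 2) := by gcongr
  have h6 : D (c / (4 * (K M + 1))) * (‖y‖ ^ α + φ * ‖ι y‖ ^ 2)
      ≤ D (c / (4 * (K M + 1))) * (‖y‖ ^ α + φ * M ^ 2) := by gcongr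
  have hu0 : 0 ≤ ‖u‖ ^ α := by positivity
  have h7 : c / (4 * (K M + 1)) * (K M * (φ + ‖u‖ ^ α)) ≤ c / 4 * (φ + ‖u‖ ^ α) := by
    rw [← mul_assoc]
    refine mul_le_mul_of_nonneg_right ?_ (by positivity)
    rw [div_mul_eq_mul_div, div_le_div_iff₀ (by positivity) (by positivity)]
    nlinarith
  have h8 : 0 ≤ φ * (1 + M ^ 2) := by positivity
  have h9 : 0 ≤ c * φ := by positivity
  rw [map_sub]
  linarith

theorem tendsto_max_pairing_sub_zero (h : PointwiseAdmissible ι α c K D φ a) (hα : 0 < α)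
    (hc : 0 < c) (hK : ∀ M, 0 ≤ K M) (hD : ∀ ε, 0 ≤ D ε) (hV : IsReflexiveBanach V)
    (hι : Function.Injective ι) {M : ℝ} {u : ℕ → V} {y : V} (hu : ∀ n, ‖ι (u n)‖ ≤ M)
    (hy : ‖ι y‖ ≤ M) (hlim : Tendsto (fun n => ι (u n)) atTop (𝓝 (ι y))) :
    Tendsto (fun n => max (a (u n) (u n - y)) 0) atTop (𝓝 0) := by
  classical
  set G := φ * (1 + M ^ 2) + c * φ + D (c / (4 * (K M + 1))) * (‖y‖ ^ α + φ * M ^ 2)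
  have hG : ∀ n, a (u n) (u n - y) ≤ G - c / 4 * ‖u n‖ ^ α := fun n =>
    h.pairing_sub_le hc hK hD (hu n) hy
  set u₁ : ℕ → V := fun n => if 0 ≤ a (u n) (u n - y) then u n else y with hu₁
  have hle : ∀ n, max (a (u n) (u n - y)) 0 = a (u₁ n) (u₁ n - y) := by
    intro n
    by_cases h0 : 0 ≤ a (u n) (u n - y)
    · simp only [hu₁, if_pos h0, max_eq_left h0]
    · simp only [hu₁, if_neg h0, max_eq_right (not_le.1 h0).le, sub_self, map_zero]
  have hR : ∀ n, ‖u₁ n‖ ≤ max ((4 * G / c) ^ α⁻¹) ‖y‖ := by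
    intro n
    by_cases h0 : 0 ≤ a (u n) (u n - y)
    · simp only [hu₁, if_pos h0]
      refine le_trans ?_ (le_max_left _ _)
      have h1 : ‖u n‖ ^ α ≤ 4 * G / c := by
        rw [le_div_iff₀ hc]; linarith [hG n]
      have h2 := Real.rpow_le_rpow (by positivity) h1 (inv_nonneg.2 hα.le)
      rwa [← Real.rpow_mul (norm_nonneg _), mul_inv_cancel₀ hα.ne', Real.rpow_one] at h2
    · simp only [hu₁, if_neg h0]; exact le_max_right _ _
  have hlim₁ : Tendsto (fun n => ι (u₁ n)) atTop (𝓝 (ι y)) := by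
    rw [tendsto_iff_norm_sub_tendsto_zero] at hlim ⊢
    refine squeeze_zero (fun n => norm_nonneg _) (fun n => ?_) hlim
    by_cases h0 : 0 ≤ a (u n) (u n - y)
    · simp only [hu₁, if_pos h0]; exact le_rfl
    · simp only [hu₁, if_neg h0, sub_self, norm_zero]; exact norm_nonneg _
  rw [Metric.tendsto_nhds]
  intro ε hε
  filter_upwards [h.eventually_pairing_sub_lt hα.le hK hV hι hR hlim₁ hε] with n hn
  rw [Real.dist_eq, sub_zero, abs_of_nonneg (le_max_right _ _), hle]
  exact hn

theorem tendsto_apply_of_pairing_sub (h : PointwiseAdmissible ι α c K D φ a) (hα : 0 < α)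
    (hc : 0 < c) (hK : ∀ M, 0 ≤ K M) (hD : ∀ ε, 0 ≤ D ε) (hV : IsReflexiveBanach V)
    (hι : Function.Injective ι) {M : ℝ} {u : ℕ → V} {y : V} (hu : ∀ n, ‖ι (u n)‖ ≤ M)
    (hy : ‖ι y‖ ≤ M) (hlim : Tendsto (fun n => ι (u n)) atTop (𝓝 (ι y)))
    (h0 : Tendsto (fun n => a (u n) (u n - y)) atTop (𝓝 0)) (w : V) :
    Tendsto (fun n => a (u n) w) atTop (𝓝 (a y w)) := by
  obtain ⟨m, hm⟩ := h0.bddBelow_range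
  set G := φ * (1 + M ^ 2) + c * φ + D (c / (4 * (K M + 1))) * (‖y‖ ^ α + φ * M ^ 2)
  have hR : ∀ n, ‖u n‖ ≤ (4 * (G - m) / c) ^ α⁻¹ := by
    intro n
    have h1 : ‖u n‖ ^ α ≤ 4 * (G - m) / c := by
      have h2 : a (u n) (u n - y) ≤ G - c / 4 * ‖u n‖ ^ α :=
        h.pairing_sub_le hc hK hD (hu n) hy
      have h3 : m ≤ a (u n) (u n - y) := hm ⟨n, rfl⟩
      rw [le_div_iff₀ hc]; linarith
    have h2 := Real.rpow_le_rpow (by positivity) h1 (inv_nonneg.2 hα.le)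
    rwa [← Real.rpow_mul (norm_nonneg _), mul_inv_cancel₀ hα.ne', Real.rpow_one] at h2
  exact h.tendsto_apply hα.le hK hV hι hR hlim h0 w

end PointwiseAdmissible

variable {ι : V →L[ℝ] H} {α c : ℝ} {K D F : ℝ → ℝ} {a : ℝ → V → StrongDual ℝ V} {μ : Measure ℝ}

theorem hasGrowthBound_of_admissible (had : ∀ᵐ t ∂μ, PointwiseAdmissible ι α c K D (F t) (a t))
    {M : ℝ} {u : ℝ → V} (hu : ∀ᵐ t ∂μ, ‖ι (u t)‖ ≤ M) :
    HasGrowthBound μ ι α F D (fun t => K M * (F t + ‖u t‖ ^ α)) fun t => a t (u t) := by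
  filter_upwards [had, hu] with t h1 h2 ε hε z
  exact h1.growth M (u t) h2 ε hε z

/-- Pseudo-monotonicity for functions of time. -/
theorem exists_subseq_tendsto_of_liminf (had : ∀ᵐ t ∂μ, PointwiseAdmissible ι α c K D (F t) (a t))
    (hα : 0 < α) (hc : 0 < c) (hK : ∀ M, 0 ≤ K M) (hD : ∀ ε, 0 ≤ D ε) (hV : IsReflexiveBanach V)
    (hι : Function.Injective ι) (hF : Integrable F μ) {M : ℝ} {u : ℕ → ℝ → V} {y : ℝ → V}
    (hum : ∀ n, AEStronglyMeasurable (u n) μ) (hym : AEStronglyMeasurable y μ)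
    (ham : ∀ n, AEStronglyMeasurable (fun t => a t (u n t)) μ)
    (huα : ∀ n, MemLp (u n) (ENNReal.ofReal α) μ) (hyα : MemLp y (ENNReal.ofReal α) μ)
    (hu : ∀ n, ∀ᵐ t ∂μ, ‖ι (u n t)‖ ≤ M) (hy : ∀ᵐ t ∂μ, ‖ι (y t)‖ ≤ M)
    (hlim : ∀ᵐ t ∂μ, Tendsto (fun n => ι (u n t)) atTop (𝓝 (ι (y t))))
    (hinf : ∀ ε > 0, ∀ᶠ n in atTop, -ε ≤ ∫ t, a t (u n t) (u n t - y t) ∂μ) :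
    Tendsto (fun n => ∫ t, |a t (u n t) (u n t - y t)| ∂μ) atTop (𝓝 0) ∧
    ∃ σ : ℕ → ℕ, StrictMono σ ∧ ∀ᵐ t ∂μ, ∀ w : V,
      Tendsto (fun n => a t (u (σ n) t) w) atTop (𝓝 (a t (y t) w)) := by
  set x : ℕ → ℝ → ℝ := fun n t => a t (u n t) (u n t - y t) with hx
  have hu' : ∀ᵐ t ∂μ, ∀ n, ‖ι (u n t)‖ ≤ M := ae_all_iff.2 hu
  have hF0 : ∀ᵐ t ∂μ, 0 ≤ F t := had.mono fun t ht => ht.nonneg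
  have hzM : ∀ n, ∀ᵐ t ∂μ, ‖ι (u n t - y t)‖ ≤ M + M := fun n => by
    filter_upwards [hu n, hy] with t h1 h2
    rw [map_sub]
    exact (norm_sub_le _ _).trans (add_le_add h1 h2)
  have hpow : ∀ {z : ℝ → V}, MemLp z (ENNReal.ofReal α) μ → Integrable (fun t => ‖z t‖ ^ α) μ :=
    fun hz => (integrable_norm_rpow_iff_memLp hα hz.1).2 hz
  have hxi : ∀ n, Integrable (x n) μ := fun n =>
    (hasGrowthBound_of_admissible had (hu n)).integrable_pairing (ham n) ((hum n).sub hym)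
      ((hF.add (hpow (huα n))).const_mul _) (hpow ((huα n).sub hyα))
      (integrable_mul_norm_sq_of_bounded hF hF0 ((hum n).sub hym) (hzM n))
  set G : ℝ → ℝ := fun t => F t * (1 + M ^ 2) + c * F t
      + D (c / (4 * (K M + 1))) * (‖y t‖ ^ α + F t * M ^ 2) with hG
  have hGi : Integrable G μ :=
    ((hF.mul_const _).add (hF.const_mul _)).add
      (((hpow hyα).add (hF.mul_const _)).const_mul _)
  have hpos : Tendsto (fun n => ∫ t, max (x n t) 0 ∂μ) atTop (𝓝 0) := by
    have := tendsto_integral_of_dominated_convergence (μ := μ) (f := fun _ => (0 : ℝ))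
      (F := fun n t => max (x n t) 0) (fun t => |G t|)
      (fun n => (hxi n).1.sup aestronglyMeasurable_const) hGi.abs
      (fun n => by
        filter_upwards [had, hu n, hy] with t h1 h2 h3
        rw [Real.norm_eq_abs, abs_of_nonneg (le_max_right _ _)]
        refine max_le ?_ (abs_nonneg _)
        refine le_trans ?_ (le_abs_self _)
        have h4 := h1.pairing_sub_le hc hK hD h2 h3
        have h5 : 0 ≤ c / 4 * ‖u n t‖ ^ α := by positivity
        change _ ≤ G t - _ at h4
        simp only [hx]
        linarith)
      (by
        filter_upwards [had, hu', hy, hlim] with t h1 h2 h3 h4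
        exact h1.tendsto_max_pairing_sub_zero hα hc hK hD hV hι h2 h3 h4)
    simpa using this
  have habs : Tendsto (fun n => ∫ t, |x n t| ∂μ) atTop (𝓝 0) := by
    have heq : ∀ n, ∫ t, |x n t| ∂μ = 2 * ∫ t, max (x n t) 0 ∂μ - ∫ t, x n t ∂μ := by
      intro n
      have hmi : Integrable (fun t => max (x n t) 0) μ := (hxi n).pos_part
      rw [← integral_const_mul, ← integral_sub (hmi.const_mul 2) (hxi n)]
      refine integral_congr_ae (ae_of_all _ fun t => ?_)
      simp only
      rcases le_total 0 (x n t) with h | h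
      · rw [abs_of_nonneg h, max_eq_left h]; ring
      · rw [abs_of_nonpos h, max_eq_right h]; ring
    rw [Metric.tendsto_nhds]
    intro ε hε
    filter_upwards [hinf (ε / 4) (by positivity),
      hpos.eventually (gt_mem_nhds (by positivity : 0 < ε / 4))] with n h1 h2
    rw [Real.dist_eq, sub_zero, abs_of_nonneg (integral_nonneg fun t => abs_nonneg _), heq]
    change -(ε / 4) ≤ ∫ t, x n t ∂μ at h1
    linarith
  refine ⟨habs, ?_⟩
  obtain ⟨σ, hσ, hσ0⟩ := exists_subseq_tendsto_ae_zero hxi habs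
  refine ⟨σ, hσ, ?_⟩
  filter_upwards [had, hu', hy, hlim, hσ0] with t h1 h2 h3 h4 h5 w
  exact h1.tendsto_apply_of_pairing_sub hα hc hK hD hV hι (fun n => h2 (σ n)) h3
    (h4.comp hσ.tendsto_atTop) h5 w

end PseudoMonotone

end SkeletonEq

namespace SkeletonEq

/-! ### Galerkin approximations -/

section Truncation

variable {E : Type*} [NormedAddCommGroup E] [NormedSpace ℝ E]

/-- The radial projection onto the ball of radius `R`. -/
noncomputable def radialProj (R : ℝ) (c : E) : E := (R / max R ‖c‖) • c

theorem continuous_radialProj {R : ℝ} (hR : 0 < R) : Continuous (radialProj R : E → E) := by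
  refine Continuous.smul (continuous_const.div (by fun_prop) fun c => ?_) continuous_id
  exact (lt_of_lt_of_le hR (le_max_left _ _)).ne'

theorem radialProj_of_norm_le {R : ℝ} (hR : 0 < R) {c : E} (hc : ‖c‖ ≤ R) :
    radialProj R c = c := by
  rw [radialProj, max_eq_left hc, div_self hR.ne', one_smul]

theorem norm_radialProj {R : ℝ} (hR : 0 < R) (c : E) :
    ‖radialProj R c‖ = R / max R ‖c‖ * ‖c‖ := by
  have : 0 < max R ‖c‖ := lt_of_lt_of_le hR (le_max_left _ _)
  rw [radialProj, norm_smul, Real.norm_eq_abs, abs_of_pos (by positivity)]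

theorem norm_radialProj_le {R : ℝ} (hR : 0 < R) (c : E) : ‖radialProj R c‖ ≤ R := by
  have h : 0 < max R ‖c‖ := lt_of_lt_of_le hR (le_max_left _ _)
  rw [norm_radialProj hR, div_mul_eq_mul_div, div_le_iff₀ h]
  exact mul_le_mul_of_nonneg_left (le_max_right _ _) hR.le

theorem norm_radialProj_le_norm {R : ℝ} (hR : 0 < R) (c : E) : ‖radialProj R c‖ ≤ ‖c‖ := by
  have h : 0 < max R ‖c‖ := lt_of_lt_of_le hR (le_max_left _ _)
  rw [norm_radialProj hR]
  exact mul_le_of_le_one_left (norm_nonneg _) ((div_le_one h).2 (le_max_left _ _))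

theorem smul_radialProj {R : ℝ} (hR : 0 < R) (c : E) :
    (max R ‖c‖ / R) • radialProj R c = c := by
  have h : 0 < max R ‖c‖ := lt_of_lt_of_le hR (le_max_left _ _)
  rw [radialProj, smul_smul, div_mul_div_cancel₀ hR.ne', div_self h.ne', one_smul]

theorem mul_one_add_norm_radialProj_sq_le {R : ℝ} (hR : 1 ≤ R) (c : E) :
    max R ‖c‖ / R * (1 + ‖radialProj R c‖ ^ 2) ≤ 2 * (1 + ‖c‖ ^ 2) := by
  have hR0 : 0 < R := by linarith
  have h : 0 < max R ‖c‖ := lt_of_lt_of_le hR0 (le_max_left _ _)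
  have h1 : max R ‖c‖ / R * ‖radialProj R c‖ = ‖c‖ := by
    rw [norm_radialProj hR0]; field_simp
  have h2 := norm_radialProj_le_norm hR0 c
  have h3 : max R ‖c‖ / R ≤ 1 + ‖c‖ := by
    rw [div_le_iff₀ hR0]
    refine max_le ?_ ?_ <;> nlinarith [norm_nonneg c]
  have h4 : max R ‖c‖ / R * ‖radialProj R c‖ ^ 2 = ‖c‖ * ‖radialProj R c‖ := by
    rw [sq, ← mul_assoc, h1]
  have h5 := mul_le_mul_of_nonneg_left h2 (norm_nonneg c)
  nlinarith [sq_nonneg (‖c‖ - 1)]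

end Truncation

section Galerkin

variable {V H : Type*} [NormedAddCommGroup V] [NormedSpace ℝ V] [MeasurableSpace V] [BorelSpace V]
  [NormedAddCommGroup H] [InnerProductSpace ℝ H]
  {ι : V →L[ℝ] H} {α c T : ℝ} {K D F : ℝ → ℝ} {a : ℝ → V → StrongDual ℝ V}

/-- The radius of a ball in `H` that contains all Galerkin approximations. -/
noncomputable def galerkinRadius (T : ℝ) (F : ℝ → ℝ) (x : H) : ℝ :=
  √((1 + ‖x‖ ^ 2) * Real.exp (∫ s in Icc 0 T, 2 * F s))

theorem exists_galerkin_coordinates {E : Type*} [NormedAddCommGroup E] [InnerProductSpace ℝ E]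
    [FiniteDimensional ℝ E] [MeasurableSpace E] [BorelSpace E] (e : E →L[ℝ] V)
    (he : ∀ d d', inner ℝ (ι (e d)) (ι (e d')) = inner ℝ d d')
    (hV : IsReflexiveBanach V) (hι : Function.Injective ι) (hT : 0 ≤ T) (hα : 0 < α) (hc : 0 < c)
    (hK : ∀ M, 0 ≤ K M) (hF : IntegrableOn F (Icc 0 T))
    (ham : Measurable (Function.uncurry a))
    (had : ∀ᵐ t ∂volume.restrict (Icc 0 T), PointwiseAdmissible ι α c K D (F t) (a t)) (x : H) :
    ∃ z : ℝ → E, Continuous z ∧ (∀ t ∈ Icc 0 T, ‖z t‖ ≤ galerkinRadius T F x) ∧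
      (∀ t ∈ Icc 0 T, ∀ d, inner ℝ (z t) d
        = inner ℝ x (ι (e d)) + ∫ s in (0 : ℝ)..t, a s (e (z s)) (e d)) ∧
      ∀ t ∈ Icc 0 T, ‖z t‖ ^ 2 ≤ ‖x‖ ^ 2 + 2 * ∫ s in (0 : ℝ)..t, a s (e (z s)) (e (z s)) := by
  have hcompl : CompleteSpace E := FiniteDimensional.complete ℝ E
  have hproper : ProperSpace E := FiniteDimensional.proper ℝ E
  have hF0 : ∀ᵐ t ∂volume.restrict (Icc 0 T), 0 ≤ F t := had.mono fun t ht => ht.nonneg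
  set R := galerkinRadius T F x with hRdef
  have hexp : 1 ≤ Real.exp (∫ s in Icc 0 T, 2 * F s) :=
    Real.one_le_exp (integral_nonneg_of_ae (hF0.mono fun t ht => by simpa using ht))
  have hRsq : R ^ 2 = (1 + ‖x‖ ^ 2) * Real.exp (∫ s in Icc 0 T, 2 * F s) :=
    Real.sq_sqrt (by positivity)
  have hR1 : 1 ≤ R := by
    rw [hRdef, galerkinRadius, Real.one_le_sqrt]
    nlinarith [sq_nonneg ‖x‖]
  have hR0 : 0 < R := by linarith
  have hen : ∀ d : E, ‖ι (e d)‖ = ‖d‖ := by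
    intro d
    have := he d d
    rw [real_inner_self_eq_norm_sq, real_inner_self_eq_norm_sq] at this
    exact (pow_left_inj₀ (norm_nonneg _) (norm_nonneg _) two_ne_zero).1 this
  set b := stdOrthonormalBasis ℝ E
  set G : ℝ → E → E := fun t d => ∑ i, a t (e (radialProj R d)) (e (b i)) • b i with hG
  have hlin : ∀ (f : StrongDual ℝ V) (d : E),
      inner ℝ (∑ i, f (e (b i)) • b i) d = f (e d) := by
    intro f d
    conv_rhs => rw [← b.sum_repr' d]
    rw [sum_inner, map_sum, map_sum]
    refine Finset.sum_congr rfl fun i _ => ?_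
    rw [inner_smul_left, map_smul, map_smul, smul_eq_mul]
    simp [mul_comm]
  have hGin : ∀ t d d', inner ℝ (G t d) d' = a t (e (radialProj R d)) (e d') := fun t d d' =>
    hlin _ _
  have hGm : Measurable (Function.uncurry G) := by
    have h1 : Measurable fun p : ℝ × E => a p.1 (e (radialProj R p.2)) :=
      ham.comp (measurable_fst.prodMk
        ((e.continuous.comp (continuous_radialProj hR0)).measurable.comp measurable_snd))
    have h2 : Continuous fun f : StrongDual ℝ V => ∑ i, f (e (b i)) • b i :=
      continuous_finsetSum _ fun i _ =>
        ((ContinuousLinearMap.apply ℝ ℝ (e (b i))).continuous).smul continuous_const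
    exact h2.measurable.comp h1
  set m : ℝ → ℝ := fun t => ∑ i, (1 * (K R * (F t + (‖e‖ * R) ^ α))
    + D 1 * (‖e (b i)‖ ^ α + F t * ‖ι (e (b i))‖ ^ 2)) with hm
  have hmi : IntegrableOn m (Icc 0 T) := by
    refine integrable_finsetSum _ fun i _ => ?_
    have hcst : ∀ r : ℝ, IntegrableOn (fun _ : ℝ => r) (Icc 0 T) := fun r => integrable_const _
    exact (((hF.add (hcst _)).const_mul _).const_mul 1).add
      (((hcst _).add (hF.mul_const _)).const_mul _)
  have hGb : ∀ᵐ t ∂volume.restrict (Icc 0 T), ∀ d, ‖G t d‖ ≤ m t := by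
    filter_upwards [had] with t ht d
    refine (norm_sum_le _ _).trans (Finset.sum_le_sum fun i _ => ?_)
    rw [norm_smul, b.orthonormal.1 i, mul_one, Real.norm_eq_abs]
    have h1 : ‖ι (e (radialProj R d))‖ ≤ R := by rw [hen]; exact norm_radialProj_le hR0 d
    refine (ht.growth R _ h1 1 one_pos (e (b i))).trans ?_
    have h2 : ‖e (radialProj R d)‖ ≤ ‖e‖ * R := (e.le_opNorm _).trans
      (mul_le_mul_of_nonneg_left (norm_radialProj_le hR0 d) (norm_nonneg _))
    have := hK R
    gcongr
  have hGc : ∀ᵐ t ∂volume.restrict (Icc 0 T), Continuous (G t) := by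
    filter_upwards [had] with t ht
    refine continuous_finsetSum _ fun i _ => Continuous.smul ?_ continuous_const
    exact (ht.continuous_apply hα hK hV hι (e (b i))).comp
      (e.continuous.comp (continuous_radialProj hR0))
  set z₀ : E := ∑ i, (toVDual ι x) (e (b i)) • b i with hz₀
  have hz₀in : ∀ d, inner ℝ z₀ d = inner ℝ x (ι (e d)) := fun d => hlin (toVDual ι x) d
  have hz₀n : ‖z₀‖ ≤ ‖x‖ := by
    have h1 := hz₀in z₀
    rw [real_inner_self_eq_norm_sq] at h1
    have h2 := real_inner_le_norm x (ι (e z₀))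
    rw [hen] at h2
    rcases eq_or_lt_of_le (norm_nonneg z₀) with h | h
    · rw [← h]; exact norm_nonneg _
    · nlinarith
  have hz₀n2 : ‖z₀‖ ^ 2 ≤ ‖x‖ ^ 2 := by gcongr
  obtain ⟨z, hzc, hz⟩ := exists_caratheodory_solution hT hGm hmi hGb hGc z₀
  have hGi : IntegrableOn (fun s => G s (z s)) (Icc 0 T) :=
    integrableOn_comp_of_bound hGm hmi hGb hzc.measurable
  have h0T : (0 : ℝ) ∈ Icc 0 T := ⟨le_rfl, hT⟩
  have henergy : ∀ t ∈ Icc 0 T, ‖z t‖ ^ 2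
      = ‖z₀‖ ^ 2 + 2 * ∫ s in (0 : ℝ)..t, inner ℝ (G s (z s)) (z s) := fun t ht =>
    norm_sq_primitive ht.1 (intervalIntegrable_of_mem hGi h0T ht)
      fun s hs => hz s ⟨hs.1, hs.2.trans ht.2⟩
  have hini : IntegrableOn (fun s => inner ℝ (G s (z s)) (z s)) (Icc 0 T) := by
    have h1 : IntegrableOn (fun s => ‖G s (z s)‖ * ‖z s‖) (Icc 0 T) :=
      IntegrableOn.mul_continuousOn hGi.norm hzc.norm.continuousOn isCompact_Icc
    refine h1.mono' (hGi.1.inner hzc.aestronglyMeasurable) (ae_of_all _ fun s => ?_)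
    exact norm_inner_le_norm _ _
  have hbound : ∀ t ∈ Icc 0 T, ‖z t‖ ≤ R := by
    have hgr : ∀ t ∈ Icc 0 T, 1 + ‖z t‖ ^ 2
        ≤ (1 + ‖x‖ ^ 2) + ∫ s in (0 : ℝ)..t, 2 * F s * (1 + ‖z s‖ ^ 2) := by
      intro t ht
      rw [henergy t ht, ← intervalIntegral.integral_const_mul]
      have h1 : ∫ s in (0 : ℝ)..t, 2 * inner ℝ (G s (z s)) (z s)
          ≤ ∫ s in (0 : ℝ)..t, 2 * F s * (1 + ‖z s‖ ^ 2) := by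
        refine intervalIntegral.integral_mono_ae_restrict ht.1
          (intervalIntegrable_of_mem (hini.const_mul 2) h0T ht) ?_ ?_
        · refine (intervalIntegrable_of_mem (hF.const_mul 2) h0T ht).mul_continuousOn ?_
          fun_prop
        · refine ae_restrict_of_ae_restrict_of_subset (Icc_subset_Icc_right ht.2) ?_
          filter_upwards [had] with s hs
          have h2 := hs.coer (e (radialProj R (z s)))
          rw [hen] at h2
          have h3 : 2 * inner ℝ (G s (z s)) (z s) = max R ‖z s‖ / R
              * (2 * a s (e (radialProj R (z s))) (e (radialProj R (z s)))) := by
            rw [hGin]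
            have : a s (e (radialProj R (z s))) (e (z s)) = max R ‖z s‖ / R
                * a s (e (radialProj R (z s))) (e (radialProj R (z s))) := by
              rw [← smul_eq_mul, ← map_smul, ← map_smul, smul_radialProj hR0]
            rw [this]; ring
          have h4 : 0 ≤ c * ‖e (radialProj R (z s))‖ ^ α := by positivity
          have h5 : 0 ≤ max R ‖z s‖ / R := by positivity
          have h6 := mul_one_add_norm_radialProj_sq_le hR1 (z s)
          have h7 := hs.nonneg
          rw [h3]
          calc max R ‖z s‖ / R * (2 * a s (e (radialProj R (z s))) (e (radialProj R (z s))))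
              ≤ max R ‖z s‖ / R * (F s * (1 + ‖radialProj R (z s)‖ ^ 2)) :=
                mul_le_mul_of_nonneg_left (by linarith) h5
            _ = F s * (max R ‖z s‖ / R * (1 + ‖radialProj R (z s)‖ ^ 2)) := by ring
            _ ≤ F s * (2 * (1 + ‖z s‖ ^ 2)) := mul_le_mul_of_nonneg_left h6 h7
            _ = 2 * F s * (1 + ‖z s‖ ^ 2) := by ring
      linarith
    intro t ht
    have h1 := gronwall_integrable (φ := fun t => 1 + ‖z t‖ ^ 2) (F := fun s => 2 * F s)
      (by fun_prop) (hF.const_mul 2) (hF0.mono fun t ht => by positivity) hgr ht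
    have h2 : ∫ s in (0 : ℝ)..t, 2 * F s ≤ ∫ s in Icc 0 T, 2 * F s := by
      rw [intervalIntegral.integral_of_le ht.1, ← integral_Icc_eq_integral_Ioc]
      exact setIntegral_mono_set (hF.const_mul 2) (hF0.mono fun t ht => by simpa using ht)
        (Icc_subset_Icc_right ht.2).eventuallyLE
    have h3 : ‖z t‖ ^ 2 ≤ R ^ 2 := by
      rw [hRsq]
      have := mul_le_mul_of_nonneg_left (Real.exp_le_exp.2 h2)
        (by positivity : 0 ≤ 1 + ‖x‖ ^ 2)
      linarith
    exact (pow_le_pow_iff_left₀ (norm_nonneg _) hR0.le two_ne_zero).1 h3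
  have hGz : ∀ s ∈ Icc 0 T, ∀ d, inner ℝ (G s (z s)) d = a s (e (z s)) (e d) := by
    intro s hs d
    rw [hGin, radialProj_of_norm_le hR0 (hbound s hs)]
  refine ⟨z, hzc, hbound, fun t ht d => ?_, fun t ht => ?_⟩
  · have hgt := intervalIntegrable_of_mem hGi h0T ht
    have h1 : inner ℝ (∫ s in (0 : ℝ)..t, G s (z s)) d
        = ∫ s in (0 : ℝ)..t, inner ℝ (G s (z s)) d := by
      have := (innerSL ℝ d).intervalIntegral_comp_comm hgt
      simp only [innerSL_apply_apply] at this
      rw [real_inner_comm, ← this]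
      exact intervalIntegral.integral_congr fun s _ => real_inner_comm _ _
    rw [hz t ht, inner_add_left, hz₀in, h1]
    congr 1
    refine intervalIntegral.integral_congr fun s hs => ?_
    rw [uIcc_of_le ht.1] at hs
    exact hGz s ⟨hs.1, hs.2.trans ht.2⟩ d
  · rw [henergy t ht]
    have : ∫ s in (0 : ℝ)..t, inner ℝ (G s (z s)) (z s)
        = ∫ s in (0 : ℝ)..t, a s (e (z s)) (e (z s)) := by
      refine intervalIntegral.integral_congr fun s hs => ?_
      rw [uIcc_of_le ht.1] at hs
      exact hGz s ⟨hs.1, hs.2.trans ht.2⟩ _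
    rw [this]
    linarith

/-- Existence of Galerkin approximations in a finite-dimensional subspace `S` of `V`. -/
theorem exists_galerkin (hV : IsReflexiveBanach V) (hι : Function.Injective ι) (hT : 0 ≤ T)
    (hα : 0 < α) (hc : 0 < c) (hK : ∀ M, 0 ≤ K M)
    (hF : IntegrableOn F (Icc 0 T)) (ham : Measurable (Function.uncurry a))
    (had : ∀ᵐ t ∂volume.restrict (Icc 0 T), PointwiseAdmissible ι α c K D (F t) (a t)) (x : H)
    (S : Submodule ℝ V) [FiniteDimensional ℝ S] :
    ∃ u : ℝ → V, Continuous u ∧ (∀ t ∈ Icc 0 T, ‖ι (u t)‖ ≤ galerkinRadius T F x) ∧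
      (∀ v ∈ S, ∀ t ∈ Icc 0 T, inner ℝ (ι (u t)) (ι v)
        = inner ℝ x (ι v) + ∫ s in (0 : ℝ)..t, a s (u s) v) ∧
      ∀ t ∈ Icc 0 T, ‖ι (u t)‖ ^ 2 ≤ ‖x‖ ^ 2 + 2 * ∫ s in (0 : ℝ)..t, a s (u s) (u s) := by
  set W : Submodule ℝ H := S.map ι.toLinearMap
  set eq : S ≃ₗ[ℝ] W := Submodule.equivMapOfInjective ι.toLinearMap hι S
  let : MeasurableSpace W := borel W
  have : BorelSpace W := ⟨rfl⟩
  set e : W →L[ℝ] V := (S.subtype ∘ₗ eq.symm.toLinearMap).toContinuousLinearMap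
  have hιe : ∀ d : W, ι (e d) = d := by
    intro d
    have h1 : eq (eq.symm d) = d := eq.apply_symm_apply d
    have h2 : ((eq (eq.symm d) : W) : H) = ι ((eq.symm d : S) : V) := rfl
    rw [← h1, h2, h1]; rfl
  obtain ⟨z, hzc, hzb, hz, hze⟩ := exists_galerkin_coordinates e
    (fun d d' => by rw [hιe, hιe]; rfl) hV hι hT hα hc hK hF ham had x
  refine ⟨fun t => e (z t), e.continuous.comp hzc, fun t ht => ?_, fun v hv t ht => ?_,
    fun t ht => ?_⟩
  · rw [hιe]; exact hzb t ht
  · have hev : e (eq ⟨v, hv⟩) = v := by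
      change ((eq.symm (eq ⟨v, hv⟩) : S) : V) = v
      rw [eq.symm_apply_apply]
    have h1 := hz t ht (eq ⟨v, hv⟩)
    rw [hev] at h1
    rw [← h1, hιe]
    rfl
  · rw [hιe]; exact hze t ht

end Galerkin

end SkeletonEq

namespace SkeletonEq

/-! ### Approximating sequences and their weak limits -/

/-- A bounded sequence whose inner products with a dense set converge has a weak limit. -/
theorem exists_weak_limit {H : Type*} [NormedAddCommGroup H] [InnerProductSpace ℝ H]
    [CompleteSpace H] {z : ℕ → H} {M : ℝ} (hM : ∀ n, ‖z n‖ ≤ M) {d : ℕ → H} (hd : DenseRange d)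
    (h : ∀ j, ∃ l, Tendsto (fun n => inner ℝ (z n) (d j)) atTop (𝓝 l)) :
    ∃ z' : H, ‖z'‖ ≤ M ∧ ∀ w, Tendsto (fun n => inner ℝ (z n) w) atTop (𝓝 (inner ℝ z' w)) := by
  have hM0 : 0 ≤ M := (norm_nonneg _).trans (hM 0)
  have hex : ∀ w, ∃ l, Tendsto (fun n => inner ℝ (z n) w) atTop (𝓝 l) := by
    intro w
    refine cauchySeq_tendsto_of_complete (Metric.cauchySeq_iff.2 fun ε hε => ?_)
    obtain ⟨j, hj⟩ := hd.exists_dist_lt w (ε := ε / (4 * (M + 1))) (by positivity)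
    obtain ⟨l, hl⟩ := h j
    obtain ⟨N, hN⟩ := Metric.cauchySeq_iff.1 hl.cauchySeq (ε / 2) (by positivity)
    refine ⟨N, fun m hm n hn => ?_⟩
    have h1 := hN m hm n hn
    rw [Real.dist_eq] at h1 ⊢
    have h2 : ∀ k, |inner ℝ (z k) (w - d j)| ≤ ε / 4 := by
      intro k
      refine (abs_real_inner_le_norm _ _).trans ?_
      rw [dist_eq_norm] at hj
      refine (mul_le_mul (hM k) hj.le (norm_nonneg _) hM0).trans ?_
      rw [mul_div_assoc', div_le_div_iff₀ (by positivity) (by positivity)]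
      nlinarith
    have h3 : ∀ k, inner ℝ (z k) w = inner ℝ (z k) (d j) + inner ℝ (z k) (w - d j) := fun k => by
      rw [← inner_add_right]; simp
    rw [h3 m, h3 n]
    have h4 := h2 m
    have h5 := h2 n
    rw [abs_le] at h4 h5
    rw [abs_lt] at h1 ⊢
    constructor <;> linarith
  choose l hl using hex
  set L : H →ₗ[ℝ] ℝ := linearMapOfTendsto l (fun n => (innerSL ℝ (z n)).toLinearMap)
    (tendsto_pi_nhds.2 hl)
  have hL : ∀ w, ‖L w‖ ≤ M * ‖w‖ := fun w =>
    le_of_tendsto (hl w).norm (Eventually.of_forall fun n => (norm_inner_le_norm _ _).trans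
      (mul_le_mul_of_nonneg_right (hM n) (norm_nonneg _)))
  set Lc : StrongDual ℝ H := L.mkContinuous M hL
  refine ⟨(InnerProductSpace.toDual ℝ H).symm Lc, ?_, fun w => ?_⟩
  · rw [LinearIsometryEquiv.norm_map]
    exact L.mkContinuous_norm_le hM0 hL
  · rw [InnerProductSpace.toDual_symm_apply]
    exact hl w

theorem two_mul_inner_sub_norm_sq_le {H : Type*} [NormedAddCommGroup H] [InnerProductSpace ℝ H]
    (y z : H) : 2 * inner ℝ y z - ‖z‖ ^ 2 ≤ ‖y‖ ^ 2 := by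
  have h1 := norm_sub_sq_real y z
  have h2 := sq_nonneg ‖y - z‖
  linarith

section Approximation

variable {V H : Type*} [NormedAddCommGroup V] [NormedSpace ℝ V]
  [NormedAddCommGroup H] [InnerProductSpace ℝ H]

/-- The standing assumptions on the full drift `a` of the equation. -/
structure AdmissibleDrift [MeasurableSpace V] (ι : V →L[ℝ] H) (α c T : ℝ) (K D F : ℝ → ℝ)
    (a : ℝ → V → StrongDual ℝ V) : Prop where
  one_lt : 1 < α
  c_pos : 0 < c
  T_pos : 0 < T
  K_nonneg : ∀ M, 0 ≤ K M
  D_nonneg : ∀ ε, 0 ≤ D ε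
  integrable : IntegrableOn F (Icc 0 T)
  measurable : Measurable (Function.uncurry a)
  admissible : ∀ᵐ t ∂volume.restrict (Icc 0 T), PointwiseAdmissible ι α c K D (F t) (a t)

/-- Approximate solutions: the equation holds eventually when tested with the elements `d j` of a
dense sequence, and the energy inequality holds. -/
structure IsApproximation (ι : V →L[ℝ] H) (α T M Q : ℝ) (a : ℝ → V → StrongDual ℝ V) (x : H)
    (d : ℕ → V) (u : ℕ → ℝ → V) : Prop where
  continuous : ∀ n, Continuous (u n)
  bound : ∀ n, ∀ t ∈ Icc 0 T, ‖ι (u n t)‖ ≤ M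
  integral_le : ∀ n, ∫ t in Icc 0 T, ‖u n t‖ ^ α ≤ Q
  equation : ∀ j, ∀ᶠ n in atTop, ∀ t ∈ Icc 0 T, inner ℝ (ι (u n t)) (ι (d j))
    = inner ℝ x (ι (d j)) + ∫ s in (0 : ℝ)..t, a s (u n s) (d j)
  energy : ∀ n, ∀ t ∈ Icc 0 T,
    ‖ι (u n t)‖ ^ 2 ≤ ‖x‖ ^ 2 + 2 * ∫ s in (0 : ℝ)..t, a s (u n s) (u n s)

variable {ι : V →L[ℝ] H} {α c T M Q : ℝ} {K D F : ℝ → ℝ} {a : ℝ → V → StrongDual ℝ V} {x : H}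
  {d : ℕ → V} {u : ℕ → ℝ → V}

theorem _root_.Continuous.memLp_Icc {E : Type*} [NormedAddCommGroup E] {y : ℝ → E}
    (hy : Continuous y) {p : ℝ≥0∞} : MemLp y p (volume.restrict (Icc 0 T)) := by
  obtain ⟨C, hC⟩ := (isCompact_Icc (a := (0 : ℝ)) (b := T)).exists_bound_of_continuousOn
    hy.continuousOn
  exact MemLp.of_bound hy.aestronglyMeasurable C ((ae_restrict_mem measurableSet_Icc).mono hC)

namespace IsApproximation

variable (hu : IsApproximation ι α T M Q a x d u)
include hu

theorem subseq {σ : ℕ → ℕ} (hσ : StrictMono σ) :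
    IsApproximation ι α T M Q a x d fun n => u (σ n) where
  continuous _ := hu.continuous _
  bound _ := hu.bound _
  integral_le _ := hu.integral_le _
  equation j := hσ.tendsto_atTop.eventually (hu.equation j)
  energy _ := hu.energy _

theorem ae_bound (n : ℕ) : ∀ᵐ t ∂volume.restrict (Icc 0 T), ‖ι (u n t)‖ ≤ M :=
  (ae_restrict_mem measurableSet_Icc).mono (hu.bound n)

theorem memLp (n : ℕ) : MemLp (u n) (ENNReal.ofReal α) (volume.restrict (Icc 0 T)) :=
  (hu.continuous n).memLp_Icc

end IsApproximation

variable [MeasurableSpace V]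

namespace AdmissibleDrift

variable (h : AdmissibleDrift ι α c T K D F a)
include h

theorem alpha_pos : 0 < α := by linarith [h.one_lt]

theorem ae_nonneg : ∀ᵐ t ∂volume.restrict (Icc 0 T), 0 ≤ F t :=
  h.admissible.mono fun _ ht => ht.nonneg

theorem stronglyMeasurable_comp [SecondCountableTopology (StrongDual ℝ V)] {y : ℝ → V}
    (hy : Measurable y) : StronglyMeasurable fun t => a t (y t) :=
  (h.measurable.comp (measurable_id.prodMk hy)).stronglyMeasurable

theorem integrable_growth {y : ℝ → V}
    (hyα : MemLp y (ENNReal.ofReal α) (volume.restrict (Icc 0 T))) :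
    IntegrableOn (fun t => K M * (F t + ‖y t‖ ^ α)) (Icc 0 T) :=
  (h.integrable.add ((integrable_norm_rpow_iff_memLp h.alpha_pos hyα.1).2 hyα)).const_mul _

/-- Integrability of the pairing of the drift along `y` with `z`. -/
theorem integrable_pairing [SecondCountableTopology (StrongDual ℝ V)] {y z : ℝ → V}
    (hym : Measurable y) (hyα : MemLp y (ENNReal.ofReal α) (volume.restrict (Icc 0 T)))
    (hyM : ∀ᵐ t ∂volume.restrict (Icc 0 T), ‖ι (y t)‖ ≤ M)
    (hzα : MemLp z (ENNReal.ofReal α) (volume.restrict (Icc 0 T)))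
    {M' : ℝ} (hzM : ∀ᵐ t ∂volume.restrict (Icc 0 T), ‖ι (z t)‖ ≤ M') :
    IntegrableOn (fun t => a t (y t) (z t)) (Icc 0 T) :=
  (hasGrowthBound_of_admissible h.admissible hyM).integrable_pairing
    (h.stronglyMeasurable_comp hym).aestronglyMeasurable hzα.1 (h.integrable_growth hyα)
    ((integrable_norm_rpow_iff_memLp h.alpha_pos hzα.1).2 hzα)
    (integrable_mul_norm_sq_of_bounded h.integrable h.ae_nonneg hzα.1 hzM)

end AdmissibleDrift

namespace IsApproximation

variable (hu : IsApproximation ι α T M Q a x d u)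
include hu

variable (h : AdmissibleDrift ι α c T K D F a)
include h

theorem integral_growth_le (n : ℕ) : ∫ t in Icc 0 T, K M * (F t + ‖u n t‖ ^ α)
    ≤ K M * ((∫ t in Icc 0 T, F t) + Q) := by
  rw [integral_const_mul, integral_add h.integrable
    ((integrable_norm_rpow_iff_memLp h.alpha_pos (hu.memLp n).1).2 (hu.memLp n))]
  exact mul_le_mul_of_nonneg_left (add_le_add le_rfl (hu.integral_le n)) (h.K_nonneg M)

/-- Uniform smallness of the integrals of the drift over short intervals. -/
theorem abs_intervalIntegral_le (n : ℕ) (v : V) {ε : ℝ} (hε : 0 < ε) {s t : ℝ} (hs : s ∈ Icc 0 T)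
    (ht : t ∈ Icc 0 T) : |∫ r in s..t, a r (u n r) v| ≤ ε * (K M * ((∫ t in Icc 0 T, F t) + Q))
      + D ε * |∫ r in s..t, (‖v‖ ^ α + F r * ‖ι v‖ ^ 2)| := by
  have h0 : (0 : ℝ) ∈ Icc 0 T := ⟨le_rfl, h.T_pos.le⟩
  have hg := hasGrowthBound_of_admissible h.admissible (hu.ae_bound n)
  have hq := h.integrable_growth (M := M) (hu.memLp n)
  have hk : IntegrableOn (fun r => ‖v‖ ^ α + F r * ‖ι v‖ ^ 2) (Icc 0 T) :=
    (integrable_const (μ := volume.restrict (Icc 0 T)) _).add (h.integrable.mul_const _)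
  have hsub : uIoc s t ⊆ Icc 0 T := uIoc_subset_uIcc.trans (uIcc_subset_Icc hs ht)
  set q : ℝ → ℝ := fun t => K M * (F t + ‖u n t‖ ^ α) with hqdef
  have h1 := intervalIntegral.norm_integral_le_abs_of_norm_le (f := fun r => a r (u n r) v)
    (g := fun r => ε * q r + D ε * (‖v‖ ^ α + F r * ‖ι v‖ ^ 2))
    (ae_restrict_of_ae_restrict_of_subset hsub (hg.mono fun r hr => hr ε hε v))
    (intervalIntegrable_of_mem ((hq.const_mul ε).add (hk.const_mul (D ε))) hs ht)
  rw [Real.norm_eq_abs, intervalIntegral.integral_add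
    (intervalIntegrable_of_mem (hq.const_mul ε) hs ht)
    (intervalIntegrable_of_mem (hk.const_mul (D ε)) hs ht), intervalIntegral.integral_const_mul ε q,
    intervalIntegral.integral_const_mul (D ε)] at h1
  refine h1.trans ((abs_add_le _ _).trans ?_)
  rw [abs_mul, abs_mul, abs_of_pos hε, abs_of_nonneg (h.D_nonneg ε)]
  refine add_le_add (mul_le_mul_of_nonneg_left ?_ hε.le) le_rfl
  have hq0 : ∀ᵐ r ∂volume.restrict (Icc 0 T), 0 ≤ q r :=
    h.ae_nonneg.mono fun r hr => mul_nonneg (h.K_nonneg M) (add_nonneg hr (by positivity))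
  refine le_trans ?_ (hu.integral_growth_le h n)
  rw [intervalIntegral.abs_integral_eq_abs_integral_uIoc,
    abs_of_nonneg (integral_nonneg_of_ae (ae_restrict_of_ae_restrict_of_subset hsub hq0))]
  exact setIntegral_mono_set hq hq0 hsub.eventuallyLE

variable [BorelSpace V] [SecondCountableTopology (StrongDual ℝ V)]

theorem integrable_apply (n : ℕ) (v : V) : IntegrableOn (fun t => a t (u n t) v) (Icc 0 T) :=
  h.integrable_pairing (z := fun _ => v) (hu.continuous n).measurable (hu.memLp n) (hu.ae_bound n)
    (memLp_const v) (ae_of_all _ fun _ => le_rfl)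

theorem eventually_inner_sub_eq (j : ℕ) : ∀ᶠ n in atTop, ∀ s ∈ Icc 0 T, ∀ t ∈ Icc 0 T,
    inner ℝ (ι (u n t)) (ι (d j)) - inner ℝ (ι (u n s)) (ι (d j))
      = ∫ r in s..t, a r (u n r) (d j) := by
  have h0 : (0 : ℝ) ∈ Icc 0 T := ⟨le_rfl, h.T_pos.le⟩
  filter_upwards [hu.equation j] with n hn s hs t ht
  have hi := hu.integrable_apply h n (d j)
  rw [hn t ht, hn s hs, add_sub_add_left_eq_sub, intervalIntegral.integral_interval_sub_left
    (intervalIntegrable_of_mem hi h0 ht) (intervalIntegrable_of_mem hi h0 hs)]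

theorem equicontinuous (j : ℕ) {ε : ℝ} (hε : 0 < ε) : ∃ δ > 0, ∀ s ∈ Icc 0 T, ∀ t ∈ Icc 0 T,
    |s - t| < δ → ∀ᶠ n in atTop,
      |inner ℝ (ι (u n s)) (ι (d j)) - inner ℝ (ι (u n t)) (ι (d j))| ≤ ε := by
  have h0 : (0 : ℝ) ∈ Icc 0 T := ⟨le_rfl, h.T_pos.le⟩
  set B := K M * ((∫ t in Icc 0 T, F t) + Q)
  set ε' := ε / (2 * (|B| + 1)) with hε'
  have hε'0 : 0 < ε' := by positivity
  have hD := h.D_nonneg ε'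
  set k : ℝ → ℝ := fun r => ‖d j‖ ^ α + F r * ‖ι (d j)‖ ^ 2
  have hk : IntegrableOn k (Icc 0 T) :=
    (integrable_const (μ := volume.restrict (Icc 0 T)) _).add (h.integrable.mul_const _)
  have hP : ContinuousOn (fun t => ∫ r in (0 : ℝ)..t, k r) (Icc 0 T) := by
    have := intervalIntegral.continuousOn_primitive_interval (a := 0) (b := T) (f := k)
      (μ := volume) (by rwa [uIcc_of_le h.T_pos.le])
    rwa [uIcc_of_le h.T_pos.le] at this
  obtain ⟨δ, hδ, hδ'⟩ := Metric.uniformContinuousOn_iff.1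
    (isCompact_Icc.uniformContinuousOn_of_continuous hP) (ε / (2 * (D ε' + 1))) (by positivity)
  refine ⟨δ, hδ, fun s hs t ht hst => ?_⟩
  filter_upwards [hu.eventually_inner_sub_eq h j] with n hn
  rw [hn t ht s hs]
  refine (hu.abs_intervalIntegral_le h n (d j) hε'0 ht hs).trans ?_
  have h1 := (hδ' s hs t ht hst).le
  rw [Real.dist_eq, intervalIntegral.integral_interval_sub_left
    (intervalIntegrable_of_mem hk h0 hs) (intervalIntegrable_of_mem hk h0 ht)] at h1
  have h2 : ε' * B ≤ ε / 2 := by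
    refine (mul_le_mul_of_nonneg_left ((le_abs_self B).trans (le_add_of_nonneg_right one_pos.le))
      hε'0.le).trans (le_of_eq ?_)
    rw [hε']; field_simp
  have h3 : D ε' * |∫ r in t..s, k r| ≤ ε / 2 := by
    refine (mul_le_mul_of_nonneg_left h1 hD).trans ?_
    rw [mul_div_assoc', div_le_div_iff₀ (by positivity) (by positivity)]
    nlinarith
  linarith

/-- A subsequence converges weakly in `H` at all times. -/
theorem exists_subseq_weak_limit [CompleteSpace H] (hd : DenseRange fun j => ι (d j)) :
    ∃ σ : ℕ → ℕ, StrictMono σ ∧ ∃ w : ℝ → H, (∀ t ∈ Icc 0 T, ‖w t‖ ≤ M) ∧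
      ∀ t ∈ Icc 0 T, ∀ z, Tendsto (fun n => inner ℝ (ι (u (σ n) t)) z) atTop
        (𝓝 (inner ℝ (w t) z)) := by
  obtain ⟨σ, hσ, hl⟩ := exists_subseq_tendsto_pointwise h.T_pos.le
    (fun n j t => inner ℝ (ι (u n t)) (ι (d j)))
    (fun j => ⟨M * ‖ι (d j)‖, fun n t ht => (abs_real_inner_le_norm _ _).trans
      (mul_le_mul_of_nonneg_right (hu.bound n t ht) (norm_nonneg _))⟩)
    (fun j ε hε => hu.equicontinuous h j hε)
  have : ∀ t ∈ Icc 0 T, ∃ z : H, ‖z‖ ≤ M ∧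
      ∀ w, Tendsto (fun n => inner ℝ (ι (u (σ n) t)) w) atTop (𝓝 (inner ℝ z w)) := fun t ht =>
    exists_weak_limit (fun n => hu.bound (σ n) t ht) hd fun j => hl j t ht
  choose! w hw1 hw2 using this
  exact ⟨σ, hσ, w, hw1, hw2⟩

end IsApproximation

end Approximation

end SkeletonEq

namespace SkeletonEq

/-! ### Strong convergence of approximate solutions -/

section Convergence

variable {V H : Type*} [NormedAddCommGroup V] [NormedSpace ℝ V]
  [NormedAddCommGroup H] [InnerProductSpace ℝ H]
  {ι : V →L[ℝ] H} {α c T M Q : ℝ} {K D F : ℝ → ℝ} {a : ℝ → V → StrongDual ℝ V} {x : H}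
  {d : ℕ → V} {u : ℕ → ℝ → V} {w : ℝ → H}

theorem AdmissibleDrift.exists_approximation [MeasurableSpace V] [BorelSpace V]
    [SecondCountableTopology (StrongDual ℝ V)] (h : AdmissibleDrift ι α c T K D F a)
    (hV : IsReflexiveBanach V) (hι : Function.Injective ι) (x : H) (d : ℕ → V) :
    ∃ (M Q : ℝ) (u : ℕ → ℝ → V), IsApproximation ι α T M Q a x d u := by
  set S : ℕ → Submodule ℝ V := fun n => Submodule.span ℝ (d '' Iio n)
  have hfin : ∀ n, FiniteDimensional ℝ (S n) := fun n =>
    FiniteDimensional.span_of_finite ℝ ((finite_Iio n).image d)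
  choose u hu hM heq hen using fun n => exists_galerkin hV hι h.T_pos.le h.alpha_pos h.c_pos
    h.K_nonneg h.integrable h.measurable h.admissible x (S n)
  set M := galerkinRadius T F x
  refine ⟨M, (‖x‖ ^ 2 + (∫ t in Icc 0 T, F t) * (1 + M ^ 2)) / c, u, hu, hM, fun n => ?_,
    fun j => ?_, hen⟩
  · rw [le_div_iff₀ h.c_pos]
    have hL : MemLp (u n) (ENNReal.ofReal α) (volume.restrict (Icc 0 T)) := (hu n).memLp_Icc
    have hMae := (ae_restrict_mem (μ := volume) measurableSet_Icc).mono (hM n)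
    have hi := h.integrable_pairing (hu n).measurable hL hMae hL hMae
    have hα := (integrable_norm_rpow_iff_memLp h.alpha_pos hL.1).2 hL
    have h1 := hen n T ⟨h.T_pos.le, le_rfl⟩
    rw [intervalIntegral.integral_of_le h.T_pos.le, ← integral_Icc_eq_integral_Ioc] at h1
    have h2 : ∫ t in Icc 0 T, 2 * a t (u n t) (u n t)
        ≤ ∫ t in Icc 0 T, (F t * (1 + M ^ 2) - c * ‖u n t‖ ^ α) := by
      refine integral_mono_ae (hi.const_mul 2) ((h.integrable.mul_const _).sub (hα.const_mul c)) ?_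
      filter_upwards [h.admissible, hMae] with t h3 h4
      refine (h3.coer _).trans (sub_le_sub_right ?_ _)
      have := h3.nonneg
      gcongr
    rw [integral_const_mul, integral_sub (h.integrable.mul_const _) (hα.const_mul c),
      integral_mul_const, integral_const_mul] at h2
    have h3 := sq_nonneg ‖ι (u n T)‖
    linarith
  · filter_upwards [eventually_gt_atTop j] with n hn
    exact heq n (d j) (Submodule.subset_span ⟨j, hn, rfl⟩)

/-- If a sequence converges weakly, the norm of the limit is controlled. -/
theorem exists_eventually_norm_sq_lt {z : ℕ → H} {z' : H}
    (hz : ∀ w, Tendsto (fun n => inner ℝ (z n) w) atTop (𝓝 (inner ℝ z' w))) {ε : ℝ} (hε : 0 < ε) :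
    ∀ᶠ n in atTop, ‖z'‖ ^ 2 - ε < ‖z n‖ ^ 2 := by
  have h1 : Tendsto (fun n => 2 * inner ℝ (z n) z' - ‖z'‖ ^ 2) atTop (𝓝 (‖z'‖ ^ 2)) := by
    have := ((hz z').const_mul 2).sub_const (‖z'‖ ^ 2)
    rw [real_inner_self_eq_norm_sq, two_mul, add_sub_cancel_right] at this
    exact this
  filter_upwards [h1.eventually (lt_mem_nhds (sub_lt_self _ hε))] with n hn
  exact hn.trans_le (two_mul_inner_sub_norm_sq_le _ _)

/-- Dominated convergence for the inner products. -/
theorem tendsto_integral_abs_inner_sub {v : ℕ → ℝ → H} {w : ℝ → H}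
    (hv : ∀ n, AEStronglyMeasurable (v n) (volume.restrict (Icc 0 T)))
    (hvM : ∀ n, ∀ t ∈ Icc 0 T, ‖v n t‖ ≤ M) {z : H}
    (hwz : ContinuousOn (fun t => inner ℝ (w t) z) (Icc 0 T)) (hwM : ∀ t ∈ Icc 0 T, ‖w t‖ ≤ M)
    (hw : ∀ t ∈ Icc 0 T, Tendsto (fun n => inner ℝ (v n t) z) atTop (𝓝 (inner ℝ (w t) z))) :
    Tendsto (fun n => ∫ t in Icc 0 T, |inner ℝ (v n t) z - inner ℝ (w t) z|) atTop (𝓝 0) := by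
  have h1 := tendsto_integral_of_dominated_convergence
    (μ := volume.restrict (Icc 0 T)) (F := fun n t => |inner ℝ (v n t) z - inner ℝ (w t) z|)
    (f := fun _ => 0) (fun _ => M * ‖z‖ + M * ‖z‖)
    (fun n => (((hv n).inner aestronglyMeasurable_const).sub
      (hwz.aestronglyMeasurable measurableSet_Icc)).norm) (integrable_const _) ?_ ?_
  · simpa using h1
  · intro n
    filter_upwards [ae_restrict_mem measurableSet_Icc] with t ht
    rw [Real.norm_eq_abs, abs_abs]
    refine (abs_sub _ _).trans (add_le_add ?_ ?_)
    · exact (abs_real_inner_le_norm _ _).trans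
        (mul_le_mul_of_nonneg_right (hvM n t ht) (norm_nonneg _))
    · exact (abs_real_inner_le_norm _ _).trans
        (mul_le_mul_of_nonneg_right (hwM t ht) (norm_nonneg _))
  · filter_upwards [ae_restrict_mem measurableSet_Icc] with t ht
    have := ((hw t ht).sub_const (inner ℝ (w t) z)).abs
    simpa using this

namespace IsApproximation

variable (hu : IsApproximation ι α T M Q a x d u)
include hu

theorem weak_limit_zero (hT : 0 ≤ T) (hd : DenseRange fun j => ι (d j))
    (hw : ∀ t ∈ Icc 0 T, ∀ z, Tendsto (fun n => inner ℝ (ι (u n t)) z) atTop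
      (𝓝 (inner ℝ (w t) z))) : w 0 = x := by
  have h0 : (0 : ℝ) ∈ Icc 0 T := ⟨le_rfl, hT⟩
  have h1 : (fun z => inner ℝ (w 0) z) = fun z => inner ℝ x z := by
    refine hd.equalizer (continuous_const.inner continuous_id)
      (continuous_const.inner continuous_id) (funext fun j => ?_)
    refine tendsto_nhds_unique (hw 0 h0 (ι (d j))) (tendsto_const_nhds.congr' ?_)
    filter_upwards [hu.equation j] with n hn
    rw [hn 0 h0, intervalIntegral.integral_same, add_zero]
    rfl
  exact ext_inner_right ℝ fun z => congrFun h1 z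

theorem weak_limit_continuousOn [MeasurableSpace V] [BorelSpace V]
    [SecondCountableTopology (StrongDual ℝ V)] (h : AdmissibleDrift ι α c T K D F a)
    (hd : DenseRange fun j => ι (d j)) (hwM : ∀ t ∈ Icc 0 T, ‖w t‖ ≤ M)
    (hw : ∀ t ∈ Icc 0 T, ∀ z, Tendsto (fun n => inner ℝ (ι (u n t)) z) atTop
      (𝓝 (inner ℝ (w t) z))) (z : H) : ContinuousOn (fun t => inner ℝ (w t) z) (Icc 0 T) := by
  have hM : 0 ≤ M := (norm_nonneg _).trans (hwM 0 ⟨le_rfl, h.T_pos.le⟩)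
  have h1 : ∀ j, ContinuousOn (fun t => inner ℝ (w t) (ι (d j))) (Icc 0 T) := by
    intro j
    rw [Metric.continuousOn_iff]
    intro t ht ε hε
    obtain ⟨δ, hδ, hδ'⟩ := hu.equicontinuous h j (half_pos hε)
    refine ⟨δ, hδ, fun s hs hst => ?_⟩
    rw [Real.dist_eq] at hst ⊢
    refine lt_of_le_of_lt ?_ (half_lt_self hε)
    exact le_of_tendsto ((hw s hs _).sub (hw t ht _)).abs (hδ' s hs t ht hst)
  refine continuousOn_of_uniform_approx_of_continuousOn fun s hs => ?_
  obtain ⟨ε, hε, hεs⟩ := Metric.mem_uniformity_dist.1 hs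
  obtain ⟨j, hj⟩ := hd.exists_dist_lt z (ε := ε / (M + 1)) (by positivity)
  refine ⟨_, h1 j, fun t ht => hεs ?_⟩
  rw [Real.dist_eq, ← inner_sub_right]
  refine (abs_real_inner_le_norm _ _).trans_lt ?_
  rw [dist_eq_norm, lt_div_iff₀ (by positivity)] at hj
  have := hwM t ht
  have h2 := norm_nonneg (z - ι (d j))
  nlinarith

/-- By compactness of the embedding, weak convergence at all times improves to strong convergence
at almost all times, along a subsequence. -/
theorem exists_subseq_tendsto_ae [CompleteSpace H] (hα : 1 ≤ α) (hT : 0 ≤ T)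
    (hι : IsCompactOperator ι) (hwM : ∀ t ∈ Icc 0 T, ‖w t‖ ≤ M)
    (hw : ∀ t ∈ Icc 0 T, ∀ z, Tendsto (fun n => inner ℝ (ι (u n t)) z) atTop
      (𝓝 (inner ℝ (w t) z)))
    (hwc : ∀ z, ContinuousOn (fun t => inner ℝ (w t) z) (Icc 0 T)) :
    ∃ σ : ℕ → ℕ, StrictMono σ ∧ AEStronglyMeasurable w (volume.restrict (Icc 0 T)) ∧
      ∀ᵐ t ∂volume.restrict (Icc 0 T), Tendsto (fun n => ι (u (σ n) t)) atTop (𝓝 (w t)) := by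
  set μ := volume.restrict (Icc 0 T) with hμ
  have hα0 : 0 < α := by linarith
  have hui : ∀ n, Integrable (u n) μ := fun n =>
    memLp_one_iff_integrable.1 (hu.continuous n).memLp_Icc
  have hvi : ∀ n, Integrable (fun t => ι (u n t)) μ := fun n => ι.integrable_comp (hui n)
  have hT' : ∫ _ in Icc 0 T, (1 : ℝ) = T := by simp [hT]
  have hL1 : ∀ n, ∫ t, ‖u n t‖ ∂μ ≤ T + Q := by
    intro n
    have hi := (integrable_norm_rpow_iff_memLp hα0 (hu.memLp n).1).2 (hu.memLp n)
    calc ∫ t, ‖u n t‖ ∂μ ≤ ∫ t, (1 + ‖u n t‖ ^ α) ∂μ := by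
          refine integral_mono (hui n).norm ((integrable_const 1).add hi) fun t => ?_
          rcases le_or_gt ‖u n t‖ 1 with h1 | h1
          · have : 0 ≤ ‖u n t‖ ^ α := by positivity
            exact h1.trans (by linarith)
          · have := Real.self_le_rpow_of_one_le h1.le hα
            exact this.trans (by linarith)
      _ ≤ T + Q := by
          rw [integral_add (integrable_const _) hi, hT']
          exact add_le_add le_rfl (hu.integral_le n)
  have hQ0 : 0 ≤ T + Q := (integral_nonneg fun t => norm_nonneg _).trans (hL1 0)
  have hcauchy : ∀ ε > 0, ∃ N, ∀ m ≥ N, ∀ n ≥ N, ∫ t, ‖ι (u m t) - ι (u n t)‖ ∂μ < ε := by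
    intro ε hε
    obtain ⟨N, e, he⟩ := exists_norm_le_add_sum_inner hι
      (ε := ε / (4 * (T + Q + 1))) (by positivity)
    set J : ℕ → Fin N → ℝ := fun n i =>
      ∫ t, |inner ℝ (ι (u n t)) (e i) - inner ℝ (w t) (e i)| ∂μ with hJ
    have hJlim : Tendsto (fun n => ∑ i, J n i) atTop (𝓝 0) := by
      have : Tendsto (fun n => ∑ i, J n i) atTop (𝓝 (∑ _i : Fin N, 0)) :=
        tendsto_finsetSum _ fun i _ => tendsto_integral_abs_inner_sub (fun n => (hvi n).1)
          hu.bound (hwc (e i)) hwM fun t ht => hw t ht (e i)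
      simpa using this
    obtain ⟨n₀, hn₀⟩ := eventually_atTop.1 (hJlim.eventually
      (gt_mem_nhds (by positivity : 0 < ε / 4)))
    have hwi : ∀ i, Integrable (fun t => inner ℝ (w t) (e i)) μ := fun i =>
      (hwc (e i)).integrableOn_compact isCompact_Icc
    have hXi : ∀ n i, Integrable
        (fun t => |inner ℝ (ι (u n t)) (e i) - inner ℝ (w t) (e i)|) μ := fun n i =>
      (((hvi n).inner_const (e i)).sub (hwi i)).abs
    refine ⟨n₀, fun m hm n hn => ?_⟩
    set δ := ε / (4 * (T + Q + 1)) with hδ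
    have hδ0 : 0 < δ := by positivity
    have hI : ∀ m n, Integrable (fun t => δ * (‖u m t‖ + ‖u n t‖)) μ := fun m n =>
      ((hui m).norm.add (hui n).norm).const_mul δ
    have hXX : ∀ m n i, Integrable (fun t => |inner ℝ (ι (u m t)) (e i) - inner ℝ (w t) (e i)|
        + |inner ℝ (ι (u n t)) (e i) - inner ℝ (w t) (e i)|) μ := fun m n i =>
      (hXi m i).add (hXi n i)
    calc ∫ t, ‖ι (u m t) - ι (u n t)‖ ∂μ
        ≤ ∫ t, (δ * (‖u m t‖ + ‖u n t‖)
          + ∑ i, (|inner ℝ (ι (u m t)) (e i) - inner ℝ (w t) (e i)|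
            + |inner ℝ (ι (u n t)) (e i) - inner ℝ (w t) (e i)|)) ∂μ := by
          refine integral_mono ((hvi m).sub (hvi n)).norm ((hI m n).add
            (integrable_finsetSum _ fun i _ => hXX m n i)) fun t => ?_
          have h1 := he (u m t - u n t)
          rw [map_sub] at h1
          refine h1.trans (add_le_add (mul_le_mul_of_nonneg_left (norm_sub_le _ _) hδ0.le)
            (Finset.sum_le_sum fun i _ => ?_))
          rw [inner_sub_right, real_inner_comm, real_inner_comm (ι (u n t)),
            abs_sub_comm (inner ℝ (ι (u n t)) (e i))]
          exact abs_sub_le _ _ _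
      _ = δ * ((∫ t, ‖u m t‖ ∂μ) + ∫ t, ‖u n t‖ ∂μ) + (∑ i, J m i + ∑ i, J n i) := by
          rw [integral_add (hI m n) (integrable_finsetSum _ fun i _ => hXX m n i),
            integral_const_mul, integral_add (hui m).norm (hui n).norm,
            integral_finsetSum _ fun i _ => hXX m n i, ← Finset.sum_add_distrib]
          congr 1
          exact Finset.sum_congr rfl fun i _ => integral_add (hXi m i) (hXi n i)
      _ < ε := by
          have h1 := hn₀ m hm
          have h2 := hn₀ n hn
          have h3 : δ * ((∫ t, ‖u m t‖ ∂μ) + ∫ t, ‖u n t‖ ∂μ) ≤ ε / 2 := by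
            refine (mul_le_mul_of_nonneg_left (add_le_add (hL1 m) (hL1 n)) hδ0.le).trans ?_
            rw [hδ, div_mul_eq_mul_div, div_le_div_iff₀ (by positivity) (by positivity)]
            nlinarith
          linarith
  have hdist : ∀ f g : Lp H 1 μ, dist f g = ∫ t, ‖f t - g t‖ ∂μ := by
    intro f g
    rw [dist_eq_norm, L1.norm_eq_integral_norm]
    exact integral_congr_ae ((Lp.coeFn_sub f g).mono fun t ht => congrArg norm ht)
  have hC : CauchySeq fun n => (hvi n).toL1 := by
    rw [Metric.cauchySeq_iff]
    intro ε hε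
    obtain ⟨N, hN⟩ := hcauchy ε hε
    refine ⟨N, fun m hm n hn => ?_⟩
    rw [hdist]
    refine lt_of_eq_of_lt (integral_congr_ae ?_) (hN m hm n hn)
    filter_upwards [(hvi m).coeFn_toL1, (hvi n).coeFn_toL1] with t h1 h2
    rw [h1, h2]
  obtain ⟨G, hG⟩ := cauchySeq_tendsto_of_complete hC
  have hGi : Integrable G μ := L1.integrable_coeFn G
  have hG0 : Tendsto (fun n => ∫ t, |‖ι (u n t) - G t‖| ∂μ) atTop (𝓝 0) := by
    refine (tendsto_iff_dist_tendsto_zero.1 hG).congr fun n => ?_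
    rw [hdist]
    refine integral_congr_ae ?_
    filter_upwards [(hvi n).coeFn_toL1] with t h1
    rw [h1, abs_of_nonneg (norm_nonneg _)]
  obtain ⟨σ, hσ, hae⟩ := exists_subseq_tendsto_ae_zero (fun n => ((hvi n).sub hGi).norm) hG0
  have hGw : G =ᵐ[μ] w := by
    filter_upwards [hae, ae_restrict_mem measurableSet_Icc] with t h1 ht
    have h2 : Tendsto (fun n => ι (u (σ n) t)) atTop (𝓝 (G t)) :=
      tendsto_iff_norm_sub_tendsto_zero.2 h1
    exact ext_inner_right ℝ fun z => tendsto_nhds_unique (h2.inner tendsto_const_nhds)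
      ((hw t ht z).comp hσ.tendsto_atTop)
  refine ⟨σ, hσ, hGi.1.congr hGw, ?_⟩
  filter_upwards [hae, hGw] with t h1 h2
  rw [← h2]
  exact tendsto_iff_norm_sub_tendsto_zero.2 h1

/-- The limit takes values in `V` almost everywhere and lies in `L^α(0, T; V)`. -/
theorem exists_limit_memLp [MeasurableSpace V] [BorelSpace V] [SecondCountableTopology V]
    [CompleteSpace H] [TopologicalSpace.SeparableSpace H] (hα : 0 < α)
    (hV : IsReflexiveBanach V) (hι : Function.Injective ι)
    (hwm : AEStronglyMeasurable w (volume.restrict (Icc 0 T)))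
    (hlim : ∀ᵐ t ∂volume.restrict (Icc 0 T), Tendsto (fun n => ι (u n t)) atTop (𝓝 (w t))) :
    ∃ y : ℝ → V, Measurable y ∧ MemLp y (ENNReal.ofReal α) (volume.restrict (Icc 0 T)) ∧
      ∀ᵐ t ∂volume.restrict (Icc 0 T), ι (y t) = w t := by
  set μ := volume.restrict (Icc 0 T) with hμ
  have : CompleteSpace V := hV.1
  have : SecondCountableTopology H := UniformSpace.secondCountable_of_separable H
  borelize H
  have hemb : MeasurableEmbedding ι := ι.continuous.measurableEmbedding hι
  obtain ⟨g, hg, hgι⟩ := hemb.exists_measurable_extend measurable_id fun _ => ⟨0⟩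
  set w' := hwm.mk w
  have hw' : Measurable w' := hwm.stronglyMeasurable_mk.measurable
  set N : ℝ → ℝ≥0∞ := fun t => liminf (fun n => ‖u n t‖ₑ ^ α) atTop with hN
  have hmeas : ∀ n, Measurable fun t => ‖u n t‖ₑ ^ α := fun n =>
    ((hu.continuous n).measurable.enorm).pow_const α
  have hNm : Measurable N := Measurable.liminf hmeas
  have hNint : ∫⁻ t, N t ∂μ ≤ ENNReal.ofReal Q := by
    refine (lintegral_liminf_le hmeas).trans ?_
    refine liminf_le_of_le (by isBoundedDefault) fun b hb => ?_
    obtain ⟨n, hn⟩ := hb.exists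
    refine hn.trans ?_
    have hi := (integrable_norm_rpow_iff_memLp hα (hu.memLp n).1).2 (hu.memLp n)
    refine le_trans (le_of_eq ?_) (ENNReal.ofReal_le_ofReal (hu.integral_le n))
    rw [ofReal_integral_eq_lintegral_ofReal hi (ae_of_all _ fun t => by positivity)]
    refine lintegral_congr fun t => ?_
    rw [← ENNReal.ofReal_rpow_of_nonneg (norm_nonneg _) hα.le, ofReal_norm]
  have hNfin : ∀ᵐ t ∂μ, N t < ∞ :=
    ae_lt_top hNm (hNint.trans_lt ENNReal.ofReal_lt_top).ne
  have hkey : ∀ᵐ t ∂μ, ι (g (w' t)) = w t ∧ ‖g (w' t)‖ₑ ^ α ≤ N t := by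
    filter_upwards [hNfin, hlim, hwm.ae_eq_mk] with t h1 h2 h3
    have hex : ∀ R : ℝ, N t < ENNReal.ofReal R → ∃ v, ι v = w t ∧ ‖v‖ₑ ^ α ≤ ENNReal.ofReal R := by
      intro R hR
      have hfr : ∃ᶠ n in atTop, ‖u n t‖ ≤ R ^ α⁻¹ := by
        refine (frequently_lt_of_liminf_lt (by isBoundedDefault) hR).mono fun n hn => ?_
        have hR0 : 0 < R := ENNReal.ofReal_pos.1 (zero_le.trans_lt hn)
        rw [← ofReal_norm, ENNReal.ofReal_rpow_of_nonneg (norm_nonneg _) hα.le,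
          ENNReal.ofReal_lt_ofReal_iff hR0] at hn
        have h4 := Real.rpow_le_rpow (by positivity) hn.le (inv_nonneg.2 hα.le)
        rwa [← Real.rpow_mul (norm_nonneg _), mul_inv_cancel₀ hα.ne', Real.rpow_one] at h4
      obtain ⟨v, hv1, hv2⟩ := exists_of_tendsto_of_bounded hV hfr h2
      have hR0 : 0 < R := ENNReal.ofReal_pos.1 (zero_le.trans_lt hR)
      refine ⟨v, hv1, ?_⟩
      rw [← ofReal_norm, ENNReal.ofReal_rpow_of_nonneg (norm_nonneg _) hα.le]
      refine ENNReal.ofReal_le_ofReal ?_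
      have h4 := Real.rpow_le_rpow (norm_nonneg _) hv2 hα.le
      rwa [← Real.rpow_mul hR0.le, inv_mul_cancel₀ hα.ne', Real.rpow_one] at h4
    have hgv : ∀ v, ι v = w t → g (w' t) = v := by
      intro v hv
      rw [show w' t = ι v from (h3.symm.trans hv.symm)]
      exact congrFun hgι v
    obtain ⟨v, hv, -⟩ := hex ((N t).toReal + 1) (by
      rw [ENNReal.lt_ofReal_iff_toReal_lt h1.ne]; linarith)
    rw [hgv v hv]
    refine ⟨hv, le_of_forall_gt_imp_ge_of_dense fun b hb => ?_⟩
    rcases eq_or_ne b ∞ with rfl | hb'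
    · exact le_top
    · rw [← ENNReal.ofReal_toReal hb'] at hb ⊢
      obtain ⟨v', hv', hv2⟩ := hex _ hb
      rwa [hι (hv.trans hv'.symm)]
  have hgm : Measurable fun t => g (w' t) := hg.comp hw'
  refine ⟨fun t => g (w' t), hgm, ⟨hgm.aestronglyMeasurable, ?_⟩, hkey.mono fun t ht => ht.1⟩
  have hp0 : ENNReal.ofReal α ≠ 0 := by simpa using hα
  rw [eLpNorm_lt_top_iff_lintegral_rpow_enorm_lt_top hp0 ENNReal.ofReal_ne_top,
    ENNReal.toReal_ofReal hα.le]
  exact (lintegral_mono_ae (hkey.mono fun t ht => ht.2)).trans_lt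
    (hNint.trans_lt ENNReal.ofReal_lt_top)

end IsApproximation

end Convergence

end SkeletonEq

namespace SkeletonEq

/-! ### Existence -/

section Existence

theorem setIntegral_Icc_eq_intervalIntegral {τ : ℝ} (hτ : 0 ≤ τ) (g : ℝ → ℝ) :
    ∫ t in Icc 0 τ, g t = ∫ t in (0 : ℝ)..τ, g t := by
  rw [intervalIntegral.integral_of_le hτ, integral_Icc_eq_integral_Ioc]

theorem tendsto_intervalIntegral_of_abs_sub {T : ℝ} {X : ℕ → ℝ → ℝ} {X' : ℝ → ℝ}
    (hX : ∀ n, IntegrableOn (X n) (Icc 0 T)) (hX' : IntegrableOn X' (Icc 0 T))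
    (h : Tendsto (fun n => ∫ t in Icc 0 T, |X n t - X' t|) atTop (𝓝 0)) {s t : ℝ}
    (hs : s ∈ Icc 0 T) (ht : t ∈ Icc 0 T) :
    Tendsto (fun n => ∫ r in s..t, X n r) atTop (𝓝 (∫ r in s..t, X' r)) := by
  rw [tendsto_iff_dist_tendsto_zero]
  refine squeeze_zero (fun _ => dist_nonneg) (fun n => ?_) h
  have hsub : uIoc s t ⊆ Icc 0 T := uIoc_subset_uIcc.trans (uIcc_subset_Icc hs ht)
  rw [Real.dist_eq, ← intervalIntegral.integral_sub (intervalIntegrable_of_mem (hX n) hs ht)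
    (intervalIntegrable_of_mem hX' hs ht), ← Real.norm_eq_abs]
  refine intervalIntegral.norm_integral_le_integral_norm_uIoc.trans ?_
  exact setIntegral_mono_set ((hX n).sub hX').norm (ae_of_all _ fun _ => norm_nonneg _)
    hsub.eventuallyLE

/-- Weak continuity and continuity of the norm give strong continuity. -/
theorem continuousOn_of_weak {X H : Type*} [TopologicalSpace X] [NormedAddCommGroup H]
    [InnerProductSpace ℝ H] {w : X → H} {s : Set X}
    (hw : ∀ z, ContinuousOn (fun t => inner ℝ (w t) z) s)
    (hn : ContinuousOn (fun t => ‖w t‖ ^ 2) s) : ContinuousOn w s := by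
  intro t ht
  rw [ContinuousWithinAt, tendsto_iff_norm_sub_tendsto_zero]
  have h1 : Tendsto (fun r => ‖w r - w t‖ ^ 2) (𝓝[s] t) (𝓝 0) := by
    have h2 : Tendsto (fun r => ‖w r‖ ^ 2 - 2 * inner ℝ (w r) (w t) + ‖w t‖ ^ 2) (𝓝[s] t)
        (𝓝 (‖w t‖ ^ 2 - 2 * inner ℝ (w t) (w t) + ‖w t‖ ^ 2)) :=
      ((hn t ht).tendsto.sub ((hw (w t) t ht).tendsto.const_mul 2)).add_const (‖w t‖ ^ 2)
    rw [real_inner_self_eq_norm_sq, show ‖w t‖ ^ 2 - 2 * ‖w t‖ ^ 2 + ‖w t‖ ^ 2 = 0 by ring] at h2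
    exact h2.congr fun r => (norm_sub_sq_real _ _).symm
  have h3 := h1.sqrt
  simpa [Real.sqrt_sq] using h3

variable {V H : Type*} [NormedAddCommGroup V] [NormedSpace ℝ V]
  [NormedAddCommGroup H] [InnerProductSpace ℝ H]
  {ι : V →L[ℝ] H} {α c T M Q : ℝ} {K D F : ℝ → ℝ} {a : ℝ → V → StrongDual ℝ V} {x : H}
  {d : ℕ → V} {u : ℕ → ℝ → V} {w : ℝ → H} {y : ℝ → V}

theorem exists_norm_sq_sub_le_of_weak_continuousOn {τ : ℝ} (hτ : 0 ≤ τ)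
    (hw : ContinuousOn (fun t => inner ℝ (w t) (w 0)) (Icc 0 τ)) {ε : ℝ} (hε : 0 < ε) :
    ∃ δ > 0, ∀ t ∈ Icc 0 τ, t ≤ δ → ‖w 0‖ ^ 2 - ε ≤ ‖w t‖ ^ 2 := by
  obtain ⟨δ, hδ, h⟩ := Metric.continuousOn_iff.1 hw 0 ⟨le_rfl, hτ⟩ (ε / 2) (half_pos hε)
  refine ⟨δ / 2, half_pos hδ, fun t ht htδ => ?_⟩
  have h1 := h t ht (by rw [Real.dist_eq, sub_zero, abs_of_nonneg ht.1]; linarith)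
  rw [Real.dist_eq, real_inner_self_eq_norm_sq, abs_lt] at h1
  have h2 := two_mul_inner_sub_norm_sq_le (w t) (w 0)
  linarith [h1.1]

/-- A solution of the equation tested with elements of `V`: `w` is the `H`-continuous version and
`y` the `V`-valued version. -/
structure IsTestedSolution [MeasurableSpace V] (ι : V →L[ℝ] H) (α T : ℝ)
    (a : ℝ → V → StrongDual ℝ V) (x : H) (w : ℝ → H) (y : ℝ → V) : Prop where
  continuousOn : ContinuousOn w (Icc 0 T)
  measurable : Measurable y
  memLp : MemLp y (ENNReal.ofReal α) (volume.restrict (Icc 0 T))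
  ae_eq : ∀ᵐ t ∂volume.restrict (Icc 0 T), ι (y t) = w t
  equation : ∀ v, ∀ t ∈ Icc 0 T,
    inner ℝ (w t) (ι v) = inner ℝ x (ι v) + ∫ s in (0 : ℝ)..t, a s (y s) v

variable [MeasurableSpace V] [BorelSpace V] [SecondCountableTopology (StrongDual ℝ V)]

namespace IsApproximation

variable (hu : IsApproximation ι α T M Q a x d u)
include hu

variable (h : AdmissibleDrift ι α c T K D F a)
include h

theorem tendsto_intervalIntegral (hd : DenseRange d) (hwM : ∀ t ∈ Icc 0 T, ‖w t‖ ≤ M)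
    (hw : ∀ t ∈ Icc 0 T, ∀ z, Tendsto (fun n => inner ℝ (ι (u n t)) z) atTop
      (𝓝 (inner ℝ (w t) z))) (v : V) {s t : ℝ} (hs : s ∈ Icc 0 T) (ht : t ∈ Icc 0 T) :
    Tendsto (fun n => ∫ r in s..t, a r (u n r) v) atTop (𝓝 (inner ℝ (w t - w s) (ι v))) := by
  have hdj : ∀ j, Tendsto (fun n => ∫ r in s..t, a r (u n r) (d j)) atTop
      (𝓝 (inner ℝ (w t - w s) (ι (d j)))) := by
    intro j
    rw [inner_sub_left]
    refine ((hw t ht _).sub (hw s hs _)).congr' ?_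
    filter_upwards [hu.eventually_inner_sub_eq h j] with n hn
    exact hn s hs t ht
  set B := K M * ((∫ t in Icc 0 T, F t) + Q)
  rw [Metric.tendsto_atTop]
  intro ε hε
  set ε' := ε / (8 * (|B| + 1)) with hε'
  have hε'0 : 0 < ε' := by positivity
  have hε'B : ε' * B ≤ ε / 8 := by
    refine (mul_le_mul_of_nonneg_left ((le_abs_self B).trans (le_add_of_nonneg_right one_pos.le))
      hε'0.le).trans (le_of_eq ?_)
    rw [hε']; field_simp
  set Ψ : V → ℝ := fun z => D ε' * (‖z‖ ^ α * T + (∫ t in Icc 0 T, F t) * ‖ι z‖ ^ 2)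
    + 2 * M * ‖ι z‖ with hΨ
  have hΨc : Continuous fun z => Ψ (v - z) := by
    have h1 : Continuous fun z : V => v - z := by fun_prop
    have h2 : Continuous Ψ := by
      have h3 : Continuous fun z : V => ‖z‖ ^ α :=
        continuous_norm.rpow_const fun _ => Or.inr h.alpha_pos.le
      fun_prop
    exact h2.comp h1
  have hΨ0 : Ψ (v - v) = 0 := by
    simp [hΨ, Real.zero_rpow h.alpha_pos.ne']
  obtain ⟨j, hj⟩ := hd.exists_mem_open (isOpen_lt hΨc continuous_const)
    ⟨v, show Ψ (v - v) < ε / 8 by rw [hΨ0]; positivity⟩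
  obtain ⟨N, hN⟩ := Metric.tendsto_atTop.1 (hdj j) (ε / 2) (half_pos hε)
  refine ⟨N, fun n hn => ?_⟩
  have h1 := hN n hn
  rw [Real.dist_eq] at h1 ⊢
  set z := v - d j with hz
  have hvz : v = d j + z := by simp [hz]
  have h2 : ∫ r in s..t, a r (u n r) v
      = (∫ r in s..t, a r (u n r) (d j)) + ∫ r in s..t, a r (u n r) z := by
    rw [← intervalIntegral.integral_add
      (intervalIntegrable_of_mem (hu.integrable_apply h n _) hs ht)
      (intervalIntegrable_of_mem (hu.integrable_apply h n _) hs ht)]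
    refine intervalIntegral.integral_congr fun r _ => ?_
    simp only [hz, map_sub]; ring
  have h3 := hu.abs_intervalIntegral_le h n z hε'0 hs ht
  have h4 : |∫ r in s..t, (‖z‖ ^ α + F r * ‖ι z‖ ^ 2)|
      ≤ ‖z‖ ^ α * T + (∫ t in Icc 0 T, F t) * ‖ι z‖ ^ 2 := by
    have hc : IntegrableOn (fun _ => ‖z‖ ^ α) (Icc 0 T) :=
      integrable_const (μ := volume.restrict (Icc 0 T)) _
    have hk : IntegrableOn (fun r => ‖z‖ ^ α + F r * ‖ι z‖ ^ 2) (Icc 0 T) :=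
      hc.add (h.integrable.mul_const _)
    have hk0 : ∀ᵐ r ∂volume.restrict (Icc 0 T), 0 ≤ ‖z‖ ^ α + F r * ‖ι z‖ ^ 2 :=
      h.ae_nonneg.mono fun r hr => by positivity
    have hsub : uIoc s t ⊆ Icc 0 T := uIoc_subset_uIcc.trans (uIcc_subset_Icc hs ht)
    rw [intervalIntegral.abs_integral_eq_abs_integral_uIoc,
      abs_of_nonneg (integral_nonneg_of_ae (ae_restrict_of_ae_restrict_of_subset hsub hk0))]
    refine (setIntegral_mono_set hk hk0 hsub.eventuallyLE).trans (le_of_eq ?_)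
    rw [integral_add hc (h.integrable.mul_const _), integral_mul_const]
    simp [h.T_pos.le, mul_comm]
  have h5 : |inner ℝ (w t - w s) (ι z)| ≤ 2 * M * ‖ι z‖ := by
    refine (abs_real_inner_le_norm _ _).trans (mul_le_mul_of_nonneg_right ?_ (norm_nonneg _))
    refine (norm_sub_le _ _).trans ?_
    linarith [hwM t ht, hwM s hs]
  have h6 : Ψ z < ε / 8 := hj
  have h7 := mul_le_mul_of_nonneg_left h4 (h.D_nonneg ε')
  have h8 : inner ℝ (w t - w s) (ι v)
      = inner ℝ (w t - w s) (ι (d j)) + inner ℝ (w t - w s) (ι z) := by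
    rw [← inner_add_right, ← map_add, ← hvz]
  rw [h2, h8]
  have h9 := h3.trans (add_le_add hε'B h7)
  simp only [hΨ] at h6
  rw [abs_le] at h9 h5
  rw [abs_lt] at h1 ⊢
  constructor <;> linarith

/-- The energy inequality for the limit on `[0, τ]`. -/
theorem eventually_two_mul_pairing_le (hd : DenseRange d) (hwM : ∀ t ∈ Icc 0 T, ‖w t‖ ≤ M)
    (hw : ∀ t ∈ Icc 0 T, ∀ z, Tendsto (fun n => inner ℝ (ι (u n t)) z) atTop
      (𝓝 (inner ℝ (w t) z)))
    (hwc : ∀ z, ContinuousOn (fun t => inner ℝ (w t) z) (Icc 0 T))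
    (hyα : MemLp y (ENNReal.ofReal α) (volume.restrict (Icc 0 T)))
    (hyw : ∀ᵐ t ∂volume.restrict (Icc 0 T), ι (y t) = w t) {τ : ℝ} (hτ : τ ∈ Icc 0 T)
    {ε : ℝ} (hε : 0 < ε) :
    ∀ᶠ n in atTop, 2 * ∫ t in (0 : ℝ)..τ, a t (u n t) (y t) ≤ ‖w τ‖ ^ 2 - ‖w 0‖ ^ 2 + ε := by
  rcases hτ.1.eq_or_lt with rfl | hτ0
  · filter_upwards with n
    simp [hε.le]
  have hsub : Icc 0 τ ⊆ Icc 0 T := Icc_subset_Icc_right hτ.2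
  have hle : volume.restrict (Icc 0 τ) ≤ volume.restrict (Icc 0 T) :=
    Measure.restrict_mono hsub le_rfl
  have hq0 : ∀ n, ∀ᵐ t ∂volume.restrict (Icc 0 T), 0 ≤ K M * (F t + ‖u n t‖ ^ α) := fun n =>
    h.ae_nonneg.mono fun r hr => mul_nonneg (h.K_nonneg M) (add_nonneg hr (by positivity))
  have hq := fun n => h.integrable_growth (M := M) (hu.memLp n)
  have := eventually_two_mul_integral_le h.one_lt.le hτ0 (hyα.mono_measure hle) (u := w)
    (ae_mono hle hyw) (fun t ht => hwM t (hsub ht)) (h.integrable.mono_set hsub)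
    (ae_mono hle h.ae_nonneg) (w := fun n t => a t (u n t))
    (fun n => (h.stronglyMeasurable_comp (hu.continuous n).measurable).aestronglyMeasurable)
    (fun n => (hq n).mono_set hsub)
    (fun n => (setIntegral_mono_set (hq n) (hq0 n) hsub.eventuallyLE).trans
      (hu.integral_growth_le h n))
    (fun n => ae_mono hle (hasGrowthBound_of_admissible h.admissible (hu.ae_bound n)))
    h.D_nonneg
    (fun v s hs t ht => hu.tendsto_intervalIntegral h hd hwM hw v (hsub hs) (hsub ht))
    (fun ε hε => exists_norm_sq_sub_le_of_weak_continuousOn hτ.1 ((hwc _).mono hsub) hε) hε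
  simpa only [setIntegral_Icc_eq_intervalIntegral hτ.1] using this

/-- Convergence of the drift, integrated against a fixed function. -/
theorem tendsto_integral_abs_pairing_sub {z : ℝ → V} (hym : Measurable y)
    (hyα : MemLp y (ENNReal.ofReal α) (volume.restrict (Icc 0 T)))
    (hyM : ∀ᵐ t ∂volume.restrict (Icc 0 T), ‖ι (y t)‖ ≤ M)
    (hzα : MemLp z (ENNReal.ofReal α) (volume.restrict (Icc 0 T)))
    {M' : ℝ} (hzM : ∀ᵐ t ∂volume.restrict (Icc 0 T), ‖ι (z t)‖ ≤ M')
    (hlim : ∀ᵐ t ∂volume.restrict (Icc 0 T), ∀ v,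
      Tendsto (fun n => a t (u n t) v) atTop (𝓝 (a t (y t) v))) :
    Tendsto (fun n => ∫ t in Icc 0 T, |a t (u n t) (z t) - a t (y t) (z t)|) atTop (𝓝 0) := by
  refine tendsto_integral_abs_sub_of_le
    (fun n => (h.integrable_pairing (hu.continuous n).measurable (hu.memLp n) (hu.ae_bound n) hzα
      hzM).1) (h.integrable_pairing hym hyα hyM hzα hzM)
    (fun n => h.integrable_growth (M := M) (hu.memLp n))
    (fun n => h.ae_nonneg.mono fun r hr =>
      mul_nonneg (h.K_nonneg M) (add_nonneg hr (by positivity)))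
    (hu.integral_growth_le h) (fun ε hε => ?_) (hlim.mono fun t ht => ht (z t))
  refine ⟨fun t => D ε * (‖z t‖ ^ α + F t * ‖ι (z t)‖ ^ 2),
    (((integrable_norm_rpow_iff_memLp h.alpha_pos hzα.1).2 hzα).add
      (integrable_mul_norm_sq_of_bounded h.integrable h.ae_nonneg hzα.1 hzM)).const_mul _,
    fun n => ?_⟩
  filter_upwards [hasGrowthBound_of_admissible h.admissible (hu.ae_bound n)] with t ht
  exact ht ε hε (z t)

end IsApproximation

/-- Existence for an admissible drift. -/
theorem AdmissibleDrift.exists_solution [CompleteSpace H] [TopologicalSpace.SeparableSpace H]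
    (h : AdmissibleDrift ι α c T K D F a) (hV : IsReflexiveBanach V) (hι : IsGelfandEmbedding ι)
    (x : H) : ∃ (w : ℝ → H) (y : ℝ → V), IsTestedSolution ι α T a x w y := by
  obtain ⟨hinj, hdense, hcomp⟩ := hι
  have : TopologicalSpace.SeparableSpace V := separableSpace_of_dual V
  have : SecondCountableTopology V := UniformSpace.secondCountable_of_separable V
  set μ := volume.restrict (Icc 0 T) with hμ
  set d : ℕ → V := TopologicalSpace.denseSeq V
  have hd : DenseRange d := TopologicalSpace.denseRange_denseSeq V
  have hιd : DenseRange fun j => ι (d j) := hdense.comp hd ι.continuous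
  obtain ⟨M, Q, u₀, hu₀⟩ := h.exists_approximation hV hinj x d
  obtain ⟨σ₀, hσ₀, w, hwM, hw₀⟩ := hu₀.exists_subseq_weak_limit h hιd
  have hu₁ := hu₀.subseq hσ₀
  have hwc := hu₁.weak_limit_continuousOn h hιd hwM hw₀
  have hw0 := hu₁.weak_limit_zero h.T_pos.le hιd hw₀
  obtain ⟨σ₁, hσ₁, hwm, hlim₁⟩ := hu₁.exists_subseq_tendsto_ae h.one_lt.le h.T_pos.le hcomp hwM
    hw₀ hwc
  have hu₂ := hu₁.subseq hσ₁
  have hw₂ : ∀ t ∈ Icc 0 T, ∀ z, Tendsto (fun n => inner ℝ (ι (u₀ (σ₀ (σ₁ n)) t)) z) atTop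
      (𝓝 (inner ℝ (w t) z)) := fun t ht z => (hw₀ t ht z).comp hσ₁.tendsto_atTop
  obtain ⟨y, hym, hyα, hyw⟩ := hu₂.exists_limit_memLp h.alpha_pos hV hinj hwm hlim₁
  have hyM : ∀ᵐ t ∂μ, ‖ι (y t)‖ ≤ M := by
    filter_upwards [hyw, ae_restrict_mem measurableSet_Icc] with t h1 h2
    rw [h1]
    exact hwM t h2
  set u₂ : ℕ → ℝ → V := fun n => u₀ (σ₀ (σ₁ n)) with hu₂def
  have hTT : T ∈ Icc 0 T := ⟨h.T_pos.le, le_rfl⟩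
  have h00 : (0 : ℝ) ∈ Icc 0 T := ⟨le_rfl, h.T_pos.le⟩
  have hpair : ∀ n, IntegrableOn (fun t => a t (u₂ n t) (y t)) (Icc 0 T) := fun n =>
    h.integrable_pairing (hu₂.continuous n).measurable (hu₂.memLp n) (hu₂.ae_bound n) hyα hyM
  have hself : ∀ n, IntegrableOn (fun t => a t (u₂ n t) (u₂ n t)) (Icc 0 T) := fun n =>
    h.integrable_pairing (hu₂.continuous n).measurable (hu₂.memLp n) (hu₂.ae_bound n)
      (hu₂.memLp n) (hu₂.ae_bound n)
  have hsplit : ∀ n, ∀ τ ∈ Icc 0 T, ∫ t in (0 : ℝ)..τ, a t (u₂ n t) (u₂ n t - y t)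
      = (∫ t in (0 : ℝ)..τ, a t (u₂ n t) (u₂ n t)) - ∫ t in (0 : ℝ)..τ, a t (u₂ n t) (y t) := by
    intro n τ hτ
    rw [← intervalIntegral.integral_sub (intervalIntegrable_of_mem (hself n) h00 hτ)
      (intervalIntegrable_of_mem (hpair n) h00 hτ)]
    simp only [map_sub]
  have hinf : ∀ ε > 0, ∀ᶠ n in atTop, -ε ≤ ∫ t, a t (u₂ n t) (u₂ n t - y t) ∂μ := by
    intro ε hε
    filter_upwards [hu₂.eventually_two_mul_pairing_le h hd hwM hw₂ hwc hyα hyw hTT hε,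
      exists_eventually_norm_sq_lt (hw₂ T hTT) hε] with n h1 h2
    have h3 := hu₂.energy n T hTT
    rw [hμ, setIntegral_Icc_eq_intervalIntegral h.T_pos.le, hsplit n T hTT]
    rw [hw0] at h1
    linarith
  obtain ⟨hx0, σ, hσ, hlim⟩ := exists_subseq_tendsto_of_liminf h.admissible h.alpha_pos h.c_pos
    h.K_nonneg h.D_nonneg hV hinj h.integrable
    (fun n => (hu₂.continuous n).aestronglyMeasurable) hym.aestronglyMeasurable
    (fun n => (h.stronglyMeasurable_comp (hu₂.continuous n).measurable).aestronglyMeasurable)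
    hu₂.memLp hyα hu₂.ae_bound hyM (by
      filter_upwards [hlim₁, hyw] with t h1 h2
      rw [h2]; exact h1) hinf
  have hu := hu₂.subseq hσ
  have hw : ∀ t ∈ Icc 0 T, ∀ z, Tendsto (fun n => inner ℝ (ι (u₂ (σ n) t)) z) atTop
      (𝓝 (inner ℝ (w t) z)) := fun t ht z => (hw₂ t ht z).comp hσ.tendsto_atTop
  have hyapp : ∀ {z : ℝ → V} {M' : ℝ}, MemLp z (ENNReal.ofReal α) μ →
      (∀ᵐ t ∂μ, ‖ι (z t)‖ ≤ M') → IntegrableOn (fun t => a t (y t) (z t)) (Icc 0 T) :=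
    fun hz hzM => h.integrable_pairing hym hyα hyM hz hzM
  have heq : ∀ v, ∀ t ∈ Icc 0 T,
      inner ℝ (w t) (ι v) = inner ℝ x (ι v) + ∫ s in (0 : ℝ)..t, a s (y s) v := by
    intro v t ht
    have hv : MemLp (fun _ : ℝ => v) (ENNReal.ofReal α) μ := memLp_const v
    have hvM : ∀ᵐ t ∂μ, ‖ι ((fun _ : ℝ => v) t)‖ ≤ ‖ι v‖ := ae_of_all _ fun _ => le_rfl
    have h1 := tendsto_intervalIntegral_of_abs_sub (fun n => hu.integrable_apply h n v)
      (hyapp hv hvM) (hu.tendsto_integral_abs_pairing_sub h hym hyα hyM hv hvM hlim) h00 ht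
    have h2 := tendsto_nhds_unique h1 (hu.tendsto_intervalIntegral h hd hwM hw v h00 ht)
    rw [h2, ← inner_add_left, hw0, add_sub_cancel]
  have hnorm : ∀ τ ∈ Icc 0 T, ‖w τ‖ ^ 2 = ‖x‖ ^ 2 + 2 * ∫ t in (0 : ℝ)..τ, a t (y t) (y t) := by
    intro τ hτ
    have hyy := hyapp hyα hyM
    have h1 : Tendsto (fun n => ∫ t in (0 : ℝ)..τ, a t (u₂ (σ n) t) (y t)) atTop
        (𝓝 (∫ t in (0 : ℝ)..τ, a t (y t) (y t))) :=
      tendsto_intervalIntegral_of_abs_sub (fun n => hpair (σ n)) hyy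
        (hu.tendsto_integral_abs_pairing_sub h hym hyα hyM hyα hyM hlim) h00 hτ
    have h2 : Tendsto (fun n => ∫ t in (0 : ℝ)..τ, a t (u₂ (σ n) t) (u₂ (σ n) t - y t)) atTop
        (𝓝 0) := by
      have h3 := tendsto_intervalIntegral_of_abs_sub (T := T) (X' := fun _ => 0)
        (X := fun n t => a t (u₂ (σ n) t) (u₂ (σ n) t - y t))
        (fun n => by simpa only [map_sub] using! (hself (σ n)).sub (hpair (σ n)))
        (integrable_zero _ _ _) (by simpa [Function.comp_def] using hx0.comp hσ.tendsto_atTop)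
        h00 hτ
      simpa using h3
    refine le_antisymm ?_ ?_
    · refine le_of_forall_pos_le_add fun ε hε => ?_
      have h3 : Tendsto (fun n => ‖x‖ ^ 2 + 2 * ∫ s in (0 : ℝ)..τ, a s (u₂ (σ n) s) (u₂ (σ n) s))
          atTop (𝓝 (‖x‖ ^ 2 + 2 * ∫ t in (0 : ℝ)..τ, a t (y t) (y t))) := by
        have h4 := ((h1.add h2).const_mul 2).const_add (‖x‖ ^ 2)
        rw [add_zero] at h4
        refine h4.congr fun n => ?_
        rw [hsplit (σ n) τ hτ, add_sub_cancel]
      have h5 := ge_of_tendsto h3 (b := ‖w τ‖ ^ 2 - ε) (by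
        filter_upwards [exists_eventually_norm_sq_lt (hw τ hτ) hε] with n hn
        exact hn.le.trans (hu.energy n τ hτ))
      linarith
    · refine le_of_forall_pos_le_add fun ε hε => ?_
      have h3 := le_of_tendsto (h1.const_mul 2)
        (hu.eventually_two_mul_pairing_le h hd hwM hw hwc hyα hyw hτ hε)
      rw [hw0] at h3
      linarith
  refine ⟨w, y, continuousOn_of_weak hwc ?_, hym, hyα, hyw, heq⟩
  have hP : ContinuousOn (fun τ => ∫ t in (0 : ℝ)..τ, a t (y t) (y t)) (Icc 0 T) := by
    have := intervalIntegral.continuousOn_primitive_interval (a := 0) (b := T)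
      (f := fun t => a t (y t) (y t)) (μ := volume)
      (by rw [uIcc_of_le h.T_pos.le]; exact hyapp hyα hyM)
    rwa [uIcc_of_le h.T_pos.le] at this
  exact (continuousOn_const.add (continuousOn_const.mul hP)).congr hnorm

end Existence

end SkeletonEq

namespace SkeletonEq

/-! ### Uniqueness -/

section Uniqueness

theorem measurePreserving_const_sub_restrict (τ : ℝ) :
    MeasurePreserving (fun r : ℝ => τ - r) (volume.restrict (Icc 0 τ))
      (volume.restrict (Icc 0 τ)) := by
  have h := (Measure.measurePreserving_sub_left volume τ).restrict_preimage
    (measurableSet_Icc (a := (0 : ℝ)) (b := τ))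
  rwa [preimage_const_sub_Icc, sub_self, sub_zero] at h

variable {V H : Type*} [NormedAddCommGroup V] [NormedSpace ℝ V]
  [NormedAddCommGroup H] [InnerProductSpace ℝ H]
  {ι : V →L[ℝ] H} {y y' : ℝ → V} {w w' : ℝ → H} {x : H}
  {α c T M : ℝ} {K D F : ℝ → ℝ} {a : ℝ → V → StrongDual ℝ V}

/-- The energy inequality for a function `u` with derivative `b`. -/
theorem norm_sq_sub_norm_sq_le {τ : ℝ} (hα : 1 ≤ α) (hτ : 0 ≤ τ)
    (hy : MemLp y (ENNReal.ofReal α) (volume.restrict (Icc 0 τ))) {u : ℝ → H}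
    (hu : ContinuousOn u (Icc 0 τ)) (hyu : ∀ᵐ t ∂volume.restrict (Icc 0 τ), ι (y t) = u t)
    (hF : IntegrableOn F (Icc 0 τ)) (hF0 : ∀ᵐ t ∂volume.restrict (Icc 0 τ), 0 ≤ F t)
    {b : ℝ → StrongDual ℝ V} {q : ℝ → ℝ} (hb : AEStronglyMeasurable b (volume.restrict (Icc 0 τ)))
    (hq : IntegrableOn q (Icc 0 τ))
    (hbq : HasGrowthBound (volume.restrict (Icc 0 τ)) ι α F D q b) (hD : ∀ ε, 0 ≤ D ε)
    (heq : ∀ v : V, ∀ s ∈ Icc 0 τ, ∀ t ∈ Icc 0 τ,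
      ∫ r in s..t, b r v = inner ℝ (u t - u s) (ι v)) :
    ‖u τ‖ ^ 2 - ‖u 0‖ ^ 2 ≤ 2 * ∫ t in (0 : ℝ)..τ, b t (y t) := by
  rcases hτ.eq_or_lt with rfl | hτ0
  · simp
  obtain ⟨M, hM⟩ := isCompact_Icc.exists_bound_of_continuousOn hu
  have hmp := measurePreserving_const_sub_restrict τ
  have hmem : ∀ {r : ℝ}, r ∈ Icc 0 τ → τ - r ∈ Icc 0 τ := fun hr =>
    ⟨sub_nonneg.2 hr.2, sub_le_self _ hr.1⟩
  have hu' : ContinuousOn (fun r => u (τ - r)) (Icc 0 τ) :=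
    hu.comp (continuous_const.sub continuous_id).continuousOn fun r hr => hmem hr
  refine le_of_forall_pos_le_add fun ε hε => ?_
  have hqi : IntegrableOn (fun r => q (τ - r)) (Icc 0 τ) := hmp.integrable_comp_of_integrable hq
  have hK := eventually_two_mul_integral_le (ι := ι) (D := D) hα hτ0
    (y := fun r => y (τ - r)) (hy.comp_measurePreserving hmp) (u := fun r => u (τ - r))
    (hmp.quasiMeasurePreserving.ae hyu) (fun t ht => hM _ (hmem ht))
    (F := fun r => F (τ - r)) (hmp.integrable_comp_of_integrable hF)
    (hmp.quasiMeasurePreserving.ae hF0) (w := fun _ r => -b (τ - r)) (q := fun _ r => q (τ - r))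
    (fun _ => (hb.comp_measurePreserving hmp).neg) (fun _ => hqi) (fun _ => le_rfl)
    (fun _ => ?_) hD ?_ ?_ hε
  · obtain ⟨-, h1⟩ := hK.exists
    simp only [sub_self, sub_zero, neg_apply] at h1
    rw [integral_neg, setIntegral_Icc_eq_intervalIntegral hτ,
      intervalIntegral.integral_comp_sub_left (fun r => b r (y r)) τ, sub_self, sub_zero] at h1
    linarith
  · filter_upwards [hmp.quasiMeasurePreserving.ae hbq] with r hr ε hε z
    rw [neg_apply, abs_neg]
    exact hr ε hε z
  · intro v s hs t ht
    refine tendsto_const_nhds.congr fun n => ?_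
    simp only [neg_apply]
    rw [intervalIntegral.integral_neg, intervalIntegral.integral_comp_sub_left (fun r => b r v) τ,
      heq v _ (hmem ht) _ (hmem hs), ← inner_neg_left, neg_sub]
  · intro ε hε
    exact exists_norm_sq_sub_le_of_weak_continuousOn (w := fun r => u (τ - r)) hτ
      (hu'.inner continuousOn_const) hε

theorem IsTestedSolution.exists_bound [MeasurableSpace V]
    (h : IsTestedSolution ι α T a x w y) : ∃ M, ∀ t ∈ Icc 0 T, ‖w t‖ ≤ M :=
  isCompact_Icc.exists_bound_of_continuousOn h.continuousOn

/-- Uniqueness for an admissible drift. -/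
theorem AdmissibleDrift.eqOn_of_isTestedSolution [MeasurableSpace V]
    [SecondCountableTopology (StrongDual ℝ V)] (h : AdmissibleDrift ι α c T K D F a)
    (hι : DenseRange ι) (hs : IsTestedSolution ι α T a x w y)
    (hs' : IsTestedSolution ι α T a x w' y') : EqOn w w' (Icc 0 T) := by
  set μ := volume.restrict (Icc 0 T) with hμ
  have h00 : (0 : ℝ) ∈ Icc 0 T := ⟨le_rfl, h.T_pos.le⟩
  obtain ⟨M₁, hM₁⟩ := hs.exists_bound
  obtain ⟨M₂, hM₂⟩ := hs'.exists_bound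
  set M := max M₁ M₂
  have hyM : ∀ᵐ t ∂μ, ‖ι (y t)‖ ≤ M := by
    filter_upwards [hs.ae_eq, ae_restrict_mem measurableSet_Icc] with t h1 h2
    rw [h1]; exact (hM₁ t h2).trans (le_max_left _ _)
  have hyM' : ∀ᵐ t ∂μ, ‖ι (y' t)‖ ≤ M := by
    filter_upwards [hs'.ae_eq, ae_restrict_mem measurableSet_Icc] with t h1 h2
    rw [h1]; exact (hM₂ t h2).trans (le_max_right _ _)
  set b : ℝ → StrongDual ℝ V := fun t => a t (y t) - a t (y' t) with hb
  set G : ℝ → ℝ := fun t => K M * (F t + ‖y t‖ ^ α + ‖y' t‖ ^ α) with hG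
  have hyα := (integrable_norm_rpow_iff_memLp h.alpha_pos hs.memLp.1).2 hs.memLp
  have hyα' := (integrable_norm_rpow_iff_memLp h.alpha_pos hs'.memLp.1).2 hs'.memLp
  have hGi : IntegrableOn G (Icc 0 T) := ((h.integrable.add hyα).add hyα').const_mul _
  have hG0 : ∀ᵐ t ∂μ, 0 ≤ G t := h.ae_nonneg.mono fun t ht =>
    mul_nonneg (h.K_nonneg M) (by positivity)
  have hw0 : w 0 - w' 0 = 0 := by
    have h1 : (fun z => inner ℝ (w 0 - w' 0) z) = fun _ => 0 := by
      refine hι.equalizer (continuous_const.inner continuous_id) continuous_const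
        (funext fun v => ?_)
      have h2 := hs.equation v 0 h00
      have h3 := hs'.equation v 0 h00
      rw [intervalIntegral.integral_same] at h2 h3
      simp only [Function.comp_apply, inner_sub_left, h2, h3, sub_self]
    exact inner_self_eq_zero.1 (congrFun h1 _)
  have hbm : AEStronglyMeasurable b μ :=
    ((h.stronglyMeasurable_comp hs.measurable).sub
      (h.stronglyMeasurable_comp hs'.measurable)).aestronglyMeasurable
  have happ : ∀ v, IntegrableOn (fun t => a t (y t) v) (Icc 0 T) := fun v =>
    h.integrable_pairing (z := fun _ => v) hs.measurable hs.memLp hyM (memLp_const v)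
      (ae_of_all _ fun _ => le_rfl)
  have happ' : ∀ v, IntegrableOn (fun t => a t (y' t) v) (Icc 0 T) := fun v =>
    h.integrable_pairing (z := fun _ => v) hs'.measurable hs'.memLp hyM' (memLp_const v)
      (ae_of_all _ fun _ => le_rfl)
  have hdiff : ∀ v, ∀ s ∈ Icc 0 T, ∀ t ∈ Icc 0 T,
      ∫ r in s..t, b r v = inner ℝ ((w t - w' t) - (w s - w' s)) (ι v) := by
    intro v s hs1 t ht
    simp only [hb, sub_apply]
    rw [intervalIntegral.integral_sub (intervalIntegrable_of_mem (happ v) hs1 ht)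
      (intervalIntegrable_of_mem (happ' v) hs1 ht), inner_sub_left, inner_sub_left, inner_sub_left,
      hs.equation v t ht, hs.equation v s hs1, hs'.equation v t ht, hs'.equation v s hs1,
      ← intervalIntegral.integral_interval_sub_left (intervalIntegrable_of_mem (happ v) h00 ht)
        (intervalIntegrable_of_mem (happ v) h00 hs1),
      ← intervalIntegral.integral_interval_sub_left (intervalIntegrable_of_mem (happ' v) h00 ht)
        (intervalIntegrable_of_mem (happ' v) h00 hs1)]
    ring
  have hgrow : HasGrowthBound μ ι α F (fun ε => 2 * D ε)
      (fun t => K M * (F t + ‖y t‖ ^ α) + K M * (F t + ‖y' t‖ ^ α)) b := by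
    filter_upwards [hasGrowthBound_of_admissible h.admissible hyM,
      hasGrowthBound_of_admissible h.admissible hyM'] with t h1 h2 ε hε z
    have h3 := h1 ε hε z
    have h4 := h2 ε hε z
    simp only [hb, sub_apply]
    rw [abs_le] at h3 h4 ⊢
    constructor <;> linarith
  have hzM : ∀ᵐ t ∂μ, ‖ι (y t - y' t)‖ ≤ M + M := by
    filter_upwards [hyM, hyM'] with t h1 h2
    rw [map_sub]
    exact (norm_sub_le _ _).trans (add_le_add h1 h2)
  have hqi : IntegrableOn (fun t => K M * (F t + ‖y t‖ ^ α) + K M * (F t + ‖y' t‖ ^ α))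
      (Icc 0 T) :=
    (h.integrable_growth (M := M) hs.memLp).add (h.integrable_growth (M := M) hs'.memLp)
  have hbz : IntegrableOn (fun t => b t (y t - y' t)) (Icc 0 T) :=
    hgrow.integrable_pairing hbm (hs.memLp.sub hs'.memLp).1 hqi
      ((integrable_norm_rpow_iff_memLp h.alpha_pos (hs.memLp.sub hs'.memLp).1).2
        (hs.memLp.sub hs'.memLp))
      (integrable_mul_norm_sq_of_bounded h.integrable h.ae_nonneg
        (hs.memLp.sub hs'.memLp).1 hzM)
  have hwc : ContinuousOn (fun t => w t - w' t) (Icc 0 T) := hs.continuousOn.sub hs'.continuousOn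
  have hae : ∀ᵐ t ∂μ, ι (y t - y' t) = w t - w' t := by
    filter_upwards [hs.ae_eq, hs'.ae_eq] with t h1 h2
    rw [map_sub, h1, h2]
  have hφ : ContinuousOn (fun t => ‖w t - w' t‖ ^ 2) (Icc 0 T) := hwc.norm.pow 2
  have hGφ : IntegrableOn (fun t => G t * ‖w t - w' t‖ ^ 2) (Icc 0 T) :=
    hGi.mul_continuousOn hφ isCompact_Icc
  have hmain : ∀ τ ∈ Icc 0 T,
      ‖w τ - w' τ‖ ^ 2 ≤ 0 + ∫ t in (0 : ℝ)..τ, G t * ‖w t - w' t‖ ^ 2 := by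
    intro τ hτ
    have hsub : Icc 0 τ ⊆ Icc 0 T := Icc_subset_Icc_right hτ.2
    have hle : volume.restrict (Icc 0 τ) ≤ μ := Measure.restrict_mono hsub le_rfl
    have h1 := norm_sq_sub_norm_sq_le h.one_lt.le hτ.1
      ((hs.memLp.sub hs'.memLp).mono_measure hle) (hwc.mono hsub) (ae_mono hle hae)
      (h.integrable.mono_set hsub) (ae_mono hle h.ae_nonneg) (hbm.mono_measure hle)
      (hqi.mono_set hsub) (ae_mono hle hgrow)
      (fun ε => mul_nonneg zero_le_two (h.D_nonneg ε))
      (fun v s hs t ht => hdiff v s (hsub hs) t (hsub ht))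
    simp only [hw0, norm_zero] at h1
    rw [← intervalIntegral.integral_const_mul] at h1
    have h2 : ∫ t in (0 : ℝ)..τ, 2 * b t ((y - y') t)
        ≤ ∫ t in (0 : ℝ)..τ, G t * ‖w t - w' t‖ ^ 2 := by
      refine intervalIntegral.integral_mono_ae_restrict hτ.1
        (intervalIntegrable_of_mem (hbz.const_mul 2) h00 hτ)
        (intervalIntegrable_of_mem hGφ h00 hτ) ?_
      refine ae_mono hle ?_
      filter_upwards [h.admissible, hyM, hyM', hae] with t h3 h4 h5 h6
      have h7 := h3.mono M _ _ h4 h5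
      rwa [h6] at h7
    linarith
  intro τ hτ
  have h1 := gronwall_integrable hφ hGi hG0 hmain hτ
  rw [zero_mul] at h1
  exact sub_eq_zero.1 (norm_eq_zero.1 (pow_eq_zero_iff two_ne_zero |>.1
    (le_antisymm h1 (sq_nonneg _))))

end Uniqueness

end SkeletonEq

namespace SkeletonEq

/-! ### The drift of the skeleton equation is admissible -/

theorem mul_le_mul_rpow_add_rpow {α ε x b : ℝ} (hα : 1 < α) (hε : 0 < ε) (hx : 0 ≤ x)
    (hb : 0 ≤ b) : x * b ≤ ε * x ^ (α / (α - 1)) + ε ^ (1 - α) * b ^ α := by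
  have hα1 : 0 < α - 1 := sub_pos.2 hα
  have hα0 : 0 < α := by linarith
  set α' := α / (α - 1) with hα'
  have hα'0 : 0 < α' := div_pos hα0 hα1
  have hα'1 : 1 ≤ α' := by rw [hα', le_div_iff₀ hα1]; linarith
  have hconj : α'.HolderConjugate α :=
    ((Real.holderConjugate_iff_eq_conjExponent hα).2 rfl).symm
  have h := Real.young_inequality_of_nonneg (a := ε ^ α'⁻¹ * x) (b := (ε ^ α'⁻¹)⁻¹ * b)
    (by positivity) (by positivity) hconj
  have h1 : ε ^ α'⁻¹ * x * ((ε ^ α'⁻¹)⁻¹ * b) = x * b := by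
    have : ε ^ α'⁻¹ ≠ 0 := by positivity
    field_simp
  have h2 : (ε ^ α'⁻¹ * x) ^ α' = ε * x ^ α' := by
    rw [Real.mul_rpow (by positivity) hx, ← Real.rpow_mul hε.le, inv_mul_cancel₀ hα'0.ne',
      Real.rpow_one]
  have h3 : ((ε ^ α'⁻¹)⁻¹ * b) ^ α = ε ^ (1 - α) * b ^ α := by
    rw [Real.mul_rpow (by positivity) hb, ← Real.rpow_neg hε.le, ← Real.rpow_mul hε.le]
    congr 2
    rw [hα']
    field_simp
    ring
  rw [h1, h2, h3] at h
  exact h.trans (add_le_add (div_le_self (by positivity) hα'1) (div_le_self (by positivity) hα.le))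

theorem mul_mul_le_sq {ε b h z : ℝ} (hε : 0 < ε) :
    b * h * z ≤ ε * b ^ 2 + ε⁻¹ * (h ^ 2 * z ^ 2) := by
  have h1 : 0 ≤ ε⁻¹ * (2 * ε * b - h * z) ^ 2 := by positivity
  have h2 : ε⁻¹ * (2 * ε * b - h * z) ^ 2 = 4 * (ε * b ^ 2) - 4 * (b * h * z)
      + ε⁻¹ * (h ^ 2 * z ^ 2) := by
    field_simp; ring
  have h3 : 0 ≤ ε⁻¹ * (h ^ 2 * z ^ 2) := by positivity
  linarith

theorem two_mul_mul_mul_le_sq {ε b h z : ℝ} (hε : 0 < ε) :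
    2 * (b * h * z) ≤ ε * b ^ 2 + ε⁻¹ * (h ^ 2 * z ^ 2) := by
  have h1 : 0 ≤ ε⁻¹ * (ε * b - h * z) ^ 2 := by positivity
  have h2 : ε⁻¹ * (ε * b - h * z) ^ 2 = ε * b ^ 2 - 2 * (b * h * z)
      + ε⁻¹ * (h ^ 2 * z ^ 2) := by
    field_simp; ring
  linarith

theorem rpow_le_one_add_rpow {r θ α : ℝ} (hr : 0 ≤ r) (hθ : 0 ≤ θ) (h : θ ≤ α) :
    r ^ θ ≤ 1 + r ^ α := by
  have h0 : 0 ≤ r ^ α := by positivity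
  rcases le_or_gt r 1 with h1 | h1
  · linarith [Real.rpow_le_one hr h1 hθ]
  · linarith [Real.rpow_le_rpow_of_exponent_le h1.le h]

section HilbertSchmidtNorm

variable {U H : Type*} [NormedAddCommGroup U] [InnerProductSpace ℝ U] [CompleteSpace U]
  [NormedAddCommGroup H] [InnerProductSpace ℝ H] [CompleteSpace H]

theorem HilbertSchmidt.norm_toCLM_apply_le (S : HilbertSchmidt U H) (h : U) :
    ‖S.toCLM h‖ ≤ ‖S‖ * ‖h‖ := by
  have hunit : ∀ e : U, ‖e‖ = 1 → ‖S.toCLM e‖ ≤ ‖S‖ := by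
    intro e he
    have ho : Orthonormal ℝ ((↑) : ({e} : Set U) → U) := by
      refine ⟨fun i => ?_, fun i j hij => (hij (Subsingleton.elim i j)).elim⟩
      rw [show (i : U) = e from i.2, he]
    obtain ⟨w, b, hew, hb⟩ := ho.exists_hilbertBasis_extension
    have h1 := le_hasSum (S.hasSum_norm_sq b) ⟨e, hew rfl⟩ fun _ _ => by positivity
    rw [hb] at h1
    exact (sq_le_sq₀ (norm_nonneg _) (norm_nonneg _)).1 h1
  rcases eq_or_ne h 0 with rfl | h0
  · simp
  · have h0' : ‖h‖ ≠ 0 := norm_ne_zero_iff.2 h0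
    have h1 := hunit (‖h‖⁻¹ • h) (by rw [norm_smul, norm_inv, norm_norm, inv_mul_cancel₀ h0'])
    rw [map_smul, norm_smul, norm_inv, norm_norm, inv_mul_le_iff₀ (by positivity)] at h1
    linarith

variable (U H) in
/-- The inclusion of the Hilbert–Schmidt operators into the bounded operators. -/
noncomputable def HilbertSchmidt.toCLML : HilbertSchmidt U H →L[ℝ] U →L[ℝ] H :=
  LinearMap.mkContinuous
    { toFun := HilbertSchmidt.toCLM
      map_add' := fun _ _ => rfl
      map_smul' := fun _ _ => rfl } 1 fun S => by
    rw [one_mul]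
    exact ContinuousLinearMap.opNorm_le_bound _ (norm_nonneg _) S.norm_toCLM_apply_le

end HilbertSchmidtNorm

section Drift

variable {V H U : Type*} [NormedAddCommGroup V] [NormedSpace ℝ V]
  [NormedAddCommGroup H] [InnerProductSpace ℝ H]
  [NormedAddCommGroup U] [InnerProductSpace ℝ U] [CompleteSpace U]

/-- The constant in the growth bound of `A`. -/
noncomputable def growthConstA (β C M : ℝ) : ℝ := (1 + |M| ^ (2 + β)) + C * (1 + |M| ^ β)

/-- The constant in the growth bound of `B`. -/
noncomputable def growthConstB (L M : ℝ) : ℝ := 1 + M ^ 2 + L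

/-- The constant in the local monotonicity condition. -/
noncomputable def monoConst (β γ κ C M : ℝ) : ℝ :=
  1 + C * (1 + |M| ^ κ) + C * (1 + |M| ^ γ) + C * (1 + |M| ^ (2 + β)) + C * (1 + |M| ^ β)

theorem monoConst_nonneg {β γ κ C : ℝ} (hC : 0 ≤ C) (M : ℝ) : 0 ≤ monoConst β γ κ C M := by
  unfold monoConst; positivity

theorem growthConstA_nonneg {β C : ℝ} (hC : 0 ≤ C) (M : ℝ) : 0 ≤ growthConstA β C M := by
  unfold growthConstA; positivity

theorem growthConstB_nonneg {L : ℝ} (hL : 0 ≤ L) (M : ℝ) : 0 ≤ growthConstB L M := by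
  unfold growthConstB; positivity

theorem growthA_le {a f r n β C M α : ℝ} (hf : 0 ≤ f) (hr : 0 ≤ r) (hn : 0 ≤ n) (hβ : 0 ≤ β)
    (hC : 0 ≤ C) (hM : n ≤ M)
    (h : a ≤ f * (1 + n ^ (2 + β)) + C * r ^ α * (1 + n ^ β)) :
    a ≤ growthConstA β C M * (f + r ^ α) := by
  have hM' : n ≤ |M| := hM.trans (le_abs_self M)
  have h1 := Real.rpow_le_rpow hn hM' (by linarith : 0 ≤ 2 + β)
  have h2 := Real.rpow_le_rpow hn hM' hβ
  have h3 : 0 ≤ r ^ α := by positivity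
  have h4 : f * (1 + n ^ (2 + β)) ≤ f * (1 + |M| ^ (2 + β)) := by gcongr
  have h5 : C * r ^ α * (1 + n ^ β) ≤ C * r ^ α * (1 + |M| ^ β) := by gcongr
  have h6 : 0 ≤ (1 + |M| ^ (2 + β)) * r ^ α := by positivity
  have h7 : 0 ≤ C * (1 + |M| ^ β) * f := by positivity
  unfold growthConstA
  nlinarith

theorem growthB_le {b g r n L M α : ℝ} (hg : 0 ≤ g) (hr : 0 ≤ r) (hn : 0 ≤ n) (hL : 0 ≤ L)
    (hM : n ≤ M) (h : b ≤ g * (1 + n ^ 2) + L * (1 + r ^ α)) :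
    b ≤ growthConstB L M * (g + 1 + r ^ α) := by
  have h1 : n ^ 2 ≤ M ^ 2 := by gcongr
  have h3 : 0 ≤ r ^ α := by positivity
  have h4 : g * (1 + n ^ 2) ≤ g * (1 + M ^ 2) := by gcongr
  have h5 : 0 ≤ (1 + M ^ 2) * (1 + r ^ α) := by positivity
  have h6 : 0 ≤ L * g := by positivity
  unfold growthConstB
  nlinarith

theorem mono_le {f ρ η r r' n n' α β γ κ θ C M : ℝ} (hf : 0 ≤ f) (hr : 0 ≤ r) (hr' : 0 ≤ r')
    (hn : 0 ≤ n) (hn' : 0 ≤ n') (hβ : 0 ≤ β) (hγ : 0 ≤ γ) (hκ : 0 ≤ κ) (hθ : 0 ≤ θ) (hθα : θ ≤ α)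
    (hC : 0 ≤ C) (hM : n ≤ M) (hM' : n' ≤ M)
    (hρ : |ρ| ≤ C * (1 + n ^ κ) + C * r ^ θ * (1 + n ^ γ))
    (hη : |η| ≤ C * (1 + n' ^ (2 + β)) + C * r' ^ α * (1 + n' ^ β)) :
    f + ρ + η ≤ monoConst β γ κ C M * (f + 1 + r ^ α + r' ^ α) := by
  have hM1 : n ≤ |M| := hM.trans (le_abs_self M)
  have hM2 : n' ≤ |M| := hM'.trans (le_abs_self M)
  have e1 : C * (1 + n ^ κ) ≤ C * (1 + |M| ^ κ) := by gcongr
  have e2 : C * r ^ θ * (1 + n ^ γ) ≤ C * (1 + r ^ α) * (1 + |M| ^ γ) := by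
    have := rpow_le_one_add_rpow hr hθ hθα
    gcongr
  have e3 : C * (1 + n' ^ (2 + β)) ≤ C * (1 + |M| ^ (2 + β)) := by gcongr
  have e4 : C * r' ^ α * (1 + n' ^ β) ≤ C * r' ^ α * (1 + |M| ^ β) := by gcongr
  have h1 := le_abs_self ρ
  have h2 := le_abs_self η
  have hX : 0 ≤ r ^ α := by positivity
  have hY : 0 ≤ r' ^ α := by positivity
  have a1 : 0 ≤ C * (1 + |M| ^ κ) := by positivity
  have a2 : 0 ≤ C * (1 + |M| ^ γ) := by positivity
  have a3 : 0 ≤ C * (1 + |M| ^ (2 + β)) := by positivity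
  have a4 : 0 ≤ C * (1 + |M| ^ β) := by positivity
  unfold monoConst
  set k1 := C * (1 + |M| ^ κ)
  set k2 := C * (1 + |M| ^ γ)
  set k3 := C * (1 + |M| ^ (2 + β))
  set k4 := C * (1 + |M| ^ β)
  have b1 : C * (1 + r ^ α) * (1 + |M| ^ γ) = k2 * (1 + r ^ α) := by ring
  have b2 : C * r' ^ α * (1 + |M| ^ β) = k4 * r' ^ α := by ring
  have s : 0 ≤ f + r ^ α + r' ^ α := by positivity
  have c1 : k1 ≤ k1 * (f + 1 + r ^ α + r' ^ α) := le_mul_of_one_le_right a1 (by linarith)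
  have c2 : k2 * (1 + r ^ α) ≤ k2 * (f + 1 + r ^ α + r' ^ α) :=
    mul_le_mul_of_nonneg_left (by linarith) a2
  have c3 : k3 ≤ k3 * (f + 1 + r ^ α + r' ^ α) := le_mul_of_one_le_right a3 (by linarith)
  have c4 : k4 * r' ^ α ≤ k4 * (f + 1 + r ^ α + r' ^ α) :=
    mul_le_mul_of_nonneg_left (by linarith) a4
  linarith

variable {ι : V →L[ℝ] H} {A : V → StrongDual ℝ V} {B : V → HilbertSchmidt U H} {α : ℝ}

/-- Local monotonicity and hemicontinuity of `A` make `B` continuous along lines. -/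
theorem continuous_line_of_mono {K : ℝ → ℝ} {f δ : ℝ} (hα : 0 ≤ α) (hK : ∀ M, 0 ≤ K M)
    (hδ : 0 < δ)
    (hemi : ∀ u v x : V, Continuous fun l : ℝ => A (u + l • v) x)
    (hmono : ∀ M u v, ‖ι u‖ ≤ M → ‖ι v‖ ≤ M →
      2 * (A u - A v) (u - v) + δ ^ 2 * ‖B u - B v‖ ^ 2
        ≤ K M * (f + 1 + ‖u‖ ^ α + ‖v‖ ^ α) * ‖ι (u - v)‖ ^ 2) (u v : V) :
    Continuous fun l : ℝ => B (u + l • v) := by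
  refine continuous_iff_continuousAt.2 fun l₀ => ?_
  rw [ContinuousAt, tendsto_iff_norm_sub_tendsto_zero]
  set R := ‖u‖ + (|l₀| + 1) * ‖v‖ with hR
  set k := K (‖ι‖ * R) * (f + 1 + R ^ α + R ^ α) with hk
  have hRl : ∀ l : ℝ, |l - l₀| ≤ 1 → ‖u + l • v‖ ≤ R := by
    intro l hl
    refine (norm_add_le _ _).trans (add_le_add le_rfl ?_)
    rw [norm_smul, Real.norm_eq_abs]
    refine mul_le_mul_of_nonneg_right ?_ (norm_nonneg _)
    have := abs_sub_abs_le_abs_sub l l₀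
    linarith
  have hbound : ∀ᶠ l in 𝓝 l₀, ‖B (u + l • v) - B (u + l₀ • v)‖ ^ 2
      ≤ (δ ^ 2)⁻¹ * (k * ‖ι ((l - l₀) • v)‖ ^ 2
        - 2 * ((l - l₀) * (A (u + l • v) v - A (u + l₀ • v) v))) := by
    filter_upwards [Metric.closedBall_mem_nhds l₀ one_pos] with l hl
    rw [Metric.mem_closedBall, Real.dist_eq] at hl
    have h1 := hRl l hl
    have h2 := hRl l₀ (by simp)
    have hι : ∀ z : V, ‖z‖ ≤ R → ‖ι z‖ ≤ ‖ι‖ * R := fun z hz =>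
      (ι.le_opNorm z).trans (mul_le_mul_of_nonneg_left hz (norm_nonneg _))
    have h3 := hmono _ _ _ (hι _ h1) (hι _ h2)
    have h4 : u + l • v - (u + l₀ • v) = (l - l₀) • v := by rw [sub_smul]; abel
    rw [h4, map_smul, sub_apply, smul_eq_mul] at h3
    have h5 : K (‖ι‖ * R) * (f + 1 + ‖u + l • v‖ ^ α + ‖u + l₀ • v‖ ^ α) ≤ k := by
      have := hK (‖ι‖ * R)
      rw [hk]
      gcongr
    have h6 := h3.trans (mul_le_mul_of_nonneg_right h5 (sq_nonneg _))
    rw [← div_eq_inv_mul, le_div_iff₀ (by positivity)]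
    linarith
  have hlim : Tendsto (fun l : ℝ => (δ ^ 2)⁻¹ * (k * ‖ι ((l - l₀) • v)‖ ^ 2
      - 2 * ((l - l₀) * (A (u + l • v) v - A (u + l₀ • v) v)))) (𝓝 l₀) (𝓝 0) := by
    have hA := hemi u v v
    have hB : Continuous fun l : ℝ => ‖ι ((l - l₀) • v)‖ ^ 2 := by fun_prop
    have hc : Continuous fun l : ℝ => (δ ^ 2)⁻¹ * (k * ‖ι ((l - l₀) • v)‖ ^ 2
        - 2 * ((l - l₀) * (A (u + l • v) v - A (u + l₀ • v) v))) :=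
      continuous_const.mul ((continuous_const.mul hB).sub (continuous_const.mul
        ((continuous_id.sub continuous_const).mul (hA.sub continuous_const))))
    have := hc.tendsto l₀
    simpa using this
  have h0 := squeeze_zero' (Eventually.of_forall fun l => sq_nonneg _) hbound hlim
  have h1 := h0.sqrt
  simpa [Real.sqrt_sq] using h1

/-- The full drift `A + B h` at a fixed time is admissible. -/
theorem pointwiseAdmissible_add [CompleteSpace H] {K : ℝ → ℝ} {f g δ c p β C L : ℝ} (hα : 1 < α)
    (hK : ∀ M, 0 ≤ K M) (hf : 0 ≤ f) (hg : 0 ≤ g) (hδ : 0 < δ) (hp : 1 < p) (hβ : 0 ≤ β)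
    (hC : 0 ≤ C) (hL : 0 ≤ L)
    (hemi : ∀ u v x : V, Continuous fun l : ℝ => A (u + l • v) x)
    (hmono : ∀ M u v, ‖ι u‖ ≤ M → ‖ι v‖ ≤ M →
      2 * (A u - A v) (u - v) + δ ^ 2 * ‖B u - B v‖ ^ 2
        ≤ K M * (f + 1 + ‖u‖ ^ α + ‖v‖ ^ α) * ‖ι (u - v)‖ ^ 2)
    (hcoer : ∀ u, 2 * A u u + (p - 1) * ‖B u‖ ^ 2 ≤ f * (1 + ‖ι u‖ ^ 2) - c * ‖u‖ ^ α)
    (hgA : ∀ u, ‖A u‖ ^ (α / (α - 1))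
      ≤ f * (1 + ‖ι u‖ ^ (2 + β)) + C * ‖u‖ ^ α * (1 + ‖ι u‖ ^ β))
    (hgB : ∀ u, ‖B u‖ ^ 2 ≤ g * (1 + ‖ι u‖ ^ 2) + L * (1 + ‖u‖ ^ α)) (h : U) :
    PointwiseAdmissible ι α c (fun M => K M + 1 + growthConstA β C M + growthConstB L M)
      (fun ε => |ε| ^ (1 - α) + |ε|⁻¹)
      (f + g + 1 + (1 + (δ ^ 2)⁻¹ + (p - 1)⁻¹) * ‖h‖ ^ 2)
      fun u => A u + toVDual ι ((B u).toCLM h) := by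
  have hp0 : 0 < p - 1 := sub_pos.2 hp
  have hs : 0 ≤ ‖h‖ ^ 2 := sq_nonneg _
  have hsδ : 0 ≤ (δ ^ 2)⁻¹ * ‖h‖ ^ 2 := by positivity
  have hsp : 0 ≤ (p - 1)⁻¹ * ‖h‖ ^ 2 := by positivity
  set φ := f + g + 1 + (1 + (δ ^ 2)⁻¹ + (p - 1)⁻¹) * ‖h‖ ^ 2 with hφ
  have hφ' : φ = f + g + 1 + ‖h‖ ^ 2 + (δ ^ 2)⁻¹ * ‖h‖ ^ 2 + (p - 1)⁻¹ * ‖h‖ ^ 2 := by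
    rw [hφ]; ring
  have hφ0 : 0 ≤ φ := by linarith
  have hinner : ∀ (S : HilbertSchmidt U H) (z : V),
      |inner ℝ (S.toCLM h) (ι z)| ≤ ‖S‖ * ‖h‖ * ‖ι z‖ := fun S z =>
    (abs_real_inner_le_norm _ _).trans
      (mul_le_mul_of_nonneg_right (S.norm_toCLM_apply_le h) (norm_nonneg _))
  refine ⟨hφ0, fun u v x => ?_, fun M u v hu hv => ?_, fun u => ?_, fun M u hu ε hε z => ?_⟩
  · have h1 := continuous_line_of_mono (by linarith) hK hδ hemi hmono u v
    have h2 : Continuous fun l : ℝ => inner ℝ ((B (u + l • v)).toCLM h) (ι x) :=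
      (((HilbertSchmidt.toCLML U H).continuous.comp h1).clm_apply continuous_const).inner
        continuous_const
    exact (hemi u v x).add h2
  · have h1 := hmono M u v hu hv
    have h2 := (le_abs_self _).trans (hinner (B u - B v) (u - v))
    have h3 := two_mul_mul_mul_le_sq (b := ‖B u - B v‖) (h := ‖h‖) (z := ‖ι (u - v)‖)
      (by positivity : 0 < δ ^ 2)
    have h4 : (A u + toVDual ι ((B u).toCLM h) - (A v + toVDual ι ((B v).toCLM h))) (u - v)
        = (A u - A v) (u - v) + inner ℝ ((B u - B v).toCLM h) (ι (u - v)) := by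
      have : (B u - B v).toCLM h = (B u).toCLM h - (B v).toCLM h := rfl
      rw [this, inner_sub_left]
      simp only [sub_apply, add_apply, toVDual_apply]
      ring
    have hX : 0 ≤ ‖u‖ ^ α := by positivity
    have hY : 0 ≤ ‖v‖ ^ α := by positivity
    have hKM := hK M
    have hA0 := growthConstA_nonneg (β := β) hC M
    have hB0 := growthConstB_nonneg hL M
    have h5 : K M * (f + 1 + ‖u‖ ^ α + ‖v‖ ^ α) + (δ ^ 2)⁻¹ * ‖h‖ ^ 2
        ≤ (K M + 1 + growthConstA β C M + growthConstB L M) * (φ + ‖u‖ ^ α + ‖v‖ ^ α) := by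
      have e1 : K M * (f + 1 + ‖u‖ ^ α + ‖v‖ ^ α) ≤ K M * (φ + ‖u‖ ^ α + ‖v‖ ^ α) :=
        mul_le_mul_of_nonneg_left (by linarith) hKM
      have e2 : 0 ≤ (growthConstA β C M + growthConstB L M) * (φ + ‖u‖ ^ α + ‖v‖ ^ α) := by
        positivity
      nlinarith
    have h6 := mul_le_mul_of_nonneg_right h5 (sq_nonneg ‖ι (u - v)‖)
    rw [h4]
    linarith
  · have h1 := hcoer u
    have h2 := (le_abs_self _).trans (hinner (B u) u)
    have h3 := two_mul_mul_mul_le_sq (b := ‖B u‖) (h := ‖h‖) (z := ‖ι u‖) hp0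
    have h4 : (f + (p - 1)⁻¹ * ‖h‖ ^ 2) * (1 + ‖ι u‖ ^ 2) ≤ φ * (1 + ‖ι u‖ ^ 2) :=
      mul_le_mul_of_nonneg_right (by linarith) (by positivity)
    rw [add_apply, toVDual_apply]
    linarith
  · have h1 : |A u z| ≤ ‖A u‖ * ‖z‖ := (A u).le_opNorm z
    have h2 := mul_le_mul_rpow_add_rpow hα hε (norm_nonneg (A u)) (norm_nonneg z)
    have h3 := growthA_le hf (norm_nonneg u) (norm_nonneg _) hβ hC hu (hgA u)
    have h4 := mul_mul_le_sq (b := ‖B u‖) (h := ‖h‖) (z := ‖ι z‖) hε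
    have h5 := growthB_le hg (norm_nonneg u) (norm_nonneg _) hL hu (hgB u)
    have h6 := hinner (B u) z
    have hA0 := growthConstA_nonneg (β := β) hC M
    have hB0 := growthConstB_nonneg hL M
    have hX : 0 ≤ ‖u‖ ^ α := by positivity
    have hZ : 0 ≤ ‖z‖ ^ α := by positivity
    have e1 : growthConstA β C M * (f + ‖u‖ ^ α) ≤ growthConstA β C M * (φ + ‖u‖ ^ α) :=
      mul_le_mul_of_nonneg_left (by linarith) hA0
    have e2 : growthConstB L M * (g + 1 + ‖u‖ ^ α) ≤ growthConstB L M * (φ + ‖u‖ ^ α) :=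
      mul_le_mul_of_nonneg_left (by linarith) hB0
    have e3 : 0 ≤ (K M + 1) * (φ + ‖u‖ ^ α) :=
      mul_nonneg (by linarith [hK M]) (by positivity)
    have e4 : ε * (‖A u‖ ^ (α / (α - 1)) + ‖B u‖ ^ 2)
        ≤ ε * ((K M + 1 + growthConstA β C M + growthConstB L M) * (φ + ‖u‖ ^ α)) :=
      mul_le_mul_of_nonneg_left (by linarith) hε.le
    have e5 : ‖h‖ ^ 2 * ‖ι z‖ ^ 2 ≤ φ * ‖ι z‖ ^ 2 :=
      mul_le_mul_of_nonneg_right (by linarith) (sq_nonneg _)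
    have e6 := mul_le_mul_of_nonneg_left e5 (inv_nonneg.2 hε.le)
    have e7 : 0 ≤ ε ^ (1 - α) * (φ * ‖ι z‖ ^ 2) := by positivity
    have e8 : 0 ≤ ε⁻¹ * ‖z‖ ^ α := by positivity
    rw [add_apply, toVDual_apply, abs_of_pos hε]
    refine (abs_add_le _ _).trans ?_
    linarith

end Drift

end SkeletonEq

namespace SkeletonEq

/-! ### The skeleton equation -/

section Skeleton

/-- A function that is measurable on `[0, T] × X` agrees there with a measurable function. -/
theorem exists_measurable_extension {T : ℝ} {X E : Type*} [MeasurableSpace X]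
    [MeasurableSpace E] [Nonempty E] {G : ℝ → X → E}
    (hG : Measurable fun q : Icc (0 : ℝ) T × X => G q.1 q.2) :
    ∃ G' : ℝ × X → E, Measurable G' ∧ ∀ t ∈ Icc 0 T, ∀ u, G' (t, u) = G t u := by
  have he : MeasurableEmbedding (Prod.map ((↑) : Icc (0 : ℝ) T → ℝ) (id : X → X)) :=
    (MeasurableEmbedding.subtype_coe measurableSet_Icc).prodMap MeasurableEmbedding.id
  obtain ⟨G', hG', hext⟩ := he.exists_measurable_extend hG fun _ => inferInstance
  exact ⟨G', hG', fun t ht u => congrFun hext (⟨t, ht⟩, u)⟩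

variable {V H U : Type*} [NormedAddCommGroup V] [NormedSpace ℝ V]
  [NormedAddCommGroup H] [InnerProductSpace ℝ H]
  [NormedAddCommGroup U] [InnerProductSpace ℝ U] [CompleteSpace U]
  {ι : V →L[ℝ] H} {T α β : ℝ} {A : ℝ → V → StrongDual ℝ V} {B : ℝ → V → HilbertSchmidt U H}
  {f : ℝ → ℝ} {h : ℝ → U} {x : H}

theorem norm_toVDual_le (ι : V →L[ℝ] H) (y : H) : ‖toVDual ι y‖ ≤ ‖ι‖ * ‖y‖ := by
  refine ((innerSL ℝ y).opNorm_comp_le ι).trans (le_of_eq ?_)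
  rw [innerSL_apply_norm, mul_comm]

/-- The equation in `V*` is equivalent to the equation tested with elements of `V`. -/
theorem toVDual_eq_iff_forall_inner {a b e : ℝ → StrongDual ℝ V} {t : ℝ} (ht : t ∈ Icc 0 T) {z : H}
    (hb : Integrable b (timeMeasure T)) (he : Integrable e (timeMeasure T))
    (ha : ∀ᵐ s ∂timeMeasure T, a s = b s + e s) :
    toVDual ι z = toVDual ι x + (∫ s in (0 : ℝ)..t, b s) + ∫ s in (0 : ℝ)..t, e s ↔
      ∀ v, inner ℝ z (ι v) = inner ℝ x (ι v) + ∫ s in (0 : ℝ)..t, a s v := by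
  have h0 : (0 : ℝ) ∈ Icc 0 T := ⟨le_rfl, ht.1.trans ht.2⟩
  have hb' := intervalIntegrable_of_mem hb h0 ht
  have he' := intervalIntegrable_of_mem he h0 ht
  have ha' : ∫ s in (0 : ℝ)..t, a s = (∫ s in (0 : ℝ)..t, b s) + ∫ s in (0 : ℝ)..t, e s := by
    rw [← intervalIntegral.integral_add hb' he']
    refine intervalIntegral.integral_congr_ae_restrict
      (ae_restrict_of_ae_restrict_of_subset ?_ ha)
    exact uIoc_subset_uIcc.trans (uIcc_subset_Icc h0 ht)
  have hai : IntervalIntegrable a volume 0 t :=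
    intervalIntegrable_of_mem ((hb.add he).congr (ha.mono fun s hs => hs.symm)) h0 ht
  rw [add_assoc, ← ha', ContinuousLinearMap.ext_iff]
  refine forall_congr' fun v => ?_
  rw [add_apply, ContinuousLinearMap.intervalIntegral_apply hai]
  rfl

/-- Reduction of the skeleton equation to an equation with an admissible drift. -/
theorem exists_admissibleDrift [MeasurableSpace V] [BorelSpace V] [CompleteSpace H]
    [SecondCountableTopology (StrongDual ℝ V)] [TopologicalSpace.SeparableSpace U] (hT : 0 < T)
    (hA : Measurable fun q : Icc (0 : ℝ) T × V => A q.1 q.2)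
    (hB : Measurable fun q : Icc (0 : ℝ) T × V => B q.1 q.2)
    (hf : IsL1Nonneg T f) (hα : 1 < α) (hβ : 0 ≤ β)
    (h1 : Hemicontinuity T A) (h2 : LocalMonotonicity T α β f ι A B)
    (h3 : Coercivity T α f ι A B) (h4 : GrowthA T α f ι A) (h5 : GrowthB T α ι B)
    (hh : MemLp h 2 (timeMeasure T)) :
    ∃ (c : ℝ) (K D F : ℝ → ℝ) (a : ℝ → V → StrongDual ℝ V), AdmissibleDrift ι α c T K D F a ∧
      (∀ᵐ t ∂timeMeasure T, ∀ u, a t u = A t u + toVDual ι ((B t u).toCLM (h t))) ∧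
      ∀ (y : ℝ → V) (M : ℝ), Measurable y → MemLp y (ENNReal.ofReal α) (timeMeasure T) →
        (∀ᵐ t ∂timeMeasure T, ‖ι (y t)‖ ≤ M) →
        Integrable (fun s => A s (y s)) (timeMeasure T) ∧
        Integrable (fun s => toVDual ι ((B s (y s)).toCLM (h s))) (timeMeasure T) := by
  obtain ⟨θ, δ, γ, κ, C, hθ, hθα, hδ, hγ, hκ, hC, ρ, η, -, -, hρ, hη, hmono⟩ := h2
  obtain ⟨c, p, hc, hp, hcoer⟩ := h3
  obtain ⟨β', C', hβ', hC', hgA⟩ := h4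
  obtain ⟨g, hg, L, hL, hgB⟩ := h5
  have hα0 : 0 < α := by linarith
  have : SecondCountableTopology U := UniformSpace.secondCountable_of_separable U
  borelize U
  obtain ⟨A', hA', hAA'⟩ := exists_measurable_extension hA
  obtain ⟨B', hB', hBB'⟩ := exists_measurable_extension hB
  set h' : ℝ → U := hh.1.mk h
  have hh'm : Measurable h' := hh.1.stronglyMeasurable_mk.measurable
  have hh' : ∀ᵐ t ∂timeMeasure T, h t = h' t := hh.1.ae_eq_mk
  have hmem : ∀ᵐ t ∂timeMeasure T, t ∈ Icc 0 T := ae_restrict_mem measurableSet_Icc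
  have hpair : Continuous fun q : HilbertSchmidt U H × U => toVDualL ι (q.1.toCLM q.2) :=
    (toVDualL ι).continuous.comp (((HilbertSchmidt.toCLML U H).continuous.comp
      continuous_fst).clm_apply continuous_snd)
  have hBh : Measurable fun q : ℝ × V => toVDual ι ((B' q).toCLM (h' q.1)) :=
    Continuous.measurable2 (c := fun S r => toVDual ι (S.toCLM r)) hpair hB'
      (hh'm.comp measurable_fst)
  have hfin : IsFiniteMeasure (timeMeasure T) :=
    inferInstanceAs (IsFiniteMeasure (volume.restrict (Icc 0 T)))
  have hh2 : Integrable (fun t => ‖h' t‖ ^ 2) (timeMeasure T) :=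
    (hh.ae_eq hh').norm.integrable_sq
  have hK : ∀ M, 0 ≤ monoConst β γ κ C M := monoConst_nonneg hC
  refine ⟨c, fun M => monoConst β γ κ C M + 1 + growthConstA β' C' M + growthConstB L M,
    fun ε => |ε| ^ (1 - α) + |ε|⁻¹,
    fun t => f t + g t + 1 + (1 + (δ ^ 2)⁻¹ + (p - 1)⁻¹) * ‖h' t‖ ^ 2,
    fun t u => A' (t, u) + toVDual ι ((B' (t, u)).toCLM (h' t)),
    ⟨hα, hc, hT, fun M => ?_, fun ε => by positivity, ?_, ?_, ?_⟩, ?_, ?_⟩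
  · have := hK M
    have := growthConstA_nonneg (β := β') hC'.le M
    have := growthConstB_nonneg hL.le M
    positivity
  · exact ((hf.1.add hg.1).add (integrable_const _)).add (hh2.const_mul _)
  · exact hA'.add hBh
  · filter_upwards [hmem, hf.2, hg.2, h1, hmono, hcoer, hgA, hgB] with t ht hft hgt hemi hm hco
      hga hgb
    have e : (fun u => A' (t, u) + toVDual ι ((B' (t, u)).toCLM (h' t)))
        = fun u => A t u + toVDual ι ((B t u).toCLM (h' t)) := by
      funext u
      rw [hAA' t ht, hBB' t ht]
    rw [e]
    refine pointwiseAdmissible_add hα hK hft hgt hδ hp hβ' hC'.le hL.le hemi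
      (fun M u v hu hv => (hm u v).trans (mul_le_mul_of_nonneg_right ?_ (sq_nonneg _)))
      hco hga hgb (h' t)
    exact mono_le hft (norm_nonneg _) (norm_nonneg _) (norm_nonneg _) (norm_nonneg _) hβ hγ hκ hθ
      hθα.le hC hu hv (hρ u) (hη v)
  · filter_upwards [hmem, hh'] with t ht hht u
    rw [hAA' t ht, hBB' t ht, hht]
  · intro y M hym hyα hyM
    have hyi := (integrable_norm_rpow_iff_memLp hα0 hyα.1).2 hyα
    have hq : Measurable fun s => (s, y s) := measurable_id.prodMk hym
    constructor
    · refine Integrable.mono' ((integrable_const 1).add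
        ((hf.1.add hyi).const_mul (growthConstA β' C' M))) ?_ ?_
      · refine (hA'.comp hq).stronglyMeasurable.aestronglyMeasurable.congr ?_
        filter_upwards [hmem] with t ht
        exact hAA' t ht _
      · filter_upwards [hgA, hyM, hf.2] with t h6 h7 h8
        have h9 := growthA_le h8 (norm_nonneg _) (norm_nonneg _) hβ' hC'.le h7 (h6 (y t))
        have h10 := rpow_le_one_add_rpow (norm_nonneg (A t (y t))) zero_le_one
          (show 1 ≤ α / (α - 1) by rw [le_div_iff₀ (by linarith)]; linarith)
        rw [Real.rpow_one] at h10
        exact h10.trans (add_le_add le_rfl h9)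
    · refine Integrable.mono' ((((hg.1.add (integrable_const 1)).add hyi).const_mul
        (growthConstB L M)).add hh2 |>.const_mul ‖ι‖) ?_ ?_
      · refine (hBh.comp hq).stronglyMeasurable.aestronglyMeasurable.congr ?_
        filter_upwards [hmem, hh'] with t ht hht
        simp only [Function.comp_apply, hBB' t ht, hht]
      · filter_upwards [hgB, hyM, hg.2, hh'] with t h6 h7 h8 h9
        have h10 := growthB_le h8 (norm_nonneg _) (norm_nonneg _) hL.le h7 (h6 (y t))
        refine (norm_toVDual_le ι _).trans (mul_le_mul_of_nonneg_left ?_ (norm_nonneg _))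
        refine ((B t (y t)).norm_toCLM_apply_le _).trans ?_
        rw [h9]
        have h11 := two_mul_le_add_sq ‖B t (y t)‖ ‖h' t‖
        have h12 : 0 ≤ ‖B t (y t)‖ * ‖h' t‖ := by positivity
        refine le_trans ?_ (add_le_add h10 le_rfl)
        linarith

end Skeleton

end SkeletonEq

theorem proposition4p2
    {V H U : Type*} [NormedAddCommGroup V] [NormedSpace ℝ V] [MeasurableSpace V] [BorelSpace V]
    [NormedAddCommGroup H] [InnerProductSpace ℝ H] [CompleteSpace H]
    [TopologicalSpace.SeparableSpace H]
    [NormedAddCommGroup U] [InnerProductSpace ℝ U] [CompleteSpace U]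
    [TopologicalSpace.SeparableSpace U]
    (hV : SkeletonEq.IsReflexiveBanach V)
    (ι : V →L[ℝ] H) (hι : SkeletonEq.IsGelfandEmbedding ι)
    (T : ℝ) (hT : 0 < T)
    (A : ℝ → V → StrongDual ℝ V)
    (hA : Measurable fun q : Set.Icc (0 : ℝ) T × V => A q.1 q.2)
    (B : ℝ → V → SkeletonEq.HilbertSchmidt U H)
    (hB : Measurable fun q : Set.Icc (0 : ℝ) T × V => B q.1 q.2)
    (f : ℝ → ℝ) (hf : SkeletonEq.IsL1Nonneg T f)
    (α β : ℝ) (hα : 1 < α) (hβ : 0 ≤ β)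
    (h1 : SkeletonEq.Hemicontinuity T A)
    (h2 : SkeletonEq.LocalMonotonicity T α β f ι A B)
    (h3 : SkeletonEq.Coercivity T α f ι A B)
    (h4 : SkeletonEq.GrowthA T α f ι A)
    (h5 : SkeletonEq.GrowthB T α ι B)
    (h : ℝ → U) (hh : MeasureTheory.MemLp h 2 (SkeletonEq.timeMeasure T))
    (x : H) :
    ∃! Y : C(Set.Icc (0 : ℝ) T, H), SkeletonEq.IsSkeletonSolution T α ι A B h x Y := by
  have : TopologicalSpace.SeparableSpace (StrongDual ℝ V) :=
    SkeletonEq.separableSpace_dual hV hι.1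
  have : SecondCountableTopology (StrongDual ℝ V) :=
    UniformSpace.secondCountable_of_separable _
  obtain ⟨c, K, D, F, a, had, ha, hInt⟩ := SkeletonEq.exists_admissibleDrift (ι := ι) hT hA hB hf
    hα hβ h1 h2 h3 h4 h5 hh
  have htested : ∀ Y : C(Set.Icc (0 : ℝ) T, H), SkeletonEq.IsSkeletonSolution T α ι A B h x Y →
      ∃ y, SkeletonEq.IsTestedSolution ι α T a x (Set.IccExtend hT.le Y) y := by
    rintro Y ⟨y, hyα, hyY, hAi, hBi, heq⟩
    have hmk := hyα.1.ae_eq_mk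
    refine ⟨hyα.1.mk y, Y.continuous.Icc_extend'.continuousOn, ?_, hyα.ae_eq hmk, ?_, ?_⟩
    · exact hyα.1.stronglyMeasurable_mk.measurable
    · filter_upwards [hmk, hyY, ae_restrict_mem measurableSet_Icc] with t e1 e2 ht
      rw [← e1, e2 ht, Set.IccExtend_of_mem hT.le _ ht]
    · intro v t ht
      rw [Set.IccExtend_of_mem hT.le _ ht]
      refine (SkeletonEq.toVDual_eq_iff_forall_inner ht hAi hBi ?_).1 (heq ⟨t, ht⟩) v
      filter_upwards [ha, hmk] with s e1 e2
      rw [e1, ← e2]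
  obtain ⟨w, y, hs⟩ := had.exists_solution hV hι x
  obtain ⟨M, hM⟩ := hs.exists_bound
  refine ⟨⟨(Set.Icc 0 T).domRestrict w, hs.continuousOn.domRestrict⟩, ?_, fun Y hY => ?_⟩
  · obtain ⟨hAi, hBi⟩ := hInt y M hs.measurable hs.memLp (by
      filter_upwards [hs.ae_eq, ae_restrict_mem measurableSet_Icc] with t e1 ht
      rw [e1]; exact hM t ht)
    refine ⟨y, hs.memLp, hs.ae_eq.mono fun t e _ => e, hAi, hBi, fun t => ?_⟩
    refine (SkeletonEq.toVDual_eq_iff_forall_inner t.2 hAi hBi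
      (ha.mono fun s e => e (y s))).2 fun v => ?_
    exact hs.equation v t t.2
  · obtain ⟨y', hs'⟩ := htested Y hY
    ext t
    have e := had.eqOn_of_isTestedSolution hι.2.1 hs' hs t.2
    rw [Set.IccExtend_of_mem hT.le _ t.2] at e
    exact e
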